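/- Let $\Omega=(0,1)\times(0,1)\times(-1,1)$ with periodic boundary conditions in all three directions, and let $L^2_\sigma(\Omega)$ be the closure in $L^2(\Omega)^3$ of the (real) smooth, periodic, divergence-free vector fields. Let $\mathbb P_\sigma$ be the Helmholtz projection. Let $A$ be one of the operators (i) $A=\nu(-\Delta)+\varepsilon(-\Delta)^{5/4}$ with $\varepsilon>0$, $\nu\ge 0$, or (ii) $A=\nu(-\Delta)+\varepsilon(-\Delta_H)^{2}$ with $\varepsilon>0$, $\nu>0$, where $\Delta_H=\partial_x^2+\partial_y^2$. Write $\hat u(k)$, $k\in\mathbb Z^3$, for the Fourier coefficients of $u$ with respect to $e^{i\xi_k\cdot x}$, $\xi_k=(2\pi k_1,2\pi k_2,\pi k_3)$, and $a(k)\ge 0$ for the Fourier symbol of $A$. For $s\in\mathbb R$ let $D(A^s)$ be the space of real periodic distributions $u$ with $\mathbb P_\sigma u=u$ and $\sum_{k}(1+a(k))^{2s}|\hat u(k)|^2<\infty$, normed by the square root of this sum. Let $0<T<\infty$ and $$\mathbb E_1(T)=L^2(0,T;D(A^{1/2}))\cap H^1(0,T;D(A^{-1/2}))\subset C([0,T];L^2_\sigma(\Omega)).$$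 Then for each $u_0\in L^2_\sigma(\Omega)$ and each $f\in L^2(0,T;D(A^{-1/2}))$ there is a unique $u\in\mathbb E_1(T)$ such that $$\partial_t u+Au+\mathbb P_\sigma(u\cdot\nabla u)=f \ \text{ in } D(A^{-1/2}) \text{ for almost every } t\in(0,T),\qquad u(0)=u_0.$$ Moreover, the representative of $u$ that is continuous on $[0,T]$ with values in $L^2_\sigma(\Omega)$ satisfies the energy equality $$\|u(t)\|_{L^2(\Omega)}^2+2\int_0^t\|A^{1/2}u(s)\|_{L^2(\Omega)}^2\,ds=\|u(0)\|_{L^2(\Omega)}^2+2\int_0^t f(s)\cdot u(s)\,ds,\qquad 0<t\le T,$$ where $f\cdot u$ denotes the pairing of $D(A^{-1/2})$ with $D(A^{1/2})$ that extends the inner product of $L^2(\Omega)^3$. -/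

import Mathlib

open MeasureTheory Set
open scoped ContDiff ENNReal

noncomputable section

namespace HNS

/-! ## Domain, periodic functions, solenoidal fields -/

/-- Points of space, and values of velocity fields. -/
abbrev E3 : Type := EuclideanSpace ℝ (Fin 3)

/-- The index set of the Fourier modes. -/
abbrev Freq : Type := Fin 3 → ℤ

/-- Values of Fourier coefficients of velocity fields. -/
abbrev C3 : Type := EuclideanSpace ℂ (Fin 3)

/-- The cell `Ω = (0,1) × (0,1) × (-1,1)`. -/
def Ω : Set E3 := {x | x 0 ∈ Ioo (0 : ℝ) 1 ∧ x 1 ∈ Ioo (0 : ℝ) 1 ∧ x 2 ∈ Ioo (-1 : ℝ) 1}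

/-- The side lengths of `Ω`, i.e. the periods in the three directions. -/
def period : Fin 3 → ℝ := ![1, 1, 2]

/-- Lebesgue measure on `Ω`. -/
abbrev μΩ : Measure E3 := volume.restrict Ω

/-- `L²(Ω)³`, real vector fields. -/
abbrev L2 : Type := Lp E3 2 μΩ

/-- The space `C^∞_per` of smooth functions that are periodic in all three directions (each is given
by its periodic extension to the whole space). -/
def IsSmoothPeriodic {F : Type*} [NormedAddCommGroup F] [NormedSpace ℝ F] (φ : E3 → F) : Prop :=
  ContDiff ℝ ∞ φ ∧ ∀ (j : Fin 3) (x : E3), φ (x + EuclideanSpace.single j (period j)) = φ x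

/-- The partial derivative `∂_j φ`. -/
def partialDeriv {F : Type*} [NormedAddCommGroup F] [NormedSpace ℝ F] (j : Fin 3) (φ : E3 → F)
    (x : E3) : F :=
  fderiv ℝ φ x (EuclideanSpace.single j 1)

/-- The divergence of a vector field. -/
def divergence (φ : E3 → E3) (x : E3) : ℝ := ∑ j, partialDeriv j φ x j

/-- The fields in `L²(Ω)³` that are smooth, periodic and divergence free. -/
def smoothSolenoidal : Submodule ℝ L2 where
  carrier := {u | ∃ φ : E3 → E3, IsSmoothPeriodic φ ∧ (∀ x, divergence φ x = 0) ∧ u =ᵐ[μΩ] φ}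
  zero_mem' := by
    refine ⟨fun _ => 0, ⟨contDiff_const, fun _ _ => rfl⟩, fun x => ?_, Lp.coeFn_zero _ _ _⟩
    simp [divergence, partialDeriv]
  add_mem' := by
    rintro u v ⟨φ, hφ, hφd, hu⟩ ⟨ψ, hψ, hψd, hv⟩
    refine ⟨fun x => φ x + ψ x, ⟨hφ.1.add hψ.1, fun j x => ?_⟩, fun x => ?_, ?_⟩
    · simp only [hφ.2 j x, hψ.2 j x]
    · have h1 : DifferentiableAt ℝ φ x := (hφ.1.differentiable (by simp)).differentiableAt
      have h2 : DifferentiableAt ℝ ψ x := (hψ.1.differentiable (by simp)).differentiableAt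
      have := congrArg₂ (· + ·) (hφd x) (hψd x)
      simp only [divergence, partialDeriv, ← Finset.sum_add_distrib, add_zero] at this
      simpa [divergence, partialDeriv, fderiv_fun_add h1 h2] using this
    · filter_upwards [hu, hv, Lp.coeFn_add u v] with x h1 h2 h3
      exact h3.trans (congrArg₂ (· + ·) h1 h2)
  smul_mem' := by
    rintro c u ⟨φ, hφ, hφd, hu⟩
    refine ⟨fun x => c • φ x, ⟨hφ.1.const_smul c, fun j x => ?_⟩, fun x => ?_, ?_⟩
    · simp only [hφ.2 j x]
    · have h1 : DifferentiableAt ℝ φ x := (hφ.1.differentiable (by simp)).differentiableAt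
      have := congrArg (c * ·) (hφd x)
      simp only [divergence, partialDeriv, Finset.mul_sum, mul_zero] at this
      simpa [divergence, partialDeriv, fderiv_fun_const_smul h1 c] using this
    · filter_upwards [hu, Lp.coeFn_smul c u] with x h1 h2
      exact h2.trans (congrArg (c • ·) h1)

/-- `L²_σ(Ω)`: the closure in `L²` of the smooth periodic divergence free fields. -/
def L2sigma : Submodule ℝ L2 := smoothSolenoidal.topologicalClosure

/-! ## Fourier coefficients -/

/-- The wave vector `(2π k₁, 2π k₂, π k₃)` of the mode `k`. -/
def wave (k : Freq) (j : Fin 3) : ℝ := 2 * Real.pi * (k j : ℝ) / period j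

/-- `|ξ|²` for the wave vector `ξ` of the mode `k`: the symbol of `-Δ`. -/
def waveSq (k : Freq) : ℝ := ∑ j, wave k j ^ 2

/-- The symbol of `-Δ_H = -∂_x² - ∂_y²`. -/
def waveHSq (k : Freq) : ℝ := wave k 0 ^ 2 + wave k 1 ^ 2

/-- The Fourier coefficients `(1/|Ω|) ∫_Ω e^{-i ξ·x} v(x) dx` of a vector field, with `|Ω| = 2`. -/
def fourier (v : E3 → E3) (k : Freq) : C3 :=
  WithLp.toLp 2 fun i =>
    (1 / 2 : ℂ) * ∫ x in Ω, Complex.exp (-(Complex.I * ∑ j, (wave k j : ℂ) * (x j : ℂ))) * (v x i : ℂ)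

/-- The Helmholtz projection `ℙ_σ` on Fourier coefficients: the multiplier
`δ_{ij} - ξ_i ξ_j / |ξ|²`, and the identity on the mode `k = 0`. -/
def helmholtz (c : Freq → C3) (k : Freq) : C3 :=
  WithLp.toLp 2 fun i =>
    c k i - (wave k i : ℂ) * (∑ j, (wave k j : ℂ) * c k j) / (waveSq k : ℂ)

/-! ## The hyper-viscous operators and their scale of fractional power spaces -/

/-- The hyper-viscous operators
`A = ν (-Δ) + ε (-Δ)^{5/4}` with `ε > 0`, `ν ≥ 0`, and
`A = ν (-Δ) + ε (-Δ_H)²` with `ε > 0`, `ν > 0`. -/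
inductive HyperOp : Type
  | full (ν ε : ℝ) (hν : 0 ≤ ν) (hε : 0 < ε)
  | horizontal (ν ε : ℝ) (hν : 0 < ν) (hε : 0 < ε)

/-- The Fourier symbol `a(k)` of the operator `A`. -/
def HyperOp.symbol : HyperOp → Freq → ℝ
  | .full ν ε _ _, k => ν * waveSq k + ε * waveSq k ^ (5 / 4 : ℝ)
  | .horizontal ν ε _ _, k => ν * waveSq k + ε * waveHSq k ^ 2

theorem waveSq_nonneg (k : Freq) : 0 ≤ waveSq k := Finset.sum_nonneg fun _ _ => sq_nonneg _

theorem HyperOp.symbol_nonneg (A : HyperOp) (k : Freq) : 0 ≤ A.symbol k := by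
  have h := waveSq_nonneg k
  cases A with
  | full ν ε hν hε => exact add_nonneg (mul_nonneg hν h) (mul_nonneg hε.le (Real.rpow_nonneg h _))
  | horizontal ν ε hν hε => exact add_nonneg (mul_nonneg hν.le h) (mul_nonneg hε.le (sq_nonneg _))

theorem HyperOp.weight_pos (A : HyperOp) (s : ℝ) (k : Freq) : 0 < (1 + A.symbol k) ^ s :=
  Real.rpow_pos_of_pos (by linarith [A.symbol_nonneg k]) s

/-- The families of Fourier coefficients of the real (`c(-k) = conj c(k)`), solenoidal
(`ξ · c(k) = 0`, i.e. `ℙ_σ u = u`) periodic distributions `u` with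
`∑_k (1 + a(k))^{2s} |c(k)|² < ∞`. -/
def domFamilies (A : HyperOp) (s : ℝ) : Submodule ℝ (Freq → C3) where
  carrier := {c | (∀ k j, c (-k) j = starRingEnd ℂ (c k j)) ∧
    (∀ k, ∑ j, (wave k j : ℂ) * c k j = 0) ∧
    Memℓp (fun k => (1 + A.symbol k) ^ s • c k) 2}
  zero_mem' := by
    refine ⟨by simp, by simp, ?_⟩
    convert zero_memℓp (E := fun _ : Freq => C3) (p := 2) using 1
    ext; simp
  add_mem' := by
    rintro c d ⟨h1, h2, h3⟩ ⟨h4, h5, h6⟩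
    refine ⟨fun k j => by simp [h1, h4], fun k => ?_, ?_⟩
    · simp [mul_add, Finset.sum_add_distrib, h2, h5]
    · convert h3.add h6 using 1
      ext; simp
  smul_mem' := by
    rintro r c ⟨h1, h2, h3⟩
    refine ⟨fun k j => by simp [h1], fun k => ?_, ?_⟩
    · have := congrArg ((r : ℂ) * ·) (h2 k)
      simp only [Finset.mul_sum, mul_zero] at this
      rw [← this]
      exact Finset.sum_congr rfl fun j _ => by simp; ring
    · convert h3.const_smul r using 1
      ext k : 1
      exact smul_comm ((1 + A.symbol k) ^ s) r (c k)

/-- The space `D(A^s)`, `s ∈ ℝ`, of the interpolation-extrapolation scale, with the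
norm `(∑_k (1 + a(k))^{2s} |c(k)|²)^{1/2}`. Its elements are real solenoidal periodic distributions,
given by their Fourier coefficients. -/
def Dom (A : HyperOp) (s : ℝ) : Type := domFamilies A s

instance (A : HyperOp) (s : ℝ) : AddCommGroup (Dom A s) :=
  inferInstanceAs (AddCommGroup (domFamilies A s))

instance (A : HyperOp) (s : ℝ) : Module ℝ (Dom A s) :=
  inferInstanceAs (Module ℝ (domFamilies A s))

/-- The Fourier coefficients of an element of `D(A^s)`. -/
def Dom.coef {A : HyperOp} {s : ℝ} (c : Dom A s) : Freq → C3 := c.1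

/-- The map `c ↦ ((1 + a(k))^s c(k))_k` from `D(A^s)` to `ℓ²`. -/
def Dom.toSeq (A : HyperOp) (s : ℝ) : Dom A s →ₗ[ℝ] lp (fun _ : Freq => C3) 2 where
  toFun c := ⟨fun k => (1 + A.symbol k) ^ s • c.coef k, c.2.2.2⟩
  map_add' c d := by
    ext k : 2
    exact smul_add _ _ _
  map_smul' r c := by
    ext k : 2
    exact smul_comm ((1 + A.symbol k) ^ s) r (c.coef k)

theorem Dom.toSeq_injective (A : HyperOp) (s : ℝ) : Function.Injective (Dom.toSeq A s) := by
  intro c d h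
  apply Subtype.ext
  funext k
  have hk : (1 + A.symbol k) ^ s • c.coef k = (1 + A.symbol k) ^ s • d.coef k :=
    congrFun (congrArg Subtype.val h) k
  exact smul_right_injective C3 (A.weight_pos s k).ne' hk

instance (A : HyperOp) (s : ℝ) : NormedAddCommGroup (Dom A s) :=
  NormedAddCommGroup.induced (Dom A s) (lp (fun _ : Freq => C3) 2) (Dom.toSeq A s)
    (Dom.toSeq_injective A s)

instance (A : HyperOp) (s : ℝ) : NormedSpace ℝ (Dom A s) :=
  NormedSpace.induced ℝ (Dom A s) (lp (fun _ : Freq => C3) 2) (Dom.toSeq A s)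

/-- `D(A^s)` is complete, so that integrals of functions with values in it are Bochner integrals. -/
instance (A : HyperOp) (s : ℝ) : CompleteSpace (Dom A s) := by
  have hiso : Isometry (Dom.toSeq A s) := AddMonoidHomClass.isometry_of_norm _ fun _ => rfl
  have hrange : range (Dom.toSeq A s) = {x : lp (fun _ : Freq => C3) 2 |
      (∀ k j, x (-k) j = starRingEnd ℂ (x k j)) ∧ ∀ k, ∑ j, (wave k j : ℂ) * x k j = 0} := by
    have hneg : ∀ k, A.symbol (-k) = A.symbol k := by
      intro k
      cases A <;> simp [HyperOp.symbol, waveSq, waveHSq, wave, neg_div]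
    ext x
    constructor
    · rintro ⟨c, rfl⟩
      refine ⟨fun k j => ?_, fun k => ?_⟩
      · have := c.2.1 k j
        change (((1 + A.symbol (-k)) ^ s : ℝ) • c.1 (-k)) j
          = starRingEnd ℂ ((((1 + A.symbol k) ^ s : ℝ) • c.1 k) j)
        simp [hneg, this]
      · have := congrArg ((((1 + A.symbol k) ^ s : ℝ) : ℂ) * ·) (c.2.2.1 k)
        simp only [Finset.mul_sum, mul_zero] at this
        rw [← this]
        refine Finset.sum_congr rfl fun j _ => ?_
        change (wave k j : ℂ) * (((1 + A.symbol k) ^ s : ℝ) • c.1 k) j = _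
        simp only [PiLp.smul_apply, Complex.real_smul]
        ring
    · rintro ⟨h1, h2⟩
      have hx : (fun k => (1 + A.symbol k) ^ s • (((1 + A.symbol k) ^ s)⁻¹ • x k)) = ⇑x := by
        funext k
        exact smul_inv_smul₀ (A.weight_pos s k).ne' _
      refine ⟨⟨fun k => ((1 + A.symbol k) ^ s)⁻¹ • x k, fun k j => ?_, fun k => ?_, ?_⟩, ?_⟩
      · simp [hneg, h1]
      · have := congrArg (((((1 + A.symbol k) ^ s)⁻¹ : ℝ) : ℂ) * ·) (h2 k)
        simp only [Finset.mul_sum, mul_zero] at this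
        rw [← this]
        refine Finset.sum_congr rfl fun j _ => ?_
        simp only [PiLp.smul_apply, Complex.real_smul]
        ring
      · rw [hx]
        exact x.2
      · exact Subtype.ext hx
  have hcont : ∀ k j, Continuous fun x : lp (fun _ : Freq => C3) 2 => x k j := by
    intro k j
    have h1 : Continuous fun x : lp (fun _ : Freq => C3) 2 => (x : Freq → C3) :=
      lp.uniformContinuous_coe.continuous
    have h2 : Continuous fun x : lp (fun _ : Freq => C3) 2 => x k := (continuous_apply k).comp h1
    exact (PiLp.continuous_apply 2 (fun _ : Fin 3 => ℂ) j).comp h2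
  have hclosed : IsClosed (range (Dom.toSeq A s)) := by
    rw [hrange]
    simp only [Set.ofPred_and, Set.ofPred_forall]
    refine (isClosed_iInter fun k => isClosed_iInter fun j => ?_).inter (isClosed_iInter fun k => ?_)
    · exact isClosed_eq (hcont _ _) (Complex.continuous_conj.comp (hcont _ _))
    · exact isClosed_eq (continuous_finsetSum _ fun j _ => continuous_const.mul (hcont _ _))
        continuous_const
  exact (completeSpace_iff_isComplete_range hiso.isUniformInducing).2 hclosed.isComplete

/-! ## The convection term -/

/-- `G j = ∂_j u` for `j = 1, 2, 3`, in the sense of weak derivatives of periodic functions. -/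
def IsWeakGradient (u : L2) (G : Fin 3 → L2) : Prop :=
  ∀ φ : E3 → ℝ, IsSmoothPeriodic φ → ∀ i j : Fin 3,
    ∫ x in Ω, u x i * partialDeriv j φ x = -∫ x in Ω, G j x i * φ x

/-- `u · ∇ u = ∑_j u_j ∂_j u`, where `G` is the gradient of `u`. -/
def convection (u : L2) (G : Fin 3 → L2) (x : E3) : E3 := ∑ j, u x j • G j x

/-! ## Function spaces in time -/

/-- Lebesgue measure on `(0,T)`. -/
abbrev timeMeasure (T : ℝ) : Measure ℝ := volume.restrict (Ioo 0 T)

/-- The function `U` with values in `D(A^s)` is the function `u` with values in `L²_σ(Ω)`,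
for almost all `t ∈ (0,T)`. -/
def Represents {A : HyperOp} {s : ℝ} (T : ℝ) (U : ℝ → Dom A s) (u : ℝ → L2sigma) : Prop :=
  ∀ᵐ t ∂timeMeasure T, (U t).coef = fourier (u t : L2)

/-- `u ∈ L²(0,T; D(A^s))`. -/
def MemL2Dom (A : HyperOp) (s T : ℝ) (u : ℝ → L2sigma) : Prop :=
  ∃ U : ℝ → Dom A s, MemLp U 2 (timeMeasure T) ∧ Represents T U u

/-- `g` is the weak derivative of `U` on `(0,T)`. -/
def IsWeakTimeDeriv {X : Type*} [NormedAddCommGroup X] [NormedSpace ℝ X] (T : ℝ) (U g : ℝ → X) :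
    Prop :=
  ∀ φ : ℝ → ℝ, ContDiff ℝ ∞ φ → HasCompactSupport φ → tsupport φ ⊆ Ioo 0 T →
    ∫ t in Ioo 0 T, deriv φ t • U t = -∫ t in Ioo 0 T, φ t • g t

/-- `u ∈ H¹(0,T; D(A^s))`, with `∂_t u = g`. -/
def HasH1DomDeriv (A : HyperOp) (s T : ℝ) (u : ℝ → L2sigma) (g : ℝ → Dom A s) : Prop :=
  MemLp g 2 (timeMeasure T) ∧
    ∃ U : ℝ → Dom A s, MemLp U 2 (timeMeasure T) ∧ Represents T U u ∧ IsWeakTimeDeriv T U g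

/-- `u ∈ 𝔼₁(T) = L²(0,T; D(A^{1/2})) ∩ H¹(0,T; D(A^{-1/2}))`. -/
def MemE1 (A : HyperOp) (T : ℝ) (u : ℝ → L2sigma) : Prop :=
  MemL2Dom A (1 / 2) T u ∧ ∃ g, HasH1DomDeriv A (-1 / 2) T u g

/-- `u(0) = u₀`: the representative of `u` in `C([0,T]; L²_σ(Ω))` has the value `u₀` at `t = 0`. -/
def HasInitialValue (T : ℝ) (u : ℝ → L2sigma) (u₀ : L2sigma) : Prop :=
  ∃ v : ℝ → L2sigma, ContinuousOn v (Icc 0 T) ∧ u =ᵐ[timeMeasure T] v ∧ v 0 = u₀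

/-! ## Strong solutions and the energy equality -/

/-- `u` is a strong solution on `(0,T)` of
`∂_t u + A u + ℙ_σ (u · ∇ u) = f`, `u(0) = u₀`, the equation being an identity in `D(A^{-1/2})`,
that is, of Fourier coefficients, for almost all `t`. -/
structure IsStrongSolution (A : HyperOp) (T : ℝ) (u₀ : L2sigma) (f : ℝ → Dom A (-1 / 2))
    (u : ℝ → L2sigma) : Prop where
  memE1 : MemE1 A T u
  equation : ∃ g : ℝ → Dom A (-1 / 2), HasH1DomDeriv A (-1 / 2) T u g ∧
    ∀ᵐ t ∂timeMeasure T, ∃ G : Fin 3 → L2, IsWeakGradient (u t : L2) G ∧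
      ∀ k : Freq, (g t).coef k + A.symbol k • fourier (u t : L2) k
        + helmholtz (fourier (convection (u t : L2) G)) k = (f t).coef k
  initial : HasInitialValue T u u₀

/-- `‖A^{1/2} u‖²_{L²(Ω)}`, by Parseval's identity on `Ω`, where `|Ω| = 2`. -/
def dissipation (A : HyperOp) (u : L2) : ℝ := 2 * ∑' k : Freq, A.symbol k * ‖fourier u k‖ ^ 2

/-- The pairing `f · u` of `f ∈ D(A^{-1/2})` with `u ∈ D(A^{1/2})`, extending the inner product
`∫_Ω f · u dx` of `L²(Ω)³` (Parseval's identity on `Ω`, where `|Ω| = 2`). -/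
def pairing {A : HyperOp} (f : Dom A (-1 / 2)) (u : L2) : ℝ :=
  2 * ∑' k : Freq, (inner ℂ (f.coef k) (fourier u k)).re

end HNS

end

/-!
The equation is an equation for the Fourier coefficients, and everything is done with families of
coefficients `c : Freq → C3` and the extended sums
`en A s c = ∑ (1 + a(k))^{2s} |c(k)|²`, the squares of the norms of `D(A^s)`.

*The convection term.* `ℙ_σ (u · ∇ v)` has the coefficients `bil u v`, a projected convolution. The
point of the hyper-viscosity is the estimate (`HyperOp.exists_en_bil_sq_le`)
`‖bil u v‖²_{-1/2} ≤ C ‖u‖_0 ‖u‖_{1/2} ‖v‖_0 ‖v‖_{1/2}`. It follows from a bound of the convolution on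
the lattice of frequencies (`HyperOp.exists_conv_bound`), for which only two properties of the symbol
matter (`HyperOp.exists_count`): with `σ = (1 + a)^{1/2}` there is `0 ≤ θ < 1` such that at most
`C R^{2+θ}` frequencies have `σ ≤ R`, and `|ξ|² ≤ C σ^{2-θ}`. In addition
`⟨bil u u, u⟩ = 0` (`pair_bil_self`).

*The dictionary.* The Fourier coefficients of the fields in `L²_σ(Ω)` are exactly the square summable
families with the symmetries of real solenoidal fields (`exists_L2sigma_fourier_eq`), weak gradients
are multiplications by `i ξ` (`isWeakGradient_iff`), and products are convolutions
(`hasSum_fourier_convection`). By the lemma of du Bois-Reymond (`ae_eq_const_add_primitive`) the weak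
equation in `D(A^{-1/2})` is equivalent to an integral equation for each coefficient. Thus strong
solutions are the same as solutions of the equation for the coefficients
(`IsStrongSolution.exists_isModalSolution`, `IsModalSolution.exists_isStrongSolution`).

*Energy equality and uniqueness.* By the estimate of the convection term all terms of the equation lie
in the dual space `L²(0,T; D(A^{-1/2}))`, so that `‖u‖²` is a primitive of `2⟨∂_t u, u⟩`
(`energy_identity`), and this is the energy equality (`IsModalSolution.energy`). The difference `w` of two
solutions satisfies the same kind of identity; by the estimate of the convection term and Young's
inequality `‖w(t)‖² ≤ ∫ m ‖w‖²` with an integrable `m`, and `w = 0` by Gronwall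
(`IsModalSolution.unique`).

*Existence.* The Galerkin approximations obey energy bounds that are uniform in the truncation
(`exists_galerkin`). A subsequence converges in every mode (`exists_subseq_galerkin_tendsto`), hence
strongly in `L²(0,T; L²(Ω))` because `D(A^{1/2})` controls the high frequencies
(`tendsto_lintegral_en_zero`), and each coefficient of the convection term is continuous in that
topology (`tendsto_integral_rhs`).
-/

noncomputable section

namespace HNS

/-! ### Counting frequencies by the size of the symbol -/

/-- The square root `σ(k) = (1 + a(k))^{1/2}` of the weight of the scale `D(A^s)`. -/
def HyperOp.sig (A : HyperOp) (k : Freq) : ℝ := √(1 + A.symbol k)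

theorem HyperOp.one_le_sig (A : HyperOp) (k : Freq) : 1 ≤ A.sig k :=
  Real.one_le_sqrt.2 (by linarith [A.symbol_nonneg k])

theorem HyperOp.sig_pos (A : HyperOp) (k : Freq) : 0 < A.sig k :=
  zero_lt_one.trans_le (A.one_le_sig k)

theorem HyperOp.sig_sq (A : HyperOp) (k : Freq) : A.sig k ^ 2 = 1 + A.symbol k :=
  Real.sq_sqrt (by linarith [A.symbol_nonneg k])

theorem wave_neg (k : Freq) (j : Fin 3) : wave (-k) j = -wave k j := by
  simp [wave, neg_div]

theorem wave_add (k l : Freq) (j : Fin 3) : wave (k + l) j = wave k j + wave l j := by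
  simp [wave, mul_add, add_div]

theorem wave_sub (k l : Freq) (j : Fin 3) : wave (k - l) j = wave k j - wave l j := by
  simp [wave, mul_sub, sub_div]

theorem waveSq_neg (k : Freq) : waveSq (-k) = waveSq k := by
  simp [waveSq, wave_neg]

theorem HyperOp.symbol_neg (A : HyperOp) (k : Freq) : A.symbol (-k) = A.symbol k := by
  cases A <;> simp [HyperOp.symbol, waveSq_neg, waveHSq, wave_neg]

theorem HyperOp.sig_neg (A : HyperOp) (k : Freq) : A.sig (-k) = A.sig k := by
  simp [HyperOp.sig, A.symbol_neg]

theorem waveSq_add_le (k l : Freq) : waveSq (k + l) ≤ 2 * (waveSq k + waveSq l) := by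
  simp only [waveSq, wave_add, ← Finset.sum_add_distrib, Finset.mul_sum]
  exact Finset.sum_le_sum fun j _ => by nlinarith [sq_nonneg (wave k j - wave l j)]

theorem HyperOp.symbol_add_le (A : HyperOp) (k l : Freq) :
    A.symbol (k + l) ≤ 8 * (A.symbol k + A.symbol l) := by
  have h := waveSq_add_le k l
  have hk := waveSq_nonneg k
  have hl := waveSq_nonneg l
  cases A with
  | full ν ε hν hε =>
    have h1 : waveSq (k + l) ^ (5 / 4 : ℝ)
        ≤ 8 * (waveSq k ^ (5 / 4 : ℝ) + waveSq l ^ (5 / 4 : ℝ)) := by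
      calc waveSq (k + l) ^ (5 / 4 : ℝ)
          ≤ (2 * (waveSq k + waveSq l)) ^ (5 / 4 : ℝ) :=
            Real.rpow_le_rpow (waveSq_nonneg _) h (by norm_num)
        _ = 2 ^ (5 / 4 : ℝ) * (waveSq k + waveSq l) ^ (5 / 4 : ℝ) :=
            Real.mul_rpow (by norm_num) (by positivity)
        _ ≤ 2 ^ (2 : ℝ) * (2 ^ (5 / 4 - 1 : ℝ)
              * (waveSq k ^ (5 / 4 : ℝ) + waveSq l ^ (5 / 4 : ℝ))) := by
            gcongr
            · norm_num
            · norm_num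
            · exact_mod_cast NNReal.rpow_add_le_mul_rpow_add_rpow ⟨_, hk⟩ ⟨_, hl⟩ (by norm_num : (1 : ℝ) ≤ 5 / 4)
        _ ≤ 2 ^ (2 : ℝ) * (2 ^ (1 : ℝ)
              * (waveSq k ^ (5 / 4 : ℝ) + waveSq l ^ (5 / 4 : ℝ))) := by
            gcongr <;> norm_num
        _ = _ := by norm_num; ring
    simp only [HyperOp.symbol]
    nlinarith [mul_le_mul_of_nonneg_left h hν, mul_le_mul_of_nonneg_left h1 hε.le,
      mul_nonneg hν hk, mul_nonneg hν hl]
  | horizontal ν ε hν hε =>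
    have h1 : waveHSq (k + l) ≤ 2 * (waveHSq k + waveHSq l) := by
      simp only [waveHSq, wave_add]
      nlinarith [sq_nonneg (wave k 0 - wave l 0), sq_nonneg (wave k 1 - wave l 1)]
    have h0 : ∀ k, 0 ≤ waveHSq k := fun k => by unfold waveHSq; positivity
    have h2 : waveHSq (k + l) ^ 2 ≤ 8 * (waveHSq k ^ 2 + waveHSq l ^ 2) := by
      nlinarith [pow_le_pow_left₀ (h0 _) h1 2, sq_nonneg (waveHSq k - waveHSq l)]
    simp only [HyperOp.symbol]
    nlinarith [mul_le_mul_of_nonneg_left h hν.le, mul_le_mul_of_nonneg_left h2 hε.le,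
      mul_nonneg hν.le hk, mul_nonneg hν.le hl]

theorem HyperOp.sig_add_le (A : HyperOp) (k l : Freq) :
    A.sig (k + l) ≤ 3 * (A.sig k + A.sig l) := by
  have := A.symbol_add_le k l
  refine (sq_le_sq₀ (A.sig_pos _).le (by have := A.sig_pos k; have := A.sig_pos l; positivity)).1 ?_
  have h1 := A.sig_pos k
  have h2 := A.sig_pos l
  nlinarith [A.sig_sq k, A.sig_sq l, A.sig_sq (k + l), mul_pos h1 h2, A.symbol_nonneg k]

theorem abs_le_abs_wave (k : Freq) (j : Fin 3) : |(k j : ℝ)| ≤ |wave k j| := by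
  have hp : 0 < period j ∧ period j ≤ 2 := by
    fin_cases j <;> simp [period]
  have : wave k j = (2 * Real.pi / period j) * k j := by simp [wave]; ring
  rw [this, abs_mul]
  refine le_mul_of_one_le_left (abs_nonneg _) ?_
  rw [abs_of_pos (div_pos (by positivity) hp.1), one_le_div hp.1]
  linarith [Real.pi_gt_three]

theorem sq_le_waveSq (k : Freq) (j : Fin 3) : wave k j ^ 2 ≤ waveSq k :=
  Finset.single_le_sum (f := fun j => wave k j ^ 2) (fun _ _ => sq_nonneg _) (Finset.mem_univ j)

/-- A count of the frequencies in a box with half side lengths `x j ≥ 1`. -/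
theorem tsum_indicator_box_le {S : Set Freq} {x : Fin 3 → ℝ} (hx : ∀ j, 1 ≤ x j)
    (hS : ∀ k ∈ S, ∀ j, |(k j : ℝ)| ≤ x j) :
    ∑' k, S.indicator (fun _ => (1 : ℝ≥0∞)) k ≤ ENNReal.ofReal (27 * (x 0 * x 1 * x 2)) := by
  classical
  let F : Finset Freq := Fintype.piFinset fun j => Finset.Icc (-⌊x j⌋) ⌊x j⌋
  have hSF : ∀ k ∈ S, k ∈ F := by
    intro k hk
    simp only [F, Fintype.mem_piFinset, Finset.mem_Icc]
    intro j
    have h := abs_le.1 (hS k hk j)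
    have h1 : k j ≤ ⌊x j⌋ := Int.le_floor.2 h.2
    have h2 : -k j ≤ ⌊x j⌋ := Int.le_floor.2 (by push_cast; linarith)
    omega
  have hcard : (F.card : ℝ) ≤ 27 * (x 0 * x 1 * x 2) := by
    have h1 : ∀ j, (((Finset.Icc (-⌊x j⌋) ⌊x j⌋).card : ℕ) : ℝ) ≤ 3 * x j := by
      intro j
      have h0 : 0 ≤ ⌊x j⌋ := Int.floor_nonneg.2 (by linarith [hx j])
      have : (((Finset.Icc (-⌊x j⌋) ⌊x j⌋).card : ℤ) : ℝ) = ((2 * ⌊x j⌋ + 1 : ℤ) : ℝ) := by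
        rw [Int.card_Icc]
        congr 1
        omega
      rw [Int.cast_natCast] at this
      rw [this]
      push_cast
      linarith [Int.floor_le (x j), hx j]
    have h2 : (F.card : ℝ) = ∏ j, (((Finset.Icc (-⌊x j⌋) ⌊x j⌋).card : ℕ) : ℝ) := by
      simp only [F, Fintype.card_piFinset]
      push_cast
      rfl
    rw [h2]
    refine (Finset.prod_le_prod (fun _ _ => Nat.cast_nonneg _) fun j _ => h1 j).trans ?_
    rw [Fin.prod_univ_three]
    exact le_of_eq (by ring)
  calc ∑' k, S.indicator (fun _ => (1 : ℝ≥0∞)) k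
      ≤ ∑' k, (F : Set Freq).indicator (fun _ => (1 : ℝ≥0∞)) k :=
        ENNReal.tsum_le_tsum fun k => Set.indicator_le_indicator_of_subset hSF (by simp) k
    _ = F.card := by
        rw [tsum_eq_sum (s := F) fun k hk => by simp [hk]]
        rw [Finset.sum_congr rfl fun k hk => Set.indicator_of_mem (Finset.mem_coe.2 hk) _]
        simp
    _ ≤ _ := by
        rw [← ENNReal.ofReal_natCast]
        exact ENNReal.ofReal_le_ofReal hcard

/-- The number of frequencies with `σ(k) ≤ R` grows like `R ^ (2 + θ)`, and `|ξ|²` is controlled by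
`(σ(k)²) ^ (1 - θ/2)`: here `θ = 2/5` for the isotropic operator and `θ = 0` for the horizontal one.
That the loss of one derivative matches the growth of the count is the criticality of the operators
considered. -/
theorem HyperOp.exists_count (A : HyperOp) : ∃ θ C : ℝ, 0 ≤ θ ∧ θ < 1 ∧ 1 ≤ C ∧
    (∀ R, 1 ≤ R → ∑' k, {k | A.sig k ≤ R}.indicator (fun _ => (1 : ℝ≥0∞)) k
      ≤ ENNReal.ofReal (C * R ^ (2 + θ))) ∧
    ∀ k, waveSq k / (1 + A.symbol k) ≤ C * A.sig k ^ (-θ) := by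
  have hsig : ∀ k R, A.sig k ≤ R → 1 + A.symbol k ≤ R ^ 2 := fun k R h => by
    rw [← A.sig_sq]
    exact pow_le_pow_left₀ (A.sig_pos k).le h 2
  have habs : ∀ (k : Freq) j, (k j : ℝ) ^ 2 ≤ wave k j ^ 2 := fun k j =>
    sq_le_sq.2 (abs_le_abs_wave k j)
  cases A with
  | full ν ε hν hε =>
    set A := HyperOp.full ν ε hν hε
    have hX : ∀ k, ∀ y, 1 + A.symbol k ≤ y → waveSq k ≤ (ε⁻¹) ^ (4 / 5 : ℝ) * y ^ (4 / 5 : ℝ) := by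
      intro k y h
      have h0 := waveSq_nonneg k
      have h1 : waveSq k ^ (5 / 4 : ℝ) ≤ ε⁻¹ * y := by
        rw [inv_mul_eq_div, le_div_iff₀ hε]
        have := mul_nonneg hν h0
        simp only [A, HyperOp.symbol] at h
        linarith
      have hy : 0 ≤ y := by linarith [A.symbol_nonneg k]
      calc waveSq k = (waveSq k ^ (5 / 4 : ℝ)) ^ (4 / 5 : ℝ) := by
            rw [← Real.rpow_mul h0]; norm_num
        _ ≤ (ε⁻¹ * y) ^ (4 / 5 : ℝ) :=
            Real.rpow_le_rpow (Real.rpow_nonneg h0 _) h1 (by norm_num)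
        _ = _ := Real.mul_rpow (by positivity) hy
    set c : ℝ := max 1 ((ε⁻¹) ^ (4 / 5 : ℝ))
    have hc1 : 1 ≤ c := le_max_left _ _
    have hc2 : (ε⁻¹) ^ (4 / 5 : ℝ) ≤ c := le_max_right _ _
    refine ⟨2 / 5, 27 * c ^ 3, by norm_num, by norm_num, ?_, fun R hR => ?_, fun k => ?_⟩
    · nlinarith [one_le_pow₀ hc1 (n := 3)]
    · have hR1 : 1 ≤ R ^ (4 / 5 : ℝ) := Real.one_le_rpow hR (by norm_num)
      refine (tsum_indicator_box_le (x := fun _ => c * R ^ (4 / 5 : ℝ)) (fun _ => ?_) ?_).trans ?_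
      · nlinarith
      · intro k hk j
        refine abs_le_of_sq_le_sq ?_ (by positivity)
        have hR2 : (R ^ 2) ^ (4 / 5 : ℝ) = (R ^ (4 / 5 : ℝ)) ^ 2 := by
          rw [← Real.rpow_natCast, ← Real.rpow_natCast, ← Real.rpow_mul (by linarith),
            ← Real.rpow_mul (by linarith)]
          norm_num
        calc (k j : ℝ) ^ 2 ≤ waveSq k := (habs k j).trans (sq_le_waveSq k j)
          _ ≤ (ε⁻¹) ^ (4 / 5 : ℝ) * (R ^ 2) ^ (4 / 5 : ℝ) := hX k _ (hsig k R hk)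
          _ ≤ c * (R ^ (4 / 5 : ℝ)) ^ 2 := by rw [hR2]; gcongr
          _ ≤ (c * R ^ (4 / 5 : ℝ)) ^ 2 := by
              rw [mul_pow]; gcongr; nlinarith
      · refine ENNReal.ofReal_le_ofReal (le_of_eq ?_)
        have : R ^ (2 + 2 / 5 : ℝ) = (R ^ (4 / 5 : ℝ)) ^ 3 := by
          rw [← Real.rpow_natCast, ← Real.rpow_mul (by linarith)]
          norm_num
        rw [this]; ring
    · have hw : 0 < 1 + A.symbol k := by linarith [A.symbol_nonneg k]
      have h1 : A.sig k ^ (-(2 / 5) : ℝ) = (1 + A.symbol k) ^ (-(1 / 5) : ℝ) := by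
        rw [← A.sig_sq, ← Real.rpow_natCast, ← Real.rpow_mul (A.sig_pos k).le]
        norm_num
      rw [h1, div_le_iff₀ hw]
      have h2 : (1 + A.symbol k) ^ (-(1 / 5) : ℝ) * (1 + A.symbol k)
          = (1 + A.symbol k) ^ (4 / 5 : ℝ) := by
        nth_rw 2 [← Real.rpow_one (1 + A.symbol k)]
        rw [← Real.rpow_add hw]; norm_num
      rw [mul_assoc, h2]
      refine (hX k _ le_rfl).trans ?_
      gcongr
      nlinarith [one_le_pow₀ hc1 (n := 3), one_le_pow₀ hc1 (n := 2)]
  | horizontal ν ε hν hε =>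
    set A := HyperOp.horizontal ν ε hν hε
    have hν1 : ∀ k, waveSq k ≤ ν⁻¹ * (1 + A.symbol k) := by
      intro k
      rw [inv_mul_eq_div, le_div_iff₀ hν]
      have := mul_nonneg hε.le (sq_nonneg (waveHSq k))
      simp only [A, HyperOp.symbol]
      linarith
    have hε1 : ∀ k, waveHSq k ^ 2 ≤ ε⁻¹ * (1 + A.symbol k) := by
      intro k
      rw [inv_mul_eq_div, le_div_iff₀ hε]
      have := mul_nonneg hν.le (waveSq_nonneg k)
      simp only [A, HyperOp.symbol]
      linarith
    set c : ℝ := max 1 (max ν⁻¹ ε⁻¹)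
    have hc1 : 1 ≤ c := le_max_left _ _
    have hc2 : ν⁻¹ ≤ c := (le_max_left _ _).trans (le_max_right _ _)
    have hc3 : ε⁻¹ ≤ c := (le_max_right _ _).trans (le_max_right _ _)
    refine ⟨0, 27 * c ^ 3, le_rfl, by norm_num, ?_, fun R hR => ?_, fun k => ?_⟩
    · nlinarith [one_le_pow₀ hc1 (n := 3)]
    · have hR1 : 1 ≤ √R := Real.one_le_sqrt.2 hR
      have hRR : √R ^ 2 = R := Real.sq_sqrt (by linarith)
      have hH : ∀ k, A.sig k ≤ R → ∀ j, (k j : ℝ) ^ 2 ≤ waveHSq k → |(k j : ℝ)| ≤ c * √R := by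
        intro k hk j hj
        refine abs_le_of_sq_le_sq ?_ (by positivity)
        refine hj.trans ((sq_le_sq₀ (by unfold waveHSq; positivity) (by positivity)).1 ?_)
        calc waveHSq k ^ 2 ≤ ε⁻¹ * (1 + A.symbol k) := hε1 k
          _ ≤ c * R ^ 2 := mul_le_mul hc3 (hsig k R hk) (by linarith [A.symbol_nonneg k]) (by linarith)
          _ ≤ c ^ 4 * (√R ^ 2) ^ 2 := by
              rw [hRR]; gcongr; exact le_self_pow₀ hc1 (by norm_num)
          _ = _ := by ring
      refine (tsum_indicator_box_le (x := ![c * √R, c * √R, c * R]) ?_ ?_).trans ?_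
      · intro j; fin_cases j <;> simp <;> nlinarith
      · intro k hk j
        fin_cases j
        · exact hH k hk 0 ((habs k 0).trans (by simp only [waveHSq]; nlinarith [sq_nonneg (wave k 1)]))
        · exact hH k hk 1 ((habs k 1).trans (by simp only [waveHSq]; nlinarith [sq_nonneg (wave k 0)]))
        · refine abs_le_of_sq_le_sq ?_ (by simp; positivity)
          calc (k 2 : ℝ) ^ 2 ≤ waveSq k := (habs k 2).trans (sq_le_waveSq k 2)
            _ ≤ ν⁻¹ * (1 + A.symbol k) := hν1 k
            _ ≤ c * R ^ 2 := mul_le_mul hc2 (hsig k R hk) (by linarith [A.symbol_nonneg k]) (by linarith)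
            _ ≤ (c * R) ^ 2 := by rw [mul_pow]; gcongr; exact le_self_pow₀ hc1 (by norm_num)
      · refine ENNReal.ofReal_le_ofReal (le_of_eq ?_)
        simp only [Matrix.cons_val_zero, Matrix.cons_val_one, Matrix.cons_val, add_zero,
          Real.rpow_two]
        nth_rw 4 [← hRR]
        nth_rw 3 [← hRR]
        ring
    · have hw : 0 < 1 + A.symbol k := by linarith [A.symbol_nonneg k]
      rw [neg_zero, Real.rpow_zero, mul_one, div_le_iff₀ hw]
      refine (hν1 k).trans ?_
      gcongr
      nlinarith [one_le_pow₀ hc1 (n := 3), one_le_pow₀ hc1 (n := 2)]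

/-! ### The critical convolution estimate -/

/-- Partial sums of `σ ^ (-p)` over the sublevel sets of `σ`, from the counting bound by halving the
level: the part with `R/2 < σ ≤ R` is bounded by the count, and the bounds sum up to a geometric
series. -/
theorem tsum_rpow_neg_le {ι : Type*} {σ : ι → ℝ} (hσ : ∀ k, 1 ≤ σ k) {C D p : ℝ} (hC : 0 ≤ C)
    (hp : 0 ≤ p) (hp1 : p ≤ 1) (hD : p + 1 ≤ D)
    (hcount : ∀ R, 1 ≤ R → ∑' k, {k | σ k ≤ R}.indicator (fun _ => (1 : ℝ≥0∞)) k
      ≤ ENNReal.ofReal (C * R ^ D)) (R : ℝ) (hR : 0 < R) :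
    ∑' k, {k | σ k ≤ R}.indicator (fun k => ENNReal.ofReal (σ k ^ (-p))) k
      ≤ ENNReal.ofReal (4 * C * R ^ (D - p)) := by
  obtain ⟨n, hn⟩ := pow_unbounded_of_one_lt R (one_lt_two)
  induction n generalizing R with
  | zero =>
    have : {k | σ k ≤ R} = ∅ := by
      ext k
      have := hσ k
      simp only [pow_zero] at hn
      simp only [mem_ofPred_eq, mem_empty_iff_false, iff_false, not_le]
      linarith
    simp [this]
  | succ n ih =>
    rcases lt_or_ge R 1 with h1 | h1
    · have : {k | σ k ≤ R} = ∅ := by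
        ext k
        have := hσ k
        simp only [mem_ofPred_eq, mem_empty_iff_false, iff_false, not_le]
        linarith
      simp [this]
    have hstep := ih (R / 2) (by positivity) (by rw [pow_succ] at hn; linarith)
    have hpt : ∀ k, {k | σ k ≤ R}.indicator (fun k => ENNReal.ofReal (σ k ^ (-p))) k
        ≤ {k | σ k ≤ R / 2}.indicator (fun k => ENNReal.ofReal (σ k ^ (-p))) k
          + ENNReal.ofReal ((R / 2) ^ (-p)) * {k | σ k ≤ R}.indicator (fun _ => (1 : ℝ≥0∞)) k := by
      intro k
      by_cases hk : σ k ≤ R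
      · rw [Set.indicator_of_mem (by exact hk), Set.indicator_of_mem (s := {k | σ k ≤ R}) (by exact hk),
          mul_one]
        by_cases hk2 : σ k ≤ R / 2
        · rw [Set.indicator_of_mem (by exact hk2)]
          exact le_self_add
        · refine le_add_left (ENNReal.ofReal_le_ofReal ?_)
          exact Real.rpow_le_rpow_of_nonpos (by positivity) (by linarith) (by linarith)
      · rw [Set.indicator_of_notMem (by exact hk)]
        exact zero_le
    calc _ ≤ _ := ENNReal.tsum_le_tsum hpt
      _ ≤ ENNReal.ofReal (4 * C * (R / 2) ^ (D - p))
          + ENNReal.ofReal ((R / 2) ^ (-p)) * ENNReal.ofReal (C * R ^ D) := by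
          rw [ENNReal.tsum_add, ENNReal.tsum_mul_left]
          gcongr
          exact hcount R h1
      _ ≤ _ := by
          rw [← ENNReal.ofReal_mul (by positivity), ← ENNReal.ofReal_add (by positivity) (by positivity)]
          refine ENNReal.ofReal_le_ofReal ?_
          have e1 : (R / 2) ^ (D - p) ≤ R ^ (D - p) / 2 := by
            rw [Real.div_rpow hR.le (by norm_num)]
            gcongr
            calc (2 : ℝ) = 2 ^ (1 : ℝ) := by norm_num
              _ ≤ _ := Real.rpow_le_rpow_of_exponent_le (by norm_num) (by linarith)
          have e2 : (R / 2) ^ (-p) ≤ 2 * R ^ (-p) := by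
            rw [Real.div_rpow hR.le (by norm_num), Real.rpow_neg (by norm_num : (0:ℝ) ≤ 2), div_inv_eq_mul,
              mul_comm]
            gcongr
            calc (2 : ℝ) ^ p ≤ 2 ^ (1 : ℝ) := Real.rpow_le_rpow_of_exponent_le (by norm_num) hp1
              _ = 2 := by norm_num
          have e3 : R ^ (D - p) = R ^ (-p) * R ^ D := by
            rw [← Real.rpow_add hR]; congr 1; ring
          have e4 : 0 ≤ R ^ D := by positivity
          calc 4 * C * (R / 2) ^ (D - p) + (R / 2) ^ (-p) * (C * R ^ D)
              ≤ 4 * C * (R ^ (D - p) / 2) + (2 * R ^ (-p)) * (C * R ^ D) := by gcongr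
            _ = 4 * C * R ^ (D - p) := by rw [e3]; ring

/-- The two sums that measure the kernel of the convection term: `|ξ|²/w · σ⁻¹ · ∑_{σ(l) ≤ σ} σ(l)⁻¹`
is bounded, and `∑_{σ(k) ≤ R} |ξ_k|²/w(k)` is `O(R²)`. -/
theorem HyperOp.exists_kernel_bounds (A : HyperOp) : ∃ C : ℝ≥0∞, C ≠ ⊤ ∧
    (∀ k, ENNReal.ofReal (waveSq k / (1 + A.symbol k)) * (ENNReal.ofReal (A.sig k))⁻¹ *
      ∑' l, {l | A.sig l ≤ A.sig k}.indicator (fun l => (ENNReal.ofReal (A.sig l))⁻¹) l ≤ C) ∧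
    ∀ m, ∑' k, {k | A.sig k ≤ A.sig m}.indicator
      (fun k => ENNReal.ofReal (waveSq k / (1 + A.symbol k))) k
        ≤ C * ENNReal.ofReal (A.sig m) ^ 2 := by
  obtain ⟨θ, C, hθ0, hθ1, hC, hcount, hq⟩ := A.exists_count
  refine ⟨ENNReal.ofReal (4 * C * C), ENNReal.ofReal_ne_top, fun k => ?_, fun m => ?_⟩
  · have h1 := tsum_rpow_neg_le A.one_le_sig (by linarith) zero_le_one le_rfl (by linarith)
      hcount (A.sig k) (A.sig_pos k)
    have h2 : ∀ l, (ENNReal.ofReal (A.sig l))⁻¹ = ENNReal.ofReal (A.sig l ^ (-1 : ℝ)) := fun l => by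
      rw [Real.rpow_neg_one, ENNReal.ofReal_inv_of_pos (A.sig_pos l)]
    simp only [h2]
    refine (mul_le_mul' le_rfl h1).trans ?_
    have hs := A.sig_pos k
    have hw : 0 ≤ waveSq k / (1 + A.symbol k) :=
      div_nonneg (waveSq_nonneg k) (by linarith [A.symbol_nonneg k])
    rw [← ENNReal.ofReal_mul hw, ← ENNReal.ofReal_mul (by positivity)]
    refine ENNReal.ofReal_le_ofReal ?_
    calc waveSq k / (1 + A.symbol k) * A.sig k ^ (-1 : ℝ) * (4 * C * A.sig k ^ (2 + θ - 1))
        ≤ (C * A.sig k ^ (-θ)) * A.sig k ^ (-1 : ℝ) * (4 * C * A.sig k ^ (2 + θ - 1)) := by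
          gcongr
          exact hq k
      _ = 4 * C * C * (A.sig k ^ (-θ) * A.sig k ^ (-1 : ℝ) * A.sig k ^ (2 + θ - 1)) := by ring
      _ = 4 * C * C := by
          rw [← Real.rpow_add hs, ← Real.rpow_add hs]
          ring_nf
          simp
      _ ≤ _ := le_rfl
  · have h1 := tsum_rpow_neg_le A.one_le_sig (by linarith) hθ0 hθ1.le (by linarith)
      hcount (A.sig m) (A.sig_pos m)
    have hs := A.sig_pos m
    calc _ ≤ ∑' k, ENNReal.ofReal C * {k | A.sig k ≤ A.sig m}.indicator
          (fun k => ENNReal.ofReal (A.sig k ^ (-θ))) k := by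
          refine ENNReal.tsum_le_tsum fun k => ?_
          by_cases hk : A.sig k ≤ A.sig m
          · rw [Set.indicator_of_mem (by exact hk), Set.indicator_of_mem (by exact hk),
              ← ENNReal.ofReal_mul (by linarith)]
            exact ENNReal.ofReal_le_ofReal (hq k)
          · rw [Set.indicator_of_notMem (by exact hk)]
            exact zero_le
      _ ≤ ENNReal.ofReal C * ENNReal.ofReal (4 * C * A.sig m ^ (2 + θ - θ)) := by
          rw [ENNReal.tsum_mul_left]
          gcongr
      _ = _ := by
          rw [← ENNReal.ofReal_pow hs.le, ← ENNReal.ofReal_mul (by linarith),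
            ← ENNReal.ofReal_mul (by nlinarith)]
          congr 1
          rw [add_sub_cancel_right, Real.rpow_two]
          ring

/-- The Cauchy–Schwarz inequality with weights. -/
theorem sq_tsum_mul_le {ι : Type*} (r a b : ι → ℝ≥0∞) (h0 : ∀ i, r i ≠ 0) (ht : ∀ i, r i ≠ ⊤) :
    (∑' i, a i * b i) ^ 2 ≤ (∑' i, r i * a i ^ 2) * ∑' i, (r i)⁻¹ * b i ^ 2 := by
  let _ : MeasurableSpace ι := ⊤
  have key := ENNReal.lintegral_mul_le_Lp_mul_Lq (Measure.count : Measure ι) Real.HolderConjugate.two_two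
    (f := fun i => r i ^ (1 / 2 : ℝ) * a i) (g := fun i => (r i)⁻¹ ^ (1 / 2 : ℝ) * b i)
    measurable_from_top.aemeasurable measurable_from_top.aemeasurable
  simp only [lintegral_count' measurable_from_top,
    Pi.mul_apply, ENNReal.mul_rpow_of_nonneg _ _ (zero_le_two : (0:ℝ) ≤ 2), ← ENNReal.rpow_mul] at key
  have h1 : ∀ i, r i ^ (1 / 2 : ℝ) * a i * ((r i)⁻¹ ^ (1 / 2 : ℝ) * b i) = a i * b i := fun i => by
    have : r i ^ (1 / 2 : ℝ) * (r i)⁻¹ ^ (1 / 2 : ℝ) = 1 := by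
      rw [← ENNReal.mul_rpow_of_nonneg _ _ (by norm_num), ENNReal.mul_inv_cancel (h0 i) (ht i),
        ENNReal.one_rpow]
    calc _ = (r i ^ (1 / 2 : ℝ) * (r i)⁻¹ ^ (1 / 2 : ℝ)) * (a i * b i) := by ring
      _ = _ := by rw [this, one_mul]
  norm_num at key
  norm_num at h1
  simp only [h1] at key
  calc _ ≤ _ := pow_le_pow_left' key 2
    _ = _ := by
      rw [mul_pow, ← ENNReal.rpow_natCast, ← ENNReal.rpow_natCast, ← ENNReal.rpow_mul,
        ← ENNReal.rpow_mul]
      norm_num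

theorem add_three_sq_le (a b c : ℝ≥0∞) : (a + b + c) ^ 2 ≤ 4 * (a ^ 2 + b ^ 2 + c ^ 2) := by
  have h : ∀ x y : ℝ≥0∞, (x + y) ^ 2 ≤ 2 * (x ^ 2 + y ^ 2) := fun x y => by
    have := ENNReal.rpow_add_le_mul_rpow_add_rpow x y (one_le_two : (1:ℝ) ≤ 2)
    norm_num at this
    exact this
  calc (a + b + c) ^ 2 ≤ 2 * ((a + b) ^ 2 + c ^ 2) := h _ _
    _ ≤ 2 * (2 * (a ^ 2 + b ^ 2) + 2 * c ^ 2) := by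
        gcongr
        · exact h a b
        · exact le_mul_of_one_le_left' one_le_two
    _ = _ := by ring

/-- The critical product estimate. The pairs `l + m = k` are split according to which of `σ(l)`,
`σ(m)`, `σ(k)` is the smallest: the other two are then comparable, and the Cauchy–Schwarz inequality
reduces the claim to `exists_kernel_bounds`. -/
theorem HyperOp.exists_conv_bound (A : HyperOp) : ∃ C : ℝ≥0∞, C ≠ ⊤ ∧ ∀ f g : Freq → ℝ≥0∞,
    ∑' k, ENNReal.ofReal (waveSq k / (1 + A.symbol k)) * (∑' l, f l * g (k - l)) ^ 2
      ≤ C * ((∑' k, ENNReal.ofReal (A.sig k) * f k ^ 2) *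
        ∑' k, ENNReal.ofReal (A.sig k) * g k ^ 2) := by
  obtain ⟨C, hC, H1, H2⟩ := A.exists_kernel_bounds
  set s : Freq → ℝ≥0∞ := fun k => ENNReal.ofReal (A.sig k) with hs
  set q : Freq → ℝ≥0∞ := fun k => ENNReal.ofReal (waveSq k / (1 + A.symbol k)) with hq
  have hs0 : ∀ k, s k ≠ 0 := fun k => (ENNReal.ofReal_pos.2 (A.sig_pos k)).ne'
  have hst : ∀ k, s k ≠ ⊤ := fun k => ENNReal.ofReal_ne_top
  -- two frequencies whose sum or difference has a smaller `σ` have comparable `σ`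
  have hcmp : ∀ k l m : Freq, A.sig k ≤ 3 * (A.sig l + A.sig m) → A.sig l ≤ A.sig m →
      (s m)⁻¹ ≤ 6 * (s k)⁻¹ := by
    intro k l m h1 h2
    have h3 : s k ≤ 6 * s m := by
      rw [hs, show (6 : ℝ≥0∞) = ENNReal.ofReal 6 by norm_num]
      simp only
      rw [← ENNReal.ofReal_mul (by norm_num)]
      exact ENNReal.ofReal_le_ofReal (by linarith)
    have h4 : (6 * s m)⁻¹ ≤ (s k)⁻¹ := ENNReal.inv_le_inv.2 h3
    rw [ENNReal.mul_inv (by simp) (by simp)] at h4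
    calc (s m)⁻¹ = 6 * (6⁻¹ * (s m)⁻¹) := by
          rw [← mul_assoc, ENNReal.mul_inv_cancel (by norm_num) (by norm_num), one_mul]
      _ ≤ _ := by gcongr
  -- the case where the factor `f` carries the smallest frequency
  have low : ∀ f g : Freq → ℝ≥0∞, ∑' k, q k * (∑' l, {l | A.sig l ≤ A.sig (k - l) ∧
      A.sig l ≤ A.sig k}.indicator (fun l => f l * g (k - l)) l) ^ 2
        ≤ 6 * C * ((∑' k, s k * f k ^ 2) * ∑' k, s k * g k ^ 2) := by
    intro f g
    have hk : ∀ k, q k * (∑' l, {l | A.sig l ≤ A.sig (k - l) ∧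
      A.sig l ≤ A.sig k}.indicator (fun l => f l * g (k - l)) l) ^ 2
        ≤ 6 * C * ∑' l, s l * f l ^ 2 * (s (k - l) * g (k - l) ^ 2) := by
      intro k
      set S : Set Freq := {l | A.sig l ≤ A.sig (k - l) ∧ A.sig l ≤ A.sig k}
      have h1 := sq_tsum_mul_le (fun l => s l * s (k - l)) (fun l => f l * g (k - l))
        (S.indicator fun _ => 1) (fun l => mul_ne_zero (hs0 _) (hs0 _))
        (fun l => ENNReal.mul_ne_top (hst _) (hst _))
      have h2 : ∀ l, f l * g (k - l) * S.indicator (fun _ => 1) l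
          = S.indicator (fun l => f l * g (k - l)) l := fun l => by
        by_cases h : l ∈ S <;> simp [h]
      simp only [h2] at h1
      have h3 : ∑' l, (s l * s (k - l))⁻¹ * (S.indicator (fun _ => 1) l : ℝ≥0∞) ^ 2
          ≤ 6 * (s k)⁻¹ * ∑' l, {l | A.sig l ≤ A.sig k}.indicator (fun l => (s l)⁻¹) l := by
        rw [← ENNReal.tsum_mul_left]
        refine ENNReal.tsum_le_tsum fun l => ?_
        by_cases h : l ∈ S
        · rw [Set.indicator_of_mem h, Set.indicator_of_mem (by exact h.2), one_pow, mul_one,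
            ENNReal.mul_inv (Or.inl (hs0 _)) (Or.inl (hst _)), mul_comm]
          gcongr
          refine hcmp k l (k - l) ?_ h.1
          simpa using A.sig_add_le l (k - l)
        · simp [h]
      calc _ ≤ q k * ((∑' l, s l * s (k - l) * (f l * g (k - l)) ^ 2) *
            (6 * (s k)⁻¹ * ∑' l, {l | A.sig l ≤ A.sig k}.indicator (fun l => (s l)⁻¹) l)) := by
            gcongr
            exact h1.trans (by gcongr)
        _ = 6 * (q k * (s k)⁻¹ * ∑' l, {l | A.sig l ≤ A.sig k}.indicator (fun l => (s l)⁻¹) l) *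
            (∑' l, s l * s (k - l) * (f l * g (k - l)) ^ 2) := by ring
        _ ≤ 6 * C * (∑' l, s l * s (k - l) * (f l * g (k - l)) ^ 2) := by
            gcongr
            exact H1 k
        _ = _ := by
            congr 2
            ext l
            ring
    refine (ENNReal.tsum_le_tsum hk).trans (le_of_eq ?_)
    rw [ENNReal.tsum_mul_left, ENNReal.tsum_comm, ← ENNReal.tsum_mul_right]
    congr 2
    ext l
    rw [ENNReal.tsum_mul_left, ← (Equiv.subRight l).tsum_eq (fun m => s m * g m ^ 2)]
    rfl
  -- the case where the sum of the frequencies is the smallest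
  have high : ∀ f g : Freq → ℝ≥0∞, ∑' k, q k * (∑' l, {l | A.sig k ≤ A.sig l ∧
      A.sig k ≤ A.sig (k - l)}.indicator (fun l => f l * g (k - l)) l) ^ 2
        ≤ 6 * C * ((∑' k, s k * f k ^ 2) * ∑' k, s k * g k ^ 2) := by
    intro f g
    have hk : ∀ k, q k * (∑' l, {l | A.sig k ≤ A.sig l ∧
      A.sig k ≤ A.sig (k - l)}.indicator (fun l => f l * g (k - l)) l) ^ 2
        ≤ (∑' l, s l * f l ^ 2) * ∑' m, {m | A.sig k ≤ A.sig m}.indicator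
            (fun m => q k * (6 * (s m)⁻¹ * g m ^ 2)) m := by
      intro k
      set S : Set Freq := {l | A.sig k ≤ A.sig l ∧ A.sig k ≤ A.sig (k - l)}
      have h1 := sq_tsum_mul_le s f (fun l => S.indicator (fun l => g (k - l)) l) hs0 hst
      have h2 : ∀ l, f l * S.indicator (fun l => g (k - l)) l
          = S.indicator (fun l => f l * g (k - l)) l := fun l => by
        by_cases h : l ∈ S <;> simp [h]
      simp only [h2] at h1
      have h3 : q k * ∑' l, (s l)⁻¹ * S.indicator (fun l => g (k - l)) l ^ 2
          ≤ ∑' m, {m | A.sig k ≤ A.sig m}.indicator (fun m => q k * (6 * (s m)⁻¹ * g m ^ 2)) m := by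
        rw [← (Equiv.subLeft k).tsum_eq (fun m => {m | A.sig k ≤ A.sig m}.indicator
          (fun m => q k * (6 * (s m)⁻¹ * g m ^ 2)) m), ← ENNReal.tsum_mul_left]
        refine ENNReal.tsum_le_tsum fun l => ?_
        by_cases h : l ∈ S
        · simp only [Equiv.subLeft_apply]
          rw [Set.indicator_of_mem h, Set.indicator_of_mem (by exact h.2)]
          gcongr
          refine hcmp (k - l) k l ?_ h.1
          have := A.sig_add_le k (-l)
          rwa [← sub_eq_add_neg, A.sig_neg] at this
        · simp [h]
      calc _ ≤ q k * ((∑' l, s l * f l ^ 2) *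
            ∑' l, (s l)⁻¹ * S.indicator (fun l => g (k - l)) l ^ 2) := by gcongr
        _ = (∑' l, s l * f l ^ 2) *
            (q k * ∑' l, (s l)⁻¹ * S.indicator (fun l => g (k - l)) l ^ 2) := by ring
        _ ≤ _ := by gcongr
    refine (ENNReal.tsum_le_tsum hk).trans ?_
    rw [ENNReal.tsum_mul_left, ENNReal.tsum_comm, mul_left_comm]
    gcongr
    rw [← ENNReal.tsum_mul_left]
    refine ENNReal.tsum_le_tsum fun m => ?_
    have h4 : ∀ k, {m | A.sig k ≤ A.sig m}.indicator (fun m => q k * (6 * (s m)⁻¹ * g m ^ 2)) m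
        = (6 * (s m)⁻¹ * g m ^ 2) * {k | A.sig k ≤ A.sig m}.indicator (fun k => q k) k := by
      intro k
      by_cases h : A.sig k ≤ A.sig m
      · rw [Set.indicator_of_mem (by exact h), Set.indicator_of_mem (by exact h), mul_comm]
      · rw [Set.indicator_of_notMem (by exact h), Set.indicator_of_notMem (by exact h), mul_zero]
    simp only [h4]
    rw [ENNReal.tsum_mul_left]
    calc 6 * (s m)⁻¹ * g m ^ 2 * _ ≤ 6 * (s m)⁻¹ * g m ^ 2 * (C * s m ^ 2) := by
          gcongr
          exact H2 m
      _ = 6 * C * (((s m)⁻¹ * s m) * s m * g m ^ 2) := by ring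
      _ = _ := by rw [ENNReal.inv_mul_cancel (hs0 m) (hst m), one_mul]
  refine ⟨4 * (3 * (6 * C)), by finiteness, fun f g => ?_⟩
  have hsplit : ∀ k, q k * (∑' l, f l * g (k - l)) ^ 2 ≤ 4 * (
      q k * (∑' l, {l | A.sig l ≤ A.sig (k - l) ∧ A.sig l ≤ A.sig k}.indicator
        (fun l => f l * g (k - l)) l) ^ 2
      + q k * (∑' l, {l | A.sig l ≤ A.sig (k - l) ∧ A.sig l ≤ A.sig k}.indicator
        (fun l => g l * f (k - l)) l) ^ 2
      + q k * (∑' l, {l | A.sig k ≤ A.sig l ∧ A.sig k ≤ A.sig (k - l)}.indicator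
        (fun l => f l * g (k - l)) l) ^ 2) := by
    intro k
    rw [← (Equiv.subLeft k).tsum_eq (fun l => {l | A.sig l ≤ A.sig (k - l) ∧
      A.sig l ≤ A.sig k}.indicator (fun l => g l * f (k - l)) l)]
    rw [← mul_add, ← mul_add, mul_left_comm]
    gcongr
    refine le_trans ?_ (add_three_sq_le _ _ _)
    gcongr
    rw [← ENNReal.tsum_add, ← ENNReal.tsum_add]
    refine ENNReal.tsum_le_tsum fun l => ?_
    simp only [Equiv.subLeft_apply]
    by_cases h1 : l ∈ {l | A.sig l ≤ A.sig (k - l) ∧ A.sig l ≤ A.sig k}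
    · rw [Set.indicator_of_mem h1, add_assoc]
      exact le_self_add
    by_cases h2 : k - l ∈ {l | A.sig l ≤ A.sig (k - l) ∧ A.sig l ≤ A.sig k}
    · rw [Set.indicator_of_mem h2, sub_sub_cancel, mul_comm, add_right_comm]
      exact le_add_self
    · rw [Set.indicator_of_mem (s := {l | A.sig k ≤ A.sig l ∧ A.sig k ≤ A.sig (k - l)})]
      · exact le_add_self
      · simp only [mem_ofPred_eq, sub_sub_cancel] at h1 h2 ⊢
        grind
  refine (ENNReal.tsum_le_tsum hsplit).trans ?_
  rw [ENNReal.tsum_mul_left, ENNReal.tsum_add, ENNReal.tsum_add, mul_assoc 4]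
  gcongr
  calc _ ≤ 6 * C * ((∑' k, s k * f k ^ 2) * ∑' k, s k * g k ^ 2)
        + 6 * C * ((∑' k, s k * g k ^ 2) * ∑' k, s k * f k ^ 2)
        + 6 * C * ((∑' k, s k * f k ^ 2) * ∑' k, s k * g k ^ 2) := by
        gcongr
        · exact low f g
        · exact low g f
        · exact high f g
    _ = _ := by ring

/-! ### Fourier series on the cell -/

section Torus

attribute [local instance] instMeasureSpaceUnitAddCircle

/-- The point of the half-open cell `(0,1] × (0,1] × (-1,1]` over a point of the unit torus. -/
def cellPoint (y : UnitAddTorus (Fin 3)) : E3 :=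
  WithLp.toLp 2 fun j => period j *
    ((UnitAddTorus.measurableEquivPiIoc (![0, 0, -1 / 2] : Fin 3 → ℝ) y : Fin 3 → ℝ) j)

/-- The projection of space onto the unit torus, with the periods scaled to `1`. -/
def torusPoint (x : E3) : UnitAddTorus (Fin 3) := fun j => ((x j / period j : ℝ) : UnitAddCircle)

theorem period_pos (j : Fin 3) : 0 < period j := by
  fin_cases j <;> simp [period]

theorem torusPoint_cellPoint (y : UnitAddTorus (Fin 3)) : torusPoint (cellPoint y) = y := by
  ext j
  simp only [torusPoint, cellPoint, mul_div_cancel_left₀ _ (period_pos j).ne']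
  exact AddCircle.coe_equivIoc

theorem measurable_torusPoint : Measurable torusPoint := by
  refine measurable_pi_lambda _ fun j => AddCircle.measurable_mk'.comp ?_
  fun_prop

theorem measurable_cellPoint : Measurable cellPoint := by
  refine (WithLp.measurable_toLp 2 _).comp (measurable_pi_lambda _ fun j => ?_)
  exact measurable_const.mul ((measurable_pi_apply j).comp
    (measurable_subtype_coe.comp (MeasurableEquiv.measurable _)))

/-- The lower corner of the cell. -/
def corner : Fin 3 → ℝ := ![0, 0, -1]

theorem Ω_eq : Ω = WithLp.ofLp ⁻¹' (univ.pi fun j => Ioo (corner j) (corner j + period j)) := by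
  ext x
  simp only [Ω, mem_ofPred_eq, mem_preimage, mem_univ_pi, Fin.forall_fin_succ, corner, period]
  simp
  intro _ _ _ _ _
  constructor <;> intro <;> linarith

theorem μΩ_eq : μΩ = volume.restrict
    (WithLp.ofLp ⁻¹' (univ.pi fun j => Ioc (corner j) (corner j + period j)) : Set E3) := by
  refine Measure.restrict_congr_set ?_
  rw [Ω_eq]
  refine (PiLp.volume_preserving_ofLp (Fin 3)).quasiMeasurePreserving.preimage_ae_eq ?_
  exact (Measure.univ_pi_Ioo_ae_eq_Icc).trans (Measure.univ_pi_Ioc_ae_eq_Icc).symm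

theorem measurePreserving_cellPoint :
    MeasurePreserving cellPoint volume ((2 : ℝ≥0∞)⁻¹ • μΩ) := by
  set a : Fin 3 → ℝ := ![0, 0, -1 / 2]
  have h1 := UnitAddTorus.measurePreserving_equivPiIoc a
  have hB : MeasurableSet {x : Fin 3 → ℝ | ∀ i, x i ∈ Ioc (a i) (a i + 1)} :=
    MeasurableSet.univ_pi' fun i => measurableSet_Ioc
  have h2 := (measurePreserving_subtype_coe (μa := (volume : Measure (Fin 3 → ℝ))) hB).comp h1
  set D := Matrix.toLin' (Matrix.diagonal period)
  have hdet : (Matrix.diagonal period).det = 2 := by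
    simp [Matrix.det_diagonal, Fin.prod_univ_three, period]
  have hDm : Measurable D := by fun_prop
  have hD := Real.smul_map_diagonal_volume_pi (D := period) (by rw [hdet]; norm_num)
  rw [hdet] at hD
  have h3 : MeasurePreserving D volume ((2 : ℝ≥0∞)⁻¹ • volume) := by
    refine ⟨hDm, ?_⟩
    nth_rw 2 [← hD]
    rw [smul_smul, abs_two, ENNReal.ofReal_ofNat, ENNReal.inv_mul_cancel (by norm_num) (by norm_num),
      one_smul]
  have h4 : MeasurePreserving (fun x => WithLp.toLp 2 (D x)) volume
      ((2 : ℝ≥0∞)⁻¹ • (volume : Measure E3)) :=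
    MeasurePreserving.comp (((PiLp.volume_preserving_toLp (Fin 3))).smul_measure _) h3
  have hS : MeasurableSet
      (WithLp.ofLp ⁻¹' (univ.pi fun j => Ioc (corner j) (corner j + period j)) : Set E3) :=
    (WithLp.measurable_ofLp 2 _) (MeasurableSet.univ_pi fun i => measurableSet_Ioc)
  have h5 := h4.restrict_preimage hS
  have hpre : (fun x => WithLp.toLp 2 (D x)) ⁻¹'
      (WithLp.ofLp ⁻¹' (univ.pi fun j => Ioc (corner j) (corner j + period j)) : Set E3)
      = {x : Fin 3 → ℝ | ∀ i, x i ∈ Ioc (a i) (a i + 1)} := by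
    ext x
    simp only [mem_preimage, mem_univ_pi, mem_ofPred_eq, D, Matrix.toLin'_apply,
      Matrix.mulVec_diagonal, Fin.forall_fin_succ, corner, period, a]
    simp
    intro _ _ _ _
    constructor <;> rintro ⟨h, h'⟩ <;> constructor <;> linarith
  rw [hpre, Measure.restrict_smul, ← μΩ_eq] at h5
  have h6 : cellPoint = (fun x => WithLp.toLp 2 (D x)) ∘ Subtype.val ∘
      ⇑(UnitAddTorus.measurableEquivPiIoc a) := by
    funext y
    ext j
    simp [cellPoint, D, Matrix.mulVec_diagonal, a]
  rw [h6]
  exact h5.comp h2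

/-- The Fourier coefficients of a complex function on the cell. -/
def coeff (h : E3 → ℂ) (k : Freq) : ℂ :=
  (1 / 2 : ℂ) * ∫ x in Ω, Complex.exp (-(Complex.I * ∑ j, (wave k j : ℂ) * (x j : ℂ))) * h x

theorem fourier_apply (v : E3 → E3) (k : Freq) (i : Fin 3) :
    fourier v k i = coeff (fun x => (v x i : ℂ)) k := rfl

/-- The exponential `e^{i ξ_k · x}`. -/
def expo (k : Freq) (x : E3) : ℂ := Complex.exp (Complex.I * ∑ j, (wave k j : ℂ) * (x j : ℂ))

theorem mFourier_torusPoint (k : Freq) (x : E3) :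
    UnitAddTorus.mFourier k (torusPoint x) = expo k x := by
  simp only [UnitAddTorus.mFourier, ContinuousMap.coe_mk, torusPoint, expo, Finset.mul_sum,
    Complex.exp_sum]
  refine Finset.prod_congr rfl fun j _ => ?_
  rw [fourier_coe_apply]
  congr 1
  simp only [wave]
  push_cast
  ring

theorem expo_neg (k : Freq) (x : E3) :
    expo (-k) x = Complex.exp (-(Complex.I * ∑ j, (wave k j : ℂ) * (x j : ℂ))) := by
  simp [expo, wave_neg]

theorem coeff_eq (h : E3 → ℂ) (k : Freq) : coeff h k = (1 / 2 : ℂ) * ∫ x in Ω, expo (-k) x * h x := by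
  simp only [coeff, expo_neg]

theorem expo_add (k l : Freq) (x : E3) : expo (k + l) x = expo k x * expo l x := by
  simp [expo, ← Complex.exp_add, ← mul_add, wave_add, add_mul, Finset.sum_add_distrib]

theorem conj_expo (k : Freq) (x : E3) : starRingEnd ℂ (expo k x) = expo (-k) x := by
  simp [expo, ← Complex.exp_conj, wave_neg]

theorem norm_expo (k : Freq) (x : E3) : ‖expo k x‖ = 1 := by
  rw [expo, mul_comm]
  have : (∑ j, (wave k j : ℂ) * (x j : ℂ)) = ((∑ j, wave k j * x j : ℝ) : ℂ) := by push_cast; rfl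
  rw [this, Complex.norm_exp_ofReal_mul_I]

theorem contDiff_expo (k : Freq) : ContDiff ℝ ∞ (expo k) := by
  unfold expo
  have : ∀ j : Fin 3, ContDiff ℝ ∞ fun x : E3 => ((x j : ℝ) : ℂ) := fun j =>
    Complex.ofRealCLM.contDiff.comp (by fun_prop)
  fun_prop

theorem continuous_expo (k : Freq) : Continuous (expo k) := (contDiff_expo k).continuous

theorem measurableEmbedding_cellPoint : MeasurableEmbedding cellPoint := by
  have : Function.Injective cellPoint := Function.LeftInverse.injective torusPoint_cellPoint
  have h2 : MeasurableEmbedding (Subtype.val :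
      {x : Fin 3 → ℝ // ∀ i, x i ∈ Ioc ((![0, 0, -1 / 2] : Fin 3 → ℝ) i)
        ((![0, 0, -1 / 2] : Fin 3 → ℝ) i + 1)} → (Fin 3 → ℝ)) :=
    MeasurableEmbedding.subtype_coe (MeasurableSet.univ_pi' fun i => measurableSet_Ioc)
  have h3 : MeasurableEmbedding fun x : Fin 3 → ℝ => (WithLp.toLp 2 fun j => period j * x j : E3) := by
    refine Measurable.measurableEmbedding ?_ fun x y h => ?_
    · exact (WithLp.measurable_toLp 2 _).comp (by fun_prop)
    · ext j
      have := congrArg (fun z : E3 => z j) h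
      simpa [(period_pos j).ne'] using this
  exact h3.comp (h2.comp (MeasurableEquiv.measurableEmbedding _))

theorem integral_cell {E : Type*} [NormedAddCommGroup E] [NormedSpace ℝ E] (h : E3 → E) :
    ∫ y, h (cellPoint y) = (1 / 2 : ℝ) • ∫ x in Ω, h x := by
  rw [measurePreserving_cellPoint.integral_comp measurableEmbedding_cellPoint, integral_smul_measure]
  simp

theorem coeff_eq_mFourierCoeff (h : E3 → ℂ) (k : Freq) :
    coeff h k = UnitAddTorus.mFourierCoeff (h ∘ cellPoint) k := by
  rw [coeff_eq, UnitAddTorus.mFourierCoeff]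
  have := integral_cell fun x => expo (-k) x * h x
  simp only [← mFourier_torusPoint, torusPoint_cellPoint] at this ⊢
  simp only [smul_eq_mul, Function.comp_apply, this]
  rw [Complex.real_smul]
  norm_num

theorem memLp_comp_cellPoint {h : E3 → ℂ} (hh : MemLp h 2 μΩ) :
    MemLp (h ∘ cellPoint) 2 volume :=
  (hh.smul_measure (by simp)).comp_measurePreserving measurePreserving_cellPoint

theorem hasSum_conj_coeff_mul {g h : E3 → ℂ} (hg : MemLp g 2 μΩ) (hh : MemLp h 2 μΩ) :
    HasSum (fun k => starRingEnd ℂ (coeff g k) * coeff h k)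
      ((1 / 2 : ℂ) * ∫ x in Ω, starRingEnd ℂ (g x) * h x) := by
  have hg' := memLp_comp_cellPoint hg
  have hh' := memLp_comp_cellPoint hh
  have hc : ∀ {f : UnitAddTorus (Fin 3) → ℂ} (hf : MemLp f 2 volume) (k : Freq),
      UnitAddTorus.mFourierCoeff (hf.toLp f) k = UnitAddTorus.mFourierCoeff f k := by
    intro f hf k
    refine integral_congr_ae ?_
    filter_upwards [hf.coeFn_toLp] with y hy
    rw [hy]
  have := UnitAddTorus.hasSum_prod_mFourierCoeff (hg'.toLp _) (hh'.toLp _)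
  simp only [hc, ← coeff_eq_mFourierCoeff] at this
  convert this using 1
  have e : ∫ t, starRingEnd ℂ ((hg'.toLp _ : UnitAddTorus (Fin 3) → ℂ) t) *
      (hh'.toLp _ : UnitAddTorus (Fin 3) → ℂ) t
      = ∫ t, (fun x => starRingEnd ℂ (g x) * h x) (cellPoint t) := by
    refine integral_congr_ae ?_
    filter_upwards [hg'.coeFn_toLp, hh'.coeFn_toLp] with y h1 h2
    rw [h1, h2]
    rfl
  rw [e, integral_cell (fun x => starRingEnd ℂ (g x) * h x), Complex.real_smul]
  norm_num

theorem exists_coeff_eq {c : Freq → ℂ} (hc : Memℓp c 2) :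
    ∃ h : E3 → ℂ, MemLp h 2 μΩ ∧ coeff h = c := by
  set F := (UnitAddTorus.mFourierBasis (d := Fin 3)).repr.symm ⟨c, hc⟩
  have hF := Lp.memLp F
  refine ⟨(F : UnitAddTorus (Fin 3) → ℂ) ∘ torusPoint, ?_, ?_⟩
  · have h1 : MeasurePreserving torusPoint ((2 : ℝ≥0∞)⁻¹ • μΩ) volume := by
      refine ⟨measurable_torusPoint, ?_⟩
      rw [← measurePreserving_cellPoint.map_eq,
        Measure.map_map measurable_torusPoint measurable_cellPoint]
      have : torusPoint ∘ cellPoint = id := funext torusPoint_cellPoint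
      rw [this, Measure.map_id]
    have h2 := (hF.comp_measurePreserving h1).smul_measure (c := 2) (by simp)
    rw [smul_smul, ENNReal.mul_inv_cancel (by norm_num) (by norm_num), one_smul] at h2
    exact h2
  · funext k
    rw [coeff_eq_mFourierCoeff, Function.comp_assoc, show torusPoint ∘ cellPoint = id from
      funext torusPoint_cellPoint, Function.comp_id, ← UnitAddTorus.mFourierBasis_repr]
    simp [F]

end Torus

instance isFiniteMeasure_μΩ : IsFiniteMeasure μΩ := by
  refine ⟨?_⟩
  rw [Measure.restrict_apply_univ, Ω_eq,
    (PiLp.volume_preserving_ofLp (Fin 3)).measure_preimage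
      (MeasurableSet.univ_pi fun i => measurableSet_Ioo).nullMeasurableSet, Real.volume_pi_Ioo]
  exact ENNReal.prod_lt_top fun _ _ => ENNReal.ofReal_lt_top

theorem integrable_expo_mul {h : E3 → ℂ} (hh : Integrable h μΩ) (k : Freq) :
    Integrable (fun x => expo k x * h x) μΩ :=
  hh.bdd_mul (continuous_expo k).aestronglyMeasurable (ae_of_all _ fun x => (norm_expo k x).le)

theorem coeff_add {g h : E3 → ℂ} (hg : Integrable g μΩ) (hh : Integrable h μΩ) (k : Freq) :
    coeff (fun x => g x + h x) k = coeff g k + coeff h k := by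
  simp only [coeff_eq, mul_add]
  rw [integral_add (integrable_expo_mul hg _) (integrable_expo_mul hh _), mul_add]

theorem coeff_const_mul (c : ℂ) (h : E3 → ℂ) (k : Freq) :
    coeff (fun x => c * h x) k = c * coeff h k := by
  simp only [coeff_eq, mul_left_comm _ c, integral_const_mul]

theorem coeff_sub {g h : E3 → ℂ} (hg : Integrable g μΩ) (hh : Integrable h μΩ) (k : Freq) :
    coeff (fun x => g x - h x) k = coeff g k - coeff h k := by
  simp only [coeff_eq, mul_sub]
  rw [integral_sub (integrable_expo_mul hg _) (integrable_expo_mul hh _), mul_sub]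

theorem coeff_finset_sum {ι : Type*} (s : Finset ι) {h : ι → E3 → ℂ}
    (hh : ∀ i ∈ s, Integrable (h i) μΩ) (k : Freq) :
    coeff (fun x => ∑ i ∈ s, h i x) k = ∑ i ∈ s, coeff (h i) k := by
  simp only [coeff_eq, Finset.mul_sum]
  rw [integral_finsetSum _ fun i hi => integrable_expo_mul (hh i hi) _, Finset.mul_sum]

theorem coeff_congr {g h : E3 → ℂ} (hgh : g =ᵐ[μΩ] h) (k : Freq) : coeff g k = coeff h k := by
  rw [coeff_eq, coeff_eq]
  congr 1
  refine integral_congr_ae ?_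
  filter_upwards [hgh] with x hx
  rw [hx]

theorem coeff_conj (h : E3 → ℂ) (k : Freq) :
    coeff (fun x => starRingEnd ℂ (h x)) k = starRingEnd ℂ (coeff h (-k)) := by
  simp only [coeff_eq, map_mul, ← integral_conj, conj_expo, neg_neg, map_div₀, map_one, map_ofNat]

theorem hasSum_norm_coeff_sq {h : E3 → ℂ} (hh : MemLp h 2 μΩ) :
    HasSum (fun k => ‖coeff h k‖ ^ 2) (1 / 2 * ∫ x in Ω, ‖h x‖ ^ 2) := by
  have := hasSum_conj_coeff_mul hh hh
  simp only [Complex.conj_mul'] at this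
  have e : ∫ x in Ω, (‖h x‖ : ℂ) ^ 2 = ((∫ x in Ω, ‖h x‖ ^ 2 : ℝ) : ℂ) := by
    rw [← integral_complex_ofReal]
    simp
  rw [e] at this
  rw [← Complex.hasSum_ofReal]
  push_cast
  exact this

theorem ae_eq_of_coeff_eq {g h : E3 → ℂ} (hg : MemLp g 2 μΩ) (hh : MemLp h 2 μΩ)
    (he : ∀ k, coeff g k = coeff h k) : g =ᵐ[μΩ] h := by
  have h1 := hasSum_norm_coeff_sq (hg.sub hh)
  have h2 : ∀ k, coeff (g - h) k = 0 := fun k => by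
    have := coeff_sub (hg.integrable one_le_two) (hh.integrable one_le_two) k
    rw [he k, sub_self] at this
    exact this
  simp only [h2, norm_zero, zero_pow two_ne_zero] at h1
  have h3 := h1.unique (hasSum_zero (α := ℝ) (β := Freq))
  have h4 : ∫ x in Ω, ‖(g - h) x‖ ^ 2 = 0 := by linarith
  rw [integral_eq_zero_iff_of_nonneg (fun _ => by positivity)
    ((hg.sub hh).integrable_norm_pow two_ne_zero)] at h4
  filter_upwards [h4] with x hx
  simpa [sub_eq_zero] using hx

/-- The Fourier coefficients of a product are the convolution of the Fourier coefficients. -/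
theorem hasSum_coeff_mul {g h : E3 → ℂ} (hg : MemLp g 2 μΩ) (hh : MemLp h 2 μΩ) (k : Freq) :
    HasSum (fun l => coeff g l * coeff h (k - l)) (coeff (fun x => g x * h x) k) := by
  have hg' : MemLp (fun x => expo k x * starRingEnd ℂ (g x)) 2 μΩ := by
    refine (hg.star).of_le ((continuous_expo k).aestronglyMeasurable.mul hg.star.1)
      (ae_of_all _ fun x => ?_)
    rw [norm_mul, norm_expo, one_mul]
    rfl
  have h1 := hasSum_conj_coeff_mul hg' hh
  have h2 : ∀ m, starRingEnd ℂ (coeff (fun x => expo k x * starRingEnd ℂ (g x)) m)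
      = coeff g (k - m) := fun m => by
    simp only [coeff_eq, map_mul, ← integral_conj, conj_expo, ← mul_assoc, ← expo_add,
      Complex.conj_conj, map_div₀, map_one, map_ofNat]
    rw [show -(-m + k) = -(k - m) by abel]
  simp only [h2] at h1
  rw [← (Equiv.subLeft k).hasSum_iff] at h1
  convert h1 using 1
  · funext l
    simp
  · rw [coeff_eq]
    congr 2
    funext x
    simp [conj_expo]
    ring

theorem setIntegral_Ω {E : Type*} [NormedAddCommGroup E] [NormedSpace ℝ E] (H : E3 → E) :
    ∫ x in Ω, H x = ∫ y in Icc corner (corner + period), H (WithLp.toLp 2 y) := by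
  have h1 := (PiLp.volume_preserving_toLp (Fin 3)).setIntegral_preimage_emb
    (MeasurableEquiv.toLp 2 (Fin 3 → ℝ)).measurableEmbedding H Ω
  rw [← h1]
  refine setIntegral_congr_set ?_
  have : WithLp.toLp 2 ⁻¹' Ω = univ.pi fun j => Ioo (corner j) (corner j + period j) := by
    rw [Ω_eq]
    rfl
  rw [this]
  exact Measure.univ_pi_Ioo_ae_eq_Icc

theorem IsSmoothPeriodic.continuous_partialDeriv {F : Type*} [NormedAddCommGroup F]
    [NormedSpace ℝ F] {φ : E3 → F} (hφ : IsSmoothPeriodic φ) (j : Fin 3) :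
    Continuous (partialDeriv j φ) :=
  (hφ.1.continuous_fderiv (by simp)).clm_apply continuous_const

theorem integral_partialDeriv {φ : E3 → ℂ} (hφ : IsSmoothPeriodic φ) (j : Fin 3) :
    ∫ x in Ω, partialDeriv j φ x = 0 := by
  classical
  rw [setIntegral_Ω]
  have hd : ∀ y : Fin 3 → ℝ, HasFDerivAt (fun y => φ (WithLp.toLp 2 y))
      ((fderiv ℝ φ (WithLp.toLp 2 y)).comp
        ((PiLp.continuousLinearEquiv 2 ℝ (fun _ : Fin 3 => ℝ)).symm : (Fin 3 → ℝ) →L[ℝ] E3)) y := by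
    intro y
    have h1 : HasFDerivAt φ (fderiv ℝ φ (WithLp.toLp 2 y)) (WithLp.toLp 2 y) :=
      (hφ.1.differentiable (by simp)).differentiableAt.hasFDerivAt
    exact HasFDerivAt.comp y h1
      ((PiLp.continuousLinearEquiv 2 ℝ (fun _ : Fin 3 => ℝ)).symm).hasFDerivAt
  have hcont : Continuous fun y : Fin 3 → ℝ => φ (WithLp.toLp 2 y) :=
    hφ.1.continuous.comp (PiLp.continuous_toLp 2 _)
  have key := integral_divergence_of_hasFDerivAt_off_countable' (E := ℂ) (n := 2) corner
    (corner + period) (fun i => by simp [(period_pos i).le])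
    (fun i y => if i = j then φ (WithLp.toLp 2 y) else 0)
    (fun i y => if i = j then (fderiv ℝ φ (WithLp.toLp 2 y)).comp
        ((PiLp.continuousLinearEquiv 2 ℝ (fun _ : Fin 3 => ℝ)).symm : (Fin 3 → ℝ) →L[ℝ] E3) else 0)
    ∅ countable_empty
    (fun i => by
      split_ifs
      · exact hcont.continuousOn
      · exact continuousOn_const)
    (fun x _ i => by
      split_ifs
      · exact hd x
      · exact hasFDerivAt_const _ _)
  have e : ∀ y : Fin 3 → ℝ, ∑ i, (if i = j then (fderiv ℝ φ (WithLp.toLp 2 y)).comp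
        ((PiLp.continuousLinearEquiv 2 ℝ (fun _ : Fin 3 => ℝ)).symm : (Fin 3 → ℝ) →L[ℝ] E3) else 0)
        (Pi.single i 1) = partialDeriv j φ (WithLp.toLp 2 y) := by
    intro y
    rw [Finset.sum_eq_single j (fun i _ hi => by simp [hi]) (by simp)]
    simp [partialDeriv]
  simp only [e] at key
  rw [key]
  · refine Finset.sum_eq_zero fun i _ => ?_
    split_ifs with hi
    · subst hi
      rw [sub_eq_zero]
      congr 1
      funext x
      rw [← hφ.2 i (WithLp.toLp 2 (i.insertNth (corner i) x))]
      congr 1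
      ext m
      rcases eq_or_ne m i with rfl | hm
      · simp
      · obtain ⟨m, rfl⟩ := Fin.exists_succAbove_eq hm
        simp
    · simp
  · exact (((hφ.continuous_partialDeriv j).comp
      (PiLp.continuous_toLp 2 _)).continuousOn).integrableOn_compact isCompact_Icc

theorem exists_expo_periodic (k : Freq) (j : Fin 3) (x : E3) :
    expo k (x + EuclideanSpace.single j (period j)) = expo k x := by
  have h : ∑ i, (wave k i : ℂ) * ((EuclideanSpace.single j (period j) : E3) i : ℂ)
      = (k j : ℂ) * (2 * Real.pi) := by
    rw [Finset.sum_eq_single j (fun i _ hi => by simp [hi]) (by simp)]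
    have := (period_pos j).ne'
    simp only [PiLp.single_apply, if_true, wave]
    push_cast
    have h2 : (period j : ℂ) ≠ 0 := by exact_mod_cast this
    field_simp
  simp only [expo, PiLp.add_apply, Complex.ofReal_add, mul_add, Finset.sum_add_distrib, h]
  rw [Complex.exp_add]
  have := Complex.exp_int_mul_two_pi_mul_I (k j)
  rw [show Complex.I * ((k j : ℂ) * (2 * Real.pi)) = k j * (2 * Real.pi * Complex.I) by ring, this,
    mul_one]

theorem isSmoothPeriodic_expo (k : Freq) : IsSmoothPeriodic (expo k) :=
  ⟨contDiff_expo k, exists_expo_periodic k⟩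

theorem partialDeriv_expo (k : Freq) (j : Fin 3) (x : E3) :
    partialDeriv j (expo k) x = Complex.I * wave k j * expo k x := by
  have h1 : HasFDerivAt (fun x : E3 => Complex.I * ∑ i, (wave k i : ℂ) * (x i : ℂ))
      (∑ i, (Complex.I * (wave k i : ℂ)) • (Complex.ofRealCLM.comp (EuclideanSpace.proj i))) x := by
    have : (fun x : E3 => Complex.I * ∑ i, (wave k i : ℂ) * (x i : ℂ)) = fun x =>
      (∑ i, (Complex.I * (wave k i : ℂ)) • (Complex.ofRealCLM.comp
        (EuclideanSpace.proj i : E3 →L[ℝ] ℝ))) x := by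
      funext x
      simp [Finset.mul_sum, mul_assoc]
    rw [this]
    exact ContinuousLinearMap.hasFDerivAt _
  have h2 := h1.cexp
  have h3 : fderiv ℝ (expo k) x = _ := h2.fderiv
  have h4 : (∑ i, (Complex.I * (wave k i : ℂ)) • (Complex.ofRealCLM.comp
      (EuclideanSpace.proj i : E3 →L[ℝ] ℝ))) (EuclideanSpace.single j 1) = Complex.I * wave k j := by
    rw [sum_apply, Finset.sum_eq_single j (fun i _ hi => by simp [hi]) (by simp)]
    simp
  rw [partialDeriv, h3, smul_apply, h4, smul_eq_mul, mul_comm]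
  rfl

theorem IsSmoothPeriodic.mul {φ ψ : E3 → ℂ} (hφ : IsSmoothPeriodic φ) (hψ : IsSmoothPeriodic ψ) :
    IsSmoothPeriodic fun x => φ x * ψ x :=
  ⟨hφ.1.mul hψ.1, fun j x => by simp only [hφ.2, hψ.2]⟩

theorem partialDeriv_mul {φ ψ : E3 → ℂ} (hφ : IsSmoothPeriodic φ) (hψ : IsSmoothPeriodic ψ)
    (j : Fin 3) (x : E3) : partialDeriv j (fun x => φ x * ψ x) x
      = φ x * partialDeriv j ψ x + partialDeriv j φ x * ψ x := by
  have h1 : DifferentiableAt ℝ φ x := (hφ.1.differentiable (by simp)).differentiableAt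
  have h2 : DifferentiableAt ℝ ψ x := (hψ.1.differentiable (by simp)).differentiableAt
  simp only [partialDeriv]
  rw [fderiv_fun_mul h1 h2]
  simp [mul_comm]

theorem integrable_of_continuous {F : Type*} [NormedAddCommGroup F] {φ : E3 → F}
    (hφ : Continuous φ) : Integrable φ μΩ := by
  have hK : IsCompact (WithLp.toLp 2 '' Icc corner (corner + period) : Set E3) :=
    isCompact_Icc.image (PiLp.continuous_toLp 2 _)
  refine (hφ.continuousOn.integrableOn_compact hK).mono_set ?_
  rw [Ω_eq]
  intro x hx
  refine ⟨x.ofLp, ?_, rfl⟩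
  simp only [mem_preimage, mem_univ_pi, mem_Ioo] at hx
  exact ⟨fun j => (hx j).1.le, fun j => (hx j).2.le⟩

theorem memLp_two_of_continuous {F : Type*} [NormedAddCommGroup F] {φ : E3 → F}
    (hφ : Continuous φ) : MemLp φ 2 μΩ :=
  (memLp_two_iff_integrable_sq_norm (hφ.aestronglyMeasurable)).2
    (integrable_of_continuous (by fun_prop))

theorem coeff_partialDeriv {φ : E3 → ℂ} (hφ : IsSmoothPeriodic φ) (j : Fin 3) (k : Freq) :
    coeff (partialDeriv j φ) k = Complex.I * wave k j * coeff φ k := by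
  have h := integral_partialDeriv ((isSmoothPeriodic_expo (-k)).mul hφ) j
  simp only [partialDeriv_mul (isSmoothPeriodic_expo (-k)) hφ, partialDeriv_expo] at h
  rw [integral_add (f := fun x => expo (-k) x * partialDeriv j φ x)
    (g := fun x => Complex.I * ↑(wave (-k) j) * expo (-k) x * φ x)
    (integrable_of_continuous ((continuous_expo _).mul (hφ.continuous_partialDeriv j)))
    (integrable_of_continuous ((continuous_const.mul (continuous_expo _)).mul hφ.1.continuous))] at h
  simp only [mul_assoc, integral_const_mul, wave_neg] at h
  rw [coeff_eq, coeff_eq]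
  push_cast at h
  linear_combination (1 / 2 : ℂ) * h

/-! ### Fourier coefficients of velocity fields -/

theorem memLp_comp (u : L2) (i : Fin 3) : MemLp (fun x => ((u x i : ℝ) : ℂ)) 2 μΩ :=
  ((EuclideanSpace.proj (𝕜 := ℝ) i : E3 →L[ℝ] ℝ).comp_memLp' (Lp.memLp u)).ofReal

theorem integrable_comp (u : L2) (i : Fin 3) : Integrable (fun x => ((u x i : ℝ) : ℂ)) μΩ :=
  (memLp_comp u i).integrable one_le_two

theorem fourier_congr {u v : E3 → E3} (h : u =ᵐ[μΩ] v) : fourier u = fourier v := by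
  funext k
  ext i
  rw [fourier_apply, fourier_apply]
  refine coeff_congr ?_ k
  filter_upwards [h] with x hx
  rw [hx]

theorem fourier_add (u v : L2) : fourier (u + v : L2) = fourier u + fourier v := by
  rw [fourier_congr (Lp.coeFn_add u v)]
  funext k
  ext i
  simp only [fourier_apply, Pi.add_apply, PiLp.add_apply, Complex.ofReal_add]
  exact coeff_add (integrable_comp u i) (integrable_comp v i) k

theorem fourier_smul (r : ℝ) (u : L2) : fourier (r • u : L2) = r • fourier u := by
  rw [fourier_congr (Lp.coeFn_smul r u)]
  funext k
  ext i
  simp only [fourier_apply, Pi.smul_apply, PiLp.smul_apply, smul_eq_mul, Complex.ofReal_mul,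
    Complex.real_smul]
  exact coeff_const_mul _ _ k

theorem fourier_neg_freq (v : E3 → E3) (k : Freq) (j : Fin 3) :
    fourier v (-k) j = starRingEnd ℂ (fourier v k j) := by
  have := coeff_conj (fun x => (v x j : ℂ)) (-k)
  simp only [Complex.conj_ofReal, neg_neg] at this
  exact this

/-- Parseval's identity. -/
theorem hasSum_fourier_sq (u : L2) : HasSum (fun k => 2 * ‖fourier u k‖ ^ 2) (‖u‖ ^ 2) := by
  have h : ∀ i, HasSum (fun k => 2 * ‖fourier u k i‖ ^ 2) (∫ x in Ω, (u x i) ^ 2) := by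
    intro i
    have := (hasSum_norm_coeff_sq (memLp_comp u i)).mul_left 2
    simp only [← fourier_apply, ← mul_assoc] at this
    simpa using this
  have h2 := hasSum_sum (s := Finset.univ) fun i _ => h i
  have e : ‖u‖ ^ 2 = ∑ i, ∫ x in Ω, (u x i) ^ 2 := by
    have hi : ∀ i : Fin 3, Integrable (fun x => (u x i) ^ 2) μΩ := fun i => by
      have := (memLp_comp u i).integrable_norm_pow two_ne_zero
      simpa using this
    rw [← integral_finsetSum _ fun i _ => hi i, ← real_inner_self_eq_norm_sq, L2.inner_def]
    refine integral_congr_ae (ae_of_all _ fun x => ?_)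
    change inner ℝ (u x) (u x) = _
    rw [real_inner_self_eq_norm_sq, EuclideanSpace.real_norm_sq_eq]
  rw [e]
  convert h2 using 1
  funext k
  rw [EuclideanSpace.norm_sq_eq, Finset.mul_sum]

theorem two_mul_norm_fourier_sq_le (u : L2) (k : Freq) : 2 * ‖fourier u k‖ ^ 2 ≤ ‖u‖ ^ 2 :=
  le_hasSum (hasSum_fourier_sq u) k fun _ _ => by positivity

/-- A Fourier coefficient as a continuous linear map. -/
def fourierCLM (k : Freq) : L2 →L[ℝ] C3 :=
  LinearMap.mkContinuous
    { toFun := fun u => fourier u k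
      map_add' := fun u v => by rw [fourier_add]; rfl
      map_smul' := fun r u => by rw [fourier_smul]; rfl } 1 fun u => by
    rw [one_mul]
    refine (sq_le_sq₀ (norm_nonneg _) (norm_nonneg _)).1 ?_
    have := two_mul_norm_fourier_sq_le u k
    change ‖fourier u k‖ ^ 2 ≤ _
    nlinarith [sq_nonneg ‖fourier u k‖]

theorem fourier_sub (u v : L2) : fourier (u - v : L2) = fourier u - fourier v := by
  funext k
  exact (fourierCLM k).map_sub u v

theorem fourier_injective {u v : L2} (h : fourier u = fourier v) : u = v := by
  have h1 := hasSum_fourier_sq (u - v)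
  rw [fourier_sub, h, sub_self] at h1
  simp only [Pi.zero_apply, norm_zero, zero_pow two_ne_zero, mul_zero] at h1
  have h2 := h1.unique (hasSum_zero (α := ℝ) (β := Freq))
  exact sub_eq_zero.1 (norm_eq_zero.1 (pow_eq_zero_iff two_ne_zero |>.1 h2))

theorem memℓp_of_summable_sq {E : Type*} [NormedAddCommGroup E] {c : Freq → E}
    (hc : Summable fun k => ‖c k‖ ^ 2) : Memℓp c 2 :=
  memℓp_gen (by simpa using hc)

/-- Every square summable family of coefficients with `c(-k) = conj c(k)` belongs to a real field. -/
theorem exists_fourier_eq {c : Freq → C3} (hs : ∀ k j, c (-k) j = starRingEnd ℂ (c k j))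
    (hc : Summable fun k => ‖c k‖ ^ 2) : ∃ u : L2, fourier u = c := by
  have hi : ∀ i, Memℓp (fun k => c k i) 2 := fun i =>
    memℓp_of_summable_sq (hc.of_nonneg_of_le (fun _ => by positivity) fun k => by
      gcongr
      exact PiLp.norm_apply_le (c k) i)
  choose h hm hh using fun i => exists_coeff_eq (hi i)
  have hreal : ∀ i, (fun x => (((h i x).re : ℝ) : ℂ)) =ᵐ[μΩ] h i := by
    intro i
    have h1 : (fun x => starRingEnd ℂ (h i x)) =ᵐ[μΩ] h i := by
      refine ae_eq_of_coeff_eq (hm i).star (hm i) fun k => ?_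
      simp only [coeff_conj, hh i, hs, Complex.conj_conj]
    filter_upwards [h1] with x hx
    exact Complex.conj_eq_iff_re.1 hx
  have hm2 : MemLp (fun x => (WithLp.toLp 2 fun i => (h i x).re : E3)) 2 μΩ :=
    MemLp.of_eval_piLp fun i => (hm i).re
  refine ⟨hm2.toLp _, ?_⟩
  rw [fourier_congr hm2.coeFn_toLp]
  funext k
  ext i
  rw [fourier_apply]
  change coeff (fun x => (((h i x).re : ℝ) : ℂ)) k = _
  rw [coeff_congr (hreal i), hh i]

theorem isSmoothPeriodic_comp {F G : Type*} [NormedAddCommGroup F] [NormedSpace ℝ F]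
    [NormedAddCommGroup G] [NormedSpace ℝ G] (L : F →L[ℝ] G) {φ : E3 → F} (hφ : IsSmoothPeriodic φ) :
    IsSmoothPeriodic fun x => L (φ x) :=
  ⟨L.contDiff.comp hφ.1, fun j x => by simp only [hφ.2]⟩

theorem partialDeriv_comp {F G : Type*} [NormedAddCommGroup F] [NormedSpace ℝ F]
    [NormedAddCommGroup G] [NormedSpace ℝ G] (L : F →L[ℝ] G) {φ : E3 → F} (hφ : IsSmoothPeriodic φ)
    (j : Fin 3) (x : E3) : partialDeriv j (fun x => L (φ x)) x = L (partialDeriv j φ x) := by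
  have h1 : DifferentiableAt ℝ φ x := (hφ.1.differentiable (by simp)).differentiableAt
  have h2 := (L.hasFDerivAt (x := φ x)).comp x h1.hasFDerivAt
  have h3 : fderiv ℝ (fun x => L (φ x)) x = L.comp (fderiv ℝ φ x) := h2.fderiv
  simp [partialDeriv, h3]

theorem coeff_ofReal_partialDeriv {φ : E3 → ℝ} (hφ : IsSmoothPeriodic φ) (j : Fin 3) (k : Freq) :
    coeff (fun x => ((partialDeriv j φ x : ℝ) : ℂ)) k
      = Complex.I * wave k j * coeff (fun x => ((φ x : ℝ) : ℂ)) k := by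
  have h := coeff_partialDeriv (isSmoothPeriodic_comp Complex.ofRealCLM hφ) j k
  rw [funext fun x => partialDeriv_comp Complex.ofRealCLM hφ j x] at h
  exact h

/-- The fields in `L²_σ(Ω)` have solenoidal Fourier coefficients. -/
theorem sum_wave_mul_fourier {u : L2} (hu : u ∈ L2sigma) (k : Freq) :
    ∑ j, (wave k j : ℂ) * fourier u k j = 0 := by
  have hclosed : IsClosed {u : L2 | ∑ j, (wave k j : ℂ) * fourierCLM k u j = 0} :=
    isClosed_eq (continuous_finsetSum _ fun j _ => continuous_const.mul
      ((PiLp.continuous_apply 2 (fun _ : Fin 3 => ℂ) j).comp (fourierCLM k).continuous))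
      continuous_const
  refine (closure_minimal ?_ hclosed) (by exact hu)
  rintro u ⟨φ, hφ, hdiv, hu⟩
  change ∑ j, (wave k j : ℂ) * fourier u k j = 0
  rw [fourier_congr hu]
  have hcomp : ∀ j : Fin 3, IsSmoothPeriodic fun x => φ x j := fun j =>
    isSmoothPeriodic_comp (EuclideanSpace.proj (𝕜 := ℝ) j : E3 →L[ℝ] ℝ) hφ
  have h1 : ∀ j, (wave k j : ℂ) * fourier φ k j
      = -Complex.I * coeff (fun x => ((partialDeriv j (fun x => φ x j) x : ℝ) : ℂ)) k := by
    intro j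
    rw [coeff_ofReal_partialDeriv (hcomp j), fourier_apply]
    linear_combination ((wave k j : ℂ) * coeff (fun x => ((φ x j : ℝ) : ℂ)) k) * Complex.I_mul_I
  simp only [h1]
  rw [← Finset.mul_sum, ← coeff_finset_sum]
  · have h2 : (fun x => ∑ j, ((partialDeriv j (fun x => φ x j) x : ℝ) : ℂ)) = fun _ => 0 := by
      funext x
      rw [← Complex.ofReal_sum, ← Complex.ofReal_zero]
      congr 1
      rw [← hdiv x]
      refine Finset.sum_congr rfl fun j _ => ?_
      exact partialDeriv_comp (EuclideanSpace.proj (𝕜 := ℝ) j : E3 →L[ℝ] ℝ) hφ j x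
    rw [h2]
    simp [coeff]
  · intro j _
    exact integrable_of_continuous
      (Complex.continuous_ofReal.comp ((hcomp j).continuous_partialDeriv j))

theorem coeff_expo (k m : Freq) : coeff (expo k) m = if m = k then 1 else 0 := by
  rw [coeff_eq_mFourierCoeff]
  have : expo k ∘ cellPoint = UnitAddTorus.mFourier k := by
    funext y
    rw [Function.comp_apply, ← mFourier_torusPoint, torusPoint_cellPoint]
  have h2 := UnitAddTorus.mFourierBasis_repr (UnitAddTorus.mFourierBasis (d := Fin 3) k) m
  rw [HilbertBasis.repr_self, UnitAddTorus.coe_mFourierBasis, UnitAddTorus.mFourierCoeff_toLp] at h2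
  rw [this, ← h2, lp.single_apply, Pi.single_apply]

/-- The finite box of the frequencies with coordinates of size at most `n`. -/
def freqBox (n : ℕ) : Finset Freq := Fintype.piFinset fun _ => Finset.Icc (-(n : ℤ)) n

theorem mem_freqBox {n : ℕ} {k : Freq} : k ∈ freqBox n ↔ ∀ j, |k j| ≤ n := by
  simp [freqBox, abs_le]

theorem neg_mem_freqBox {n : ℕ} {k : Freq} : -k ∈ freqBox n ↔ k ∈ freqBox n := by
  simp [mem_freqBox]

theorem tendsto_freqBox : Filter.Tendsto freqBox Filter.atTop Filter.atTop := by
  refine Filter.tendsto_atTop_finset_of_monotone (fun m n hmn k hk => ?_) fun k => ?_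
  · rw [mem_freqBox] at hk ⊢
    exact fun j => (hk j).trans (by exact_mod_cast hmn)
  · refine ⟨∑ j, (k j).natAbs, mem_freqBox.2 fun j => ?_⟩
    rw [Int.abs_eq_natAbs]
    exact_mod_cast Finset.single_le_sum (f := fun j => (k j).natAbs) (fun _ _ => Nat.zero_le _)
      (Finset.mem_univ j)

/-- A real solenoidal trigonometric polynomial is a smooth solenoidal field. -/
theorem mem_smoothSolenoidal_of_finite {u : L2} {S : Finset Freq} (hS : ∀ k ∉ S, fourier u k = 0)
    (hdiv : ∀ k, ∑ j, (wave k j : ℂ) * fourier u k j = 0) : u ∈ smoothSolenoidal := by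
  set c := fourier u
  set P : Fin 3 → E3 → ℂ := fun i x => ∑ k ∈ S, c k i * expo k x with hP
  have hPs : ∀ i, ContDiff ℝ ∞ (P i) := fun i =>
    ContDiff.sum fun k _ => contDiff_const.mul (contDiff_expo k)
  have hPp : ∀ i, IsSmoothPeriodic (P i) := fun i =>
    ⟨hPs i, fun j x => by simp only [hP, exists_expo_periodic]⟩
  have hPu : ∀ i, (fun x => ((u x i : ℝ) : ℂ)) =ᵐ[μΩ] P i := by
    intro i
    refine ae_eq_of_coeff_eq (memLp_comp u i) (memLp_two_of_continuous (hPs i).continuous)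
      fun k => ?_
    rw [← fourier_apply, hP]
    simp only
    rw [coeff_finset_sum S (h := fun m x => c m i * expo m x) fun m _ => integrable_of_continuous
      (continuous_const.mul (continuous_expo m))]
    simp only [coeff_const_mul, coeff_expo]
    by_cases hk : k ∈ S
    · simp [hk, c]
    · have := hS k hk
      simp [hk, c] at this ⊢
      rw [this]
      rfl
  have hdP : ∀ i j x, partialDeriv j (P i) x = ∑ k ∈ S, c k i * (Complex.I * wave k j * expo k x) := by
    intro i j x
    have hd : ∀ k, DifferentiableAt ℝ (expo k) x := fun k =>
      ((contDiff_expo k).differentiable (by simp)).differentiableAt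
    have h1 : fderiv ℝ (P i) x = ∑ k ∈ S, c k i • fderiv ℝ (expo k) x := by
      rw [hP]
      simp only
      rw [fderiv_fun_sum fun k _ => (hd k).const_mul _]
      refine Finset.sum_congr rfl fun k _ => ?_
      exact fderiv_const_mul (hd k) _
    rw [partialDeriv, h1, sum_apply]
    refine Finset.sum_congr rfl fun k _ => ?_
    rw [smul_apply, smul_eq_mul, ← partialDeriv_expo]
    rfl
  set φ : E3 → E3 := fun x => WithLp.toLp 2 fun i => (P i x).re
  have hφ : IsSmoothPeriodic φ := by
    refine ⟨contDiff_piLp' 2 fun i => Complex.reCLM.contDiff.comp (hPs i), fun j x => ?_⟩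
    ext i
    simp only [φ, (hPp i).2]
  refine ⟨φ, hφ, fun x => ?_, ?_⟩
  · have h1 : ∀ j, partialDeriv j φ x j = (partialDeriv j (P j) x).re := fun j => by
      have e1 := partialDeriv_comp (EuclideanSpace.proj (𝕜 := ℝ) j : E3 →L[ℝ] ℝ) hφ j x
      have e2 := partialDeriv_comp Complex.reCLM (hPp j) j x
      exact e1.symm.trans e2
    simp only [divergence, h1]
    rw [← Complex.re_sum]
    simp only [hdP]
    rw [Finset.sum_comm, Finset.sum_eq_zero fun k _ => ?_, Complex.zero_re]
    calc ∑ j, c k j * (Complex.I * wave k j * expo k x)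
        = Complex.I * expo k x * ∑ j, (wave k j : ℂ) * c k j := by
          rw [Finset.mul_sum]
          exact Finset.sum_congr rfl fun j _ => by ring
      _ = 0 := by rw [hdiv k, mul_zero]
  · have := ae_all_iff.2 hPu
    filter_upwards [this] with x hx
    ext i
    simp only [φ, ← hx i, Complex.ofReal_re]

/-- Every square summable family of real, solenoidal coefficients belongs to a field in `L²_σ(Ω)`. -/
theorem exists_L2sigma_fourier_eq {c : Freq → C3} (hs : ∀ k j, c (-k) j = starRingEnd ℂ (c k j))
    (hdiv : ∀ k, ∑ j, (wave k j : ℂ) * c k j = 0) (hc : Summable fun k => ‖c k‖ ^ 2) :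
    ∃ u : L2sigma, fourier (u : L2) = c := by
  obtain ⟨u, hu⟩ := exists_fourier_eq hs hc
  have hn : ∀ n : ℕ, ∃ v : L2, fourier v = fun k => if k ∈ freqBox n then c k else 0 := by
    intro n
    refine exists_fourier_eq (fun k j => ?_) (hc.of_nonneg_of_le (fun _ => by positivity) fun k => ?_)
    · simp only [neg_mem_freqBox]
      split_ifs
      · exact hs k j
      · simp
    · split_ifs <;> simp
  choose v hv using hn
  have hmem : ∀ n, v n ∈ smoothSolenoidal := fun n =>
    mem_smoothSolenoidal_of_finite (S := freqBox n) (fun k hk => by simp [hv n, hk]) fun k => by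
      simp only [hv n]
      split_ifs
      · exact hdiv k
      · simp
  have hlim : Filter.Tendsto v Filter.atTop (nhds u) := by
    rw [tendsto_iff_norm_sub_tendsto_zero]
    have h1 : ∀ n, ‖v n - u‖ ^ 2 = (∑' k, 2 * ‖c k‖ ^ 2) - ∑ k ∈ freqBox n, 2 * ‖c k‖ ^ 2 := by
      intro n
      have h2 := hasSum_fourier_sq (v n - u)
      rw [fourier_sub, hv n, hu] at h2
      have h3 : HasSum (fun k => 2 * ‖c k‖ ^ 2 - (if k ∈ freqBox n then 2 * ‖c k‖ ^ 2 else 0))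
          ((∑' k, 2 * ‖c k‖ ^ 2) - ∑ k ∈ freqBox n, 2 * ‖c k‖ ^ 2) := by
        refine (hc.mul_left 2).hasSum.sub ?_
        rw [← Finset.sum_congr rfl fun k hk => if_pos hk]
        exact hasSum_sum_of_ne_finset_zero fun k hk => if_neg hk
      refine h2.unique ?_
      convert h3 using 1
      funext k
      simp only [Pi.sub_apply]
      split_ifs <;> simp
    have h2 : Filter.Tendsto (fun n => ‖v n - u‖ ^ 2) Filter.atTop (nhds 0) := by
      simp only [h1]
      have := ((hc.mul_left 2).hasSum.comp tendsto_freqBox).const_sub (∑' k, 2 * ‖c k‖ ^ 2)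
      simpa using this
    have h3 := (Real.continuous_sqrt.tendsto 0).comp h2
    simpa [Function.comp_def, Real.sqrt_sq (norm_nonneg _)] using h3
  exact ⟨⟨u, mem_closure_of_tendsto hlim (Filter.Eventually.of_forall hmem)⟩, hu⟩

/-- Weak gradients in terms of Fourier coefficients. -/
theorem isWeakGradient_iff (u : L2) (G : Fin 3 → L2) : IsWeakGradient u G ↔
    ∀ j k, fourier (G j) k = (Complex.I * wave k j) • fourier u k := by
  constructor
  · intro h j k
    have hre := fun i => h (fun x => (expo (-k) x).re)
      (isSmoothPeriodic_comp Complex.reCLM (isSmoothPeriodic_expo (-k))) i j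
    have him := fun i => h (fun x => (expo (-k) x).im)
      (isSmoothPeriodic_comp Complex.imCLM (isSmoothPeriodic_expo (-k))) i j
    have ere : ∀ x, partialDeriv j (fun x => (expo (-k) x).re) x
        = (partialDeriv j (expo (-k)) x).re := fun x =>
      partialDeriv_comp Complex.reCLM (isSmoothPeriodic_expo (-k)) j x
    have eim : ∀ x, partialDeriv j (fun x => (expo (-k) x).im) x
        = (partialDeriv j (expo (-k)) x).im := fun x =>
      partialDeriv_comp Complex.imCLM (isSmoothPeriodic_expo (-k)) j x
    simp only [ere, eim] at hre him
    ext i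
    -- the tests with the real and the imaginary part of `e^{-i ξ·x}` combine to a complex identity
    have hint : ∀ (w : L2) (H : E3 → ℂ), Continuous H → Integrable (fun x => ((w x i : ℝ) : ℂ) * H x) μΩ :=
      fun w H hH => (memLp_comp w i).integrable_mul (memLp_two_of_continuous hH)
    have hsplit : ∀ (w : L2) (H : E3 → ℂ), Continuous H →
        ∫ x in Ω, ((w x i : ℝ) : ℂ) * H x
          = ((∫ x in Ω, w x i * (H x).re : ℝ) : ℂ) + (∫ x in Ω, w x i * (H x).im : ℝ) * Complex.I := by
      intro w H hH
      have := integral_re_add_im (hint w H hH)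
      rw [← this]
      simp
    have key : ∫ x in Ω, ((u x i : ℝ) : ℂ) * partialDeriv j (expo (-k)) x
        = -∫ x in Ω, ((G j x i : ℝ) : ℂ) * expo (-k) x := by
      rw [hsplit u _ ((isSmoothPeriodic_expo (-k)).continuous_partialDeriv j),
        hsplit (G j) _ (continuous_expo _), hre i, him i]
      push_cast
      ring
    simp only [partialDeriv_expo] at key
    rw [PiLp.smul_apply, fourier_apply, fourier_apply, coeff_eq, coeff_eq, smul_eq_mul]
    have e1 : ∫ x in Ω, expo (-k) x * ((G j x i : ℝ) : ℂ)
        = ∫ x in Ω, ((G j x i : ℝ) : ℂ) * expo (-k) x := by simp only [mul_comm]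
    have e2 : ∫ x in Ω, ((u x i : ℝ) : ℂ) * (Complex.I * wave (-k) j * expo (-k) x)
        = -(Complex.I * wave k j) * ∫ x in Ω, expo (-k) x * ((u x i : ℝ) : ℂ) := by
      rw [← integral_const_mul]
      refine integral_congr_ae (ae_of_all _ fun x => ?_)
      simp [wave_neg]
      ring
    rw [e2] at key
    rw [e1]
    linear_combination (1 / 2 : ℂ) * key
  · intro h φ hφ i j
    have hφc : Continuous φ := hφ.1.continuous
    have hφm : MemLp (fun x => ((φ x : ℝ) : ℂ)) 2 μΩ :=
      memLp_two_of_continuous (Complex.continuous_ofReal.comp hφc)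
    have hdm : MemLp (fun x => ((partialDeriv j φ x : ℝ) : ℂ)) 2 μΩ :=
      memLp_two_of_continuous (Complex.continuous_ofReal.comp (hφ.continuous_partialDeriv j))
    have h1 := hasSum_conj_coeff_mul (memLp_comp u i) hdm
    have h2 := (hasSum_conj_coeff_mul (memLp_comp (G j) i) hφm).neg
    have e : (fun k => starRingEnd ℂ (coeff (fun x => ((u x i : ℝ) : ℂ)) k) *
        coeff (fun x => ((partialDeriv j φ x : ℝ) : ℂ)) k)
        = fun k => -(starRingEnd ℂ (coeff (fun x => ((G j x i : ℝ) : ℂ)) k) *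
          coeff (fun x => ((φ x : ℝ) : ℂ)) k) := by
      funext k
      have := congrArg (fun z : C3 => z i) (h j k)
      simp only [PiLp.smul_apply, smul_eq_mul, fourier_apply] at this
      rw [coeff_ofReal_partialDeriv hφ, this, map_mul, map_mul, Complex.conj_I, Complex.conj_ofReal]
      ring
    rw [e] at h1
    have h3 := h1.unique h2
    simp only [Complex.conj_ofReal, ← Complex.ofReal_mul, integral_complex_ofReal] at h3
    have h4 : ((∫ x in Ω, u x i * partialDeriv j φ x : ℝ) : ℂ)
        = ((-∫ x in Ω, G j x i * φ x : ℝ) : ℂ) := by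
      push_cast
      linear_combination 2 * h3
    exact_mod_cast h4

/-- The Fourier coefficients of the convection term are a convolution. -/
theorem hasSum_fourier_convection (u : L2) (G : Fin 3 → L2) (k : Freq) :
    HasSum (fun l => ∑ j, fourier u l j • fourier (G j) (k - l)) (fourier (convection u G) k) := by
  have h : ∀ i, HasSum (fun l => ∑ j, fourier u l j * fourier (G j) (k - l) i)
      (fourier (convection u G) k i) := by
    intro i
    have h1 := hasSum_sum (s := Finset.univ) fun j (_ : j ∈ Finset.univ) =>
      hasSum_coeff_mul (memLp_comp u j) (memLp_comp (G j) i) k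
    rw [← coeff_finset_sum] at h1
    · have e : coeff (fun x => ∑ j, ((u x j : ℝ) : ℂ) * ((G j x i : ℝ) : ℂ)) k
          = fourier (convection u G) k i := by
        rw [fourier_apply]
        congr 1
        funext x
        simp [convection]
      rw [← e]
      exact h1
    · exact fun j _ => (memLp_comp u j).integrable_mul (memLp_comp (G j) i)
  have h2 : HasSum (fun l i => (∑ j, fourier u l j • fourier (G j) (k - l)) i)
      (fun i => fourier (convection u G) k i) := by
    rw [Pi.hasSum]
    intro i
    simpa using h i
  exact h2.mapL (PiLp.continuousLinearEquiv 2 ℂ (fun _ : Fin 3 => ℂ)).symm.toContinuousLinearMap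

/-! ### The norms of the scale `D(A^s)` as sums -/

/-- The square of the norm of `D(A^s)`, as an extended sum over any family of coefficients. -/
def en (A : HyperOp) (s : ℝ) (c : Freq → C3) : ℝ≥0∞ :=
  ∑' k, ENNReal.ofReal ((1 + A.symbol k) ^ (2 * s)) * ‖c k‖ₑ ^ 2

/-- The coefficients of real solenoidal distributions. -/
structure IsReal3 (c : Freq → C3) : Prop where
  conj : ∀ k j, c (-k) j = starRingEnd ℂ (c k j)
  div : ∀ k, ∑ j, (wave k j : ℂ) * c k j = 0

theorem HyperOp.one_add_symbol_pos (A : HyperOp) (k : Freq) : 0 < 1 + A.symbol k := by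
  linarith [A.symbol_nonneg k]

theorem en_zero (A : HyperOp) (c : Freq → C3) : en A 0 c = ∑' k, ‖c k‖ₑ ^ 2 := by
  simp [en]

theorem en_half (A : HyperOp) (c : Freq → C3) :
    en A (1 / 2) c = ∑' k, ENNReal.ofReal (1 + A.symbol k) * ‖c k‖ₑ ^ 2 := by
  simp [en]

theorem en_neg_half (A : HyperOp) (c : Freq → C3) :
    en A (-1 / 2) c = ∑' k, (ENNReal.ofReal (1 + A.symbol k))⁻¹ * ‖c k‖ₑ ^ 2 := by
  simp only [en]
  congr 1
  funext k
  rw [← ENNReal.ofReal_inv_of_pos (A.one_add_symbol_pos k), ← Real.rpow_neg_one]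
  norm_num

theorem en_quarter (A : HyperOp) (c : Freq → C3) :
    en A (1 / 4) c = ∑' k, ENNReal.ofReal (A.sig k) * ‖c k‖ₑ ^ 2 := by
  simp only [en, HyperOp.sig, Real.sqrt_eq_rpow]
  norm_num

theorem en_zero_le_half (A : HyperOp) (c : Freq → C3) : en A 0 c ≤ en A (1 / 2) c := by
  rw [en_zero, en_half]
  refine ENNReal.tsum_le_tsum fun k => le_mul_of_one_le_left' ?_
  rw [ENNReal.one_le_ofReal]
  linarith [A.symbol_nonneg k]

/-- Interpolation. -/
theorem en_quarter_sq_le (A : HyperOp) (c : Freq → C3) :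
    en A (1 / 4) c ^ 2 ≤ en A 0 c * en A (1 / 2) c := by
  rw [en_quarter, en_zero, en_half]
  have hs0 : ∀ k, ENNReal.ofReal (A.sig k) ≠ 0 := fun k => (ENNReal.ofReal_pos.2 (A.sig_pos k)).ne'
  have := sq_tsum_mul_le (fun _ : Freq => 1) (fun k => ‖c k‖ₑ)
    (fun k => ENNReal.ofReal (A.sig k) * ‖c k‖ₑ) (by simp) (by simp)
  simp only [one_mul, inv_one, mul_pow, ← ENNReal.ofReal_pow (A.sig_pos _).le, A.sig_sq] at this
  refine le_trans (le_of_eq ?_) this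
  congr 2
  funext k
  ring

theorem ofReal_sq_norm {E : Type*} [NormedAddCommGroup E] (x : E) :
    ENNReal.ofReal (‖x‖ ^ 2) = ‖x‖ₑ ^ 2 := by
  rw [ENNReal.ofReal_pow (norm_nonneg _), ofReal_norm]

theorem Dom.hasSum {A : HyperOp} {s : ℝ} (c : Dom A s) :
    HasSum (fun k => (1 + A.symbol k) ^ (2 * s) * ‖c.coef k‖ ^ 2) (‖c‖ ^ 2) := by
  have h := lp.hasSum_norm (p := 2) (by simp) (Dom.toSeq A s c)
  have e : ‖c‖ = ‖Dom.toSeq A s c‖ := rfl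
  simp only [ENNReal.toReal_ofNat, Real.rpow_two] at h
  rw [e]
  convert h using 1
  funext k
  change _ = ‖(1 + A.symbol k) ^ s • c.coef k‖ ^ 2
  rw [norm_smul, Real.norm_of_nonneg (A.weight_pos s k).le, mul_pow, mul_comm 2 s, Real.rpow_mul
    (A.one_add_symbol_pos k).le, Real.rpow_two]

theorem Dom.enorm_sq {A : HyperOp} {s : ℝ} (c : Dom A s) : ‖c‖ₑ ^ 2 = en A s c.coef := by
  have h := c.hasSum
  have hpos : ∀ k, 0 ≤ (1 + A.symbol k) ^ (2 * s) := fun k => (A.weight_pos _ k).le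
  rw [← ofReal_sq_norm, ← h.tsum_eq, ENNReal.ofReal_tsum_of_nonneg
    (fun k => mul_nonneg (hpos k) (sq_nonneg _)) h.summable, en]
  congr 1
  funext k
  rw [ENNReal.ofReal_mul (hpos k), ofReal_sq_norm]

theorem Dom.isReal3 {A : HyperOp} {s : ℝ} (c : Dom A s) : IsReal3 c.coef := ⟨c.2.1, c.2.2.1⟩

theorem Dom.ext {A : HyperOp} {s : ℝ} {c d : Dom A s} (h : c.coef = d.coef) : c = d :=
  Subtype.ext h

theorem Dom.coef_sub {A : HyperOp} {s : ℝ} (c d : Dom A s) : (c - d).coef = c.coef - d.coef := rfl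

theorem summable_of_en {A : HyperOp} {s : ℝ} {c : Freq → C3} (h : en A s c < ⊤) :
    Summable fun k => (1 + A.symbol k) ^ (2 * s) * ‖c k‖ ^ 2 := by
  have hpos : ∀ k, 0 ≤ (1 + A.symbol k) ^ (2 * s) := fun k => (A.weight_pos _ k).le
  refine (ENNReal.summable_toReal h.ne).congr fun k => ?_
  rw [ENNReal.toReal_mul, ENNReal.toReal_ofReal (hpos k)]
  simp

/-- The element of `D(A^s)` with given coefficients. -/
def Dom.of {A : HyperOp} {s : ℝ} {c : Freq → C3} (h : IsReal3 c) (hfin : en A s c < ⊤) : Dom A s :=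
  ⟨c, h.conj, h.div, memℓp_of_summable_sq <| (summable_of_en hfin).congr fun k => by
    rw [norm_smul, Real.norm_of_nonneg (A.weight_pos s k).le, mul_pow, mul_comm 2 s, Real.rpow_mul
      (A.one_add_symbol_pos k).le, Real.rpow_two]⟩

theorem Dom.coef_of {A : HyperOp} {s : ℝ} {c : Freq → C3} (h : IsReal3 c) (hfin : en A s c < ⊤) :
    (Dom.of (A := A) (s := s) h hfin).coef = c := rfl

theorem IsReal3.sub {c d : Freq → C3} (hc : IsReal3 c) (hd : IsReal3 d) : IsReal3 (c - d) :=
  ⟨fun k j => by simp [hc.conj, hd.conj], fun k => by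
    simp [mul_sub, hc.div, hd.div]⟩

theorem IsReal3.add {c d : Freq → C3} (hc : IsReal3 c) (hd : IsReal3 d) : IsReal3 (c + d) :=
  ⟨fun k j => by simp [hc.conj, hd.conj], fun k => by
    simp [mul_add, Finset.sum_add_distrib, hc.div, hd.div]⟩

theorem IsReal3.symbol_smul {c : Freq → C3} (hc : IsReal3 c) {a : Freq → ℝ}
    (ha : ∀ k, a (-k) = a k) : IsReal3 fun k => a k • c k :=
  ⟨fun k j => by simp [hc.conj, ha], fun k => by
    have := congrArg ((a k : ℂ) * ·) (hc.div k)
    simp only [Finset.mul_sum, mul_zero] at this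
    rw [← this]
    exact Finset.sum_congr rfl fun j _ => by simp; ring⟩

theorem add_sq_le_two_mul (a b : ℝ≥0∞) : (a + b) ^ 2 ≤ 2 * (a ^ 2 + b ^ 2) := by
  have := ENNReal.rpow_add_le_mul_rpow_add_rpow a b (one_le_two : (1:ℝ) ≤ 2)
  norm_num at this
  exact this

theorem en_add_le (A : HyperOp) (s : ℝ) (c d : Freq → C3) :
    en A s (c + d) ≤ 2 * (en A s c + en A s d) := by
  simp only [en]
  rw [← ENNReal.tsum_add, ← ENNReal.tsum_mul_left]
  refine ENNReal.tsum_le_tsum fun k => ?_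
  calc _ ≤ ENNReal.ofReal ((1 + A.symbol k) ^ (2 * s)) * (2 * (‖c k‖ₑ ^ 2 + ‖d k‖ₑ ^ 2)) := by
        gcongr
        exact (pow_le_pow_left' (enorm_add_le _ _) 2).trans (add_sq_le_two_mul _ _)
    _ = _ := by ring

theorem en_sub_le (A : HyperOp) (s : ℝ) (c d : Freq → C3) :
    en A s (c - d) ≤ 2 * (en A s c + en A s d) := by
  have := en_add_le A s c (-d)
  rw [← sub_eq_add_neg] at this
  simpa [en] using this

/-- `A` maps `D(A^{1/2})` to `D(A^{-1/2})`. -/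
theorem en_symbol_smul_le (A : HyperOp) (c : Freq → C3) :
    en A (-1 / 2) (fun k => A.symbol k • c k) ≤ en A (1 / 2) c := by
  rw [en_half, en]
  refine ENNReal.tsum_le_tsum fun k => ?_
  have h1 := A.one_add_symbol_pos k
  have h0 := A.symbol_nonneg k
  rw [← ofReal_sq_norm, ← ofReal_sq_norm, ← ENNReal.ofReal_mul (A.weight_pos _ k).le,
    ← ENNReal.ofReal_mul h1.le]
  refine ENNReal.ofReal_le_ofReal ?_
  rw [norm_smul, Real.norm_of_nonneg h0, mul_pow, ← mul_assoc]
  gcongr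
  rw [show (2 * (-1 / 2) : ℝ) = -1 by norm_num, Real.rpow_neg_one, inv_mul_eq_div, div_le_iff₀ h1]
  nlinarith

/-- The duality between `D(A^{-1/2})` and `D(A^{1/2})`. -/
theorem sq_tsum_enorm_mul_le (A : HyperOp) (g y : Freq → C3) :
    (∑' k, ‖g k‖ₑ * ‖y k‖ₑ) ^ 2 ≤ en A (-1 / 2) g * en A (1 / 2) y := by
  rw [en_half, en_neg_half]
  have h := sq_tsum_mul_le (fun k => (ENNReal.ofReal (1 + A.symbol k))⁻¹) (fun k => ‖g k‖ₑ)
    (fun k => ‖y k‖ₑ) (by simp)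
    (fun k => by simpa using (A.one_add_symbol_pos k))
  simpa using h

/-- The duality pairing of two families, normalized without the factor `|Ω| = 2`. -/
def pair (g y : Freq → C3) : ℝ := ∑' k, (inner ℂ (g k) (y k)).re

theorem enorm_re_inner_le (x y : C3) : ‖(inner ℂ x y).re‖ₑ ≤ ‖x‖ₑ * ‖y‖ₑ := by
  rw [← ofReal_norm, ← ofReal_norm, ← ofReal_norm, ← ENNReal.ofReal_mul (norm_nonneg _)]
  exact ENNReal.ofReal_le_ofReal ((Complex.abs_re_le_norm _).trans (norm_inner_le_norm _ _))

theorem summable_pair {A : HyperOp} {g y : Freq → C3} (hg : en A (-1 / 2) g < ⊤)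
    (hy : en A (1 / 2) y < ⊤) : Summable fun k => (inner ℂ (g k) (y k)).re := by
  refine Summable.of_enorm (ne_top_of_le_ne_top ?_
    (ENNReal.tsum_le_tsum fun k => enorm_re_inner_le (g k) (y k)))
  intro h
  have := sq_tsum_enorm_mul_le A g y
  rw [h] at this
  simp only [ne_eq, OfNat.ofNat_ne_zero, not_false_eq_true, ENNReal.top_pow, top_le_iff] at this
  exact (ENNReal.mul_lt_top hg hy).ne this

theorem enorm_pair_sq_le (A : HyperOp) (g y : Freq → C3) :
    ‖pair g y‖ₑ ^ 2 ≤ en A (-1 / 2) g * en A (1 / 2) y := by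
  refine le_trans ?_ (sq_tsum_enorm_mul_le A g y)
  gcongr
  exact enorm_tsum_le_tsum_enorm.trans (ENNReal.tsum_le_tsum fun k => enorm_re_inner_le _ _)

theorem pair_add {A : HyperOp} {g h y : Freq → C3} (hg : en A (-1 / 2) g < ⊤)
    (hh : en A (-1 / 2) h < ⊤) (hy : en A (1 / 2) y < ⊤) :
    pair (g + h) y = pair g y + pair h y := by
  rw [pair, pair, pair, ← (summable_pair hg hy).tsum_add (summable_pair hh hy)]
  simp

theorem pair_sub {A : HyperOp} {g h y : Freq → C3} (hg : en A (-1 / 2) g < ⊤)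
    (hh : en A (-1 / 2) h < ⊤) (hy : en A (1 / 2) y < ⊤) :
    pair (g - h) y = pair g y - pair h y := by
  rw [pair, pair, pair, ← (summable_pair hg hy).tsum_sub (summable_pair hh hy)]
  simp

/-! ### The convection term in Fourier space -/

/-- The Fourier coefficients `∑_l i (ξ_k · u(l)) v(k - l)` of `div (u ⊗ v)`, which is `u · ∇ v` for
solenoidal `u`. -/
def conv (u v : Freq → C3) (k : Freq) : C3 :=
  ∑' l, (Complex.I * ∑ j, (wave k j : ℂ) * u l j) • v (k - l)

/-- The projected convection term `ℙ_σ (u · ∇ v)`. -/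
def bil (u v : Freq → C3) : Freq → C3 := helmholtz (conv u v)

theorem norm_sum_wave_mul_le (k : Freq) (x : C3) :
    ‖∑ j, (wave k j : ℂ) * x j‖ ≤ √(waveSq k) * ‖x‖ := by
  have h := norm_inner_le_norm (𝕜 := ℂ) (WithLp.toLp 2 fun j => (wave k j : ℂ) : C3) x
  have e1 : inner ℂ (WithLp.toLp 2 fun j => (wave k j : ℂ) : C3) x = ∑ j, (wave k j : ℂ) * x j := by
    simp [PiLp.inner_apply, mul_comm]
  have e2 : ‖(WithLp.toLp 2 fun j => (wave k j : ℂ) : C3)‖ = √(waveSq k) := by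
    simp [EuclideanSpace.norm_eq, waveSq]
  rwa [e1, e2] at h

theorem enorm_conv_term_le (k : Freq) (x y : C3) :
    ‖(Complex.I * ∑ j, (wave k j : ℂ) * x j) • y‖ₑ
      ≤ ENNReal.ofReal √(waveSq k) * (‖x‖ₑ * ‖y‖ₑ) := by
  rw [← ofReal_norm, ← ofReal_norm, ← ofReal_norm, ← ENNReal.ofReal_mul (norm_nonneg _),
    ← ENNReal.ofReal_mul (Real.sqrt_nonneg _)]
  refine ENNReal.ofReal_le_ofReal ?_
  rw [norm_smul, norm_mul, Complex.norm_I, one_mul, ← mul_assoc]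
  gcongr
  exact norm_sum_wave_mul_le k x

theorem enorm_conv_le (u v : Freq → C3) (k : Freq) :
    ‖conv u v k‖ₑ ≤ ENNReal.ofReal √(waveSq k) * ∑' l, ‖u l‖ₑ * ‖v (k - l)‖ₑ := by
  rw [← ENNReal.tsum_mul_left]
  exact enorm_tsum_le_tsum_enorm.trans (ENNReal.tsum_le_tsum fun l => enorm_conv_term_le _ _ _)

theorem sq_tsum_enorm_conv_le (A : HyperOp) (u v : Freq → C3) (k : Freq) :
    (∑' l, ‖u l‖ₑ * ‖v (k - l)‖ₑ) ^ 2 ≤ en A 0 u * en A 0 v := by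
  have h := sq_tsum_mul_le (fun _ : Freq => 1) (fun l => ‖u l‖ₑ) (fun l => ‖v (k - l)‖ₑ)
    (by simp) (by simp)
  simp only [one_mul, inv_one] at h
  rw [en_zero, en_zero, ← (Equiv.subLeft k).tsum_eq (fun l => ‖v l‖ₑ ^ 2)]
  exact h

theorem summable_conv {A : HyperOp} {u v : Freq → C3} (hu : en A 0 u < ⊤) (hv : en A 0 v < ⊤)
    (k : Freq) : Summable fun l => (Complex.I * ∑ j, (wave k j : ℂ) * u l j) • v (k - l) := by
  refine Summable.of_enorm (ne_top_of_le_ne_top ?_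
    (ENNReal.tsum_le_tsum fun l => enorm_conv_term_le k (u l) (v (k - l))))
  rw [ENNReal.tsum_mul_left]
  refine ENNReal.mul_ne_top ENNReal.ofReal_ne_top fun h => ?_
  have := sq_tsum_enorm_conv_le A u v k
  rw [h] at this
  simp only [ne_eq, OfNat.ofNat_ne_zero, not_false_eq_true, ENNReal.top_pow, top_le_iff] at this
  exact (ENNReal.mul_lt_top hu hv).ne this

theorem norm_helmholtz_le (c : Freq → C3) (k : Freq) : ‖helmholtz c k‖ ≤ 2 * ‖c k‖ := by
  set z : ℂ := (∑ j, (wave k j : ℂ) * c k j) / (waveSq k : ℂ)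
  have e : helmholtz c k = c k - z • (WithLp.toLp 2 fun j => (wave k j : ℂ) : C3) := by
    ext i
    simp [helmholtz, z]
    ring
  have h0 := waveSq_nonneg k
  have e2 : ‖(WithLp.toLp 2 fun j => (wave k j : ℂ) : C3)‖ = √(waveSq k) := by
    simp [EuclideanSpace.norm_eq, waveSq]
  have h : ‖z • (WithLp.toLp 2 fun j => (wave k j : ℂ) : C3)‖ ≤ ‖c k‖ := by
    rw [norm_smul, e2, norm_div, Complex.norm_real, Real.norm_of_nonneg h0, div_mul_eq_mul_div]
    refine div_le_of_le_mul₀ h0 (norm_nonneg _) ?_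
    calc _ ≤ √(waveSq k) * ‖c k‖ * √(waveSq k) := by gcongr; exact norm_sum_wave_mul_le k _
      _ = ‖c k‖ * (√(waveSq k) * √(waveSq k)) := by ring
      _ = _ := by rw [Real.mul_self_sqrt h0]
  rw [e]
  linarith [norm_sub_le (c k) (z • (WithLp.toLp 2 fun j => (wave k j : ℂ) : C3))]

theorem enorm_helmholtz_le (c : Freq → C3) (k : Freq) : ‖helmholtz c k‖ₑ ≤ 2 * ‖c k‖ₑ := by
  have h := ENNReal.ofReal_le_ofReal (norm_helmholtz_le c k)
  rwa [ENNReal.ofReal_mul (by norm_num), ofReal_norm, ofReal_norm, ENNReal.ofReal_ofNat] at h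

theorem enorm_bil_le (u v : Freq → C3) (k : Freq) :
    ‖bil u v k‖ₑ ≤ 2 * ENNReal.ofReal √(waveSq k) * ∑' l, ‖u l‖ₑ * ‖v (k - l)‖ₑ := by
  rw [mul_assoc]
  exact (enorm_helmholtz_le _ k).trans (by gcongr; exact enorm_conv_le u v k)

/-- A single coefficient of the convection term is controlled by the `L²` norm. -/
theorem enorm_bil_sq_le (A : HyperOp) (u v : Freq → C3) (k : Freq) :
    ‖bil u v k‖ₑ ^ 2 ≤ 4 * ENNReal.ofReal (waveSq k) * (en A 0 u * en A 0 v) := by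
  calc _ ≤ _ := pow_le_pow_left' (enorm_bil_le u v k) 2
    _ = 4 * ENNReal.ofReal (waveSq k) * (∑' l, ‖u l‖ₑ * ‖v (k - l)‖ₑ) ^ 2 := by
        rw [mul_pow, mul_pow, ← ENNReal.ofReal_pow (Real.sqrt_nonneg _),
          Real.sq_sqrt (waveSq_nonneg k)]
        norm_num
    _ ≤ _ := by gcongr; exact sq_tsum_enorm_conv_le A u v k

/-- The convection term is a bounded bilinear map from `D(A^{1/4})` to `D(A^{-1/2})`. -/
theorem HyperOp.exists_en_bil_le (A : HyperOp) : ∃ C : ℝ≥0∞, C ≠ ⊤ ∧ ∀ u v : Freq → C3,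
    en A (-1 / 2) (bil u v) ≤ C * (en A (1 / 4) u * en A (1 / 4) v) ∧
    ∑' k, ENNReal.ofReal (waveSq k / (1 + A.symbol k)) * (∑' l, ‖u l‖ₑ * ‖v (k - l)‖ₑ) ^ 2
      ≤ C * (en A (1 / 4) u * en A (1 / 4) v) := by
  obtain ⟨C, hC, h⟩ := A.exists_conv_bound
  refine ⟨4 * C, by finiteness, fun u v => ?_⟩
  have h1 := h (fun k => ‖u k‖ₑ) (fun k => ‖v k‖ₑ)
  rw [← en_quarter, ← en_quarter] at h1
  refine ⟨?_, h1.trans ?_⟩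
  · rw [mul_assoc]
    refine le_trans ?_ (mul_le_mul' le_rfl h1)
    rw [en_neg_half, ← ENNReal.tsum_mul_left]
    refine ENNReal.tsum_le_tsum fun k => ?_
    have hw := A.one_add_symbol_pos k
    calc _ ≤ (ENNReal.ofReal (1 + A.symbol k))⁻¹ *
          (2 * ENNReal.ofReal √(waveSq k) * ∑' l, ‖u l‖ₑ * ‖v (k - l)‖ₑ) ^ 2 := by
          gcongr
          exact enorm_bil_le u v k
      _ = _ := by
          rw [mul_pow, mul_pow, ← ENNReal.ofReal_pow (Real.sqrt_nonneg _),
            Real.sq_sqrt (waveSq_nonneg k), ENNReal.ofReal_div_of_pos hw, div_eq_mul_inv]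
          ring
  · gcongr
    exact le_mul_of_one_le_left' (by norm_num)

/-- The main estimate of the convection term. -/
theorem HyperOp.exists_en_bil_sq_le (A : HyperOp) : ∃ C : ℝ≥0∞, C ≠ ⊤ ∧ ∀ u v : Freq → C3,
    en A (-1 / 2) (bil u v) ^ 2
      ≤ C * (en A 0 u * en A (1 / 2) u * (en A 0 v * en A (1 / 2) v)) := by
  obtain ⟨C, hC, h⟩ := A.exists_en_bil_le
  refine ⟨C ^ 2, by finiteness, fun u v => ?_⟩
  calc _ ≤ _ := pow_le_pow_left' (h u v).1 2
    _ = C ^ 2 * (en A (1 / 4) u ^ 2 * en A (1 / 4) v ^ 2) := by ring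
    _ ≤ _ := by gcongr <;> exact en_quarter_sq_le A _

theorem en_bil_lt_top {A : HyperOp} {u v : Freq → C3} (hu : en A (1 / 2) u < ⊤)
    (hv : en A (1 / 2) v < ⊤) : en A (-1 / 2) (bil u v) < ⊤ := by
  obtain ⟨C, hC, h⟩ := A.exists_en_bil_sq_le
  have hu0 := (en_zero_le_half A u).trans_lt hu
  have hv0 := (en_zero_le_half A v).trans_lt hv
  have := (h u v).trans_lt (by finiteness)
  by_contra hcon
  rw [not_lt, top_le_iff] at hcon
  simp [hcon] at this

theorem helmholtz_conj {c : Freq → C3} (hc : ∀ k j, c (-k) j = starRingEnd ℂ (c k j)) (k : Freq)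
    (j : Fin 3) : helmholtz c (-k) j = starRingEnd ℂ (helmholtz c k j) := by
  simp [helmholtz, hc, wave_neg, waveSq_neg]

theorem waveSq_eq_zero {k : Freq} (h : waveSq k = 0) (j : Fin 3) : wave k j = 0 := by
  have := (Finset.sum_eq_zero_iff_of_nonneg fun j _ => sq_nonneg (wave k j)).1 h j (Finset.mem_univ j)
  simpa using this

theorem helmholtz_div (c : Freq → C3) (k : Freq) : ∑ j, (wave k j : ℂ) * helmholtz c k j = 0 := by
  by_cases h : waveSq k = 0
  · simp [waveSq_eq_zero h]
  · have h' : (waveSq k : ℂ) ≠ 0 := by exact_mod_cast h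
    have e : (waveSq k : ℂ) = ∑ j, (wave k j : ℂ) ^ 2 := by simp [waveSq]
    set S := ∑ j, (wave k j : ℂ) * c k j with hS
    have : ∀ j, (wave k j : ℂ) * helmholtz c k j
        = (wave k j : ℂ) * c k j - (wave k j : ℂ) ^ 2 * (S / waveSq k) := fun j => by
      simp only [helmholtz, ← hS]
      ring
    simp only [this]
    rw [Finset.sum_sub_distrib, ← Finset.sum_mul, ← e, mul_div_cancel₀ _ h', sub_self]

theorem conv_conj {u v : Freq → C3} (hu : IsReal3 u) (hv : IsReal3 v) (k : Freq) (j : Fin 3) :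
    conv u v (-k) j = starRingEnd ℂ (conv u v k j) := by
  let L : C3 ≃L[ℝ] C3 := (LinearIsometryEquiv.piLpCongrRight 2 fun _ : Fin 3 =>
    Complex.conjLIE).toContinuousLinearEquiv
  have hL : ∀ x i, L x i = starRingEnd ℂ (x i) := fun x i => rfl
  have h : conv u v (-k) = L (conv u v k) := by
    rw [conv, conv, L.map_tsum, ← (Equiv.neg Freq).tsum_eq]
    congr 1
    funext l
    ext i
    rw [hL]
    simp only [Equiv.neg_apply, PiLp.smul_apply, smul_eq_mul, map_mul, map_sum, hu.conj, wave_neg,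
      Complex.conj_I, Complex.conj_ofReal, Complex.ofReal_neg]
    rw [show -k - -l = -(k - l) by abel, hv.conj]
    simp
  rw [h, hL]

theorem isReal3_bil {u v : Freq → C3} (hu : IsReal3 u) (hv : IsReal3 v) : IsReal3 (bil u v) :=
  ⟨helmholtz_conj (conv_conj hu hv), helmholtz_div _⟩

theorem helmholtz_sub (c d : Freq → C3) : helmholtz (c - d) = helmholtz c - helmholtz d := by
  funext k
  ext i
  simp [helmholtz, mul_sub, sub_div]
  ring

theorem helmholtz_add (c d : Freq → C3) : helmholtz (c + d) = helmholtz c + helmholtz d := by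
  funext k
  ext i
  simp [helmholtz, mul_add, add_div, Finset.sum_add_distrib]
  ring

/-- The difference of two convection terms. -/
theorem bil_sub_bil {A : HyperOp} {u v : Freq → C3} (hu : en A 0 u < ⊤) (hv : en A 0 v < ⊤) :
    bil u u - bil v v = bil (u - v) u + bil v (u - v) := by
  have hd : en A 0 (u - v) < ⊤ := (en_sub_le A 0 u v).trans_lt (by finiteness)
  rw [bil, bil, bil, bil, ← helmholtz_sub, ← helmholtz_add]
  congr 1
  funext k
  simp only [Pi.sub_apply, Pi.add_apply]
  rw [conv, conv, conv, conv, ← (summable_conv hu hu k).tsum_sub (summable_conv hv hv k),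
    ← (summable_conv hd hu k).tsum_add (summable_conv hv hd k)]
  congr 1
  funext l
  simp only [Pi.sub_apply, PiLp.sub_apply, mul_sub, Finset.sum_sub_distrib, sub_smul, smul_sub]
  abel

theorem inner_helmholtz {c : Freq → C3} {k : Freq} {y : C3} (hy : ∑ j, (wave k j : ℂ) * y j = 0) :
    inner ℂ (helmholtz c k) y = inner ℂ (c k) y := by
  set S := ∑ j, (wave k j : ℂ) * c k j with hS
  have : ∀ i, inner ℂ (helmholtz c k i) (y i)
      = inner ℂ (c k i) (y i) - (starRingEnd ℂ S / waveSq k) * ((wave k i : ℂ) * y i) := fun i => by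
    simp only [helmholtz, ← hS, RCLike.inner_apply, map_sub, map_mul, map_div₀, Complex.conj_ofReal]
    ring
  rw [PiLp.inner_apply, PiLp.inner_apply]
  simp only [this]
  rw [Finset.sum_sub_distrib, ← Finset.mul_sum, hy, mul_zero, sub_zero]

/-- The convection term does no work. In the sum over the triads `k = l + m` the exchange of `(m, k)`
with `(-k, -m)` reverses the sign of every term. -/
theorem pair_bil_self {A : HyperOp} {u : Freq → C3} (hu : IsReal3 u) (hfin : en A (1 / 2) u < ⊤) :
    pair (bil u u) u = 0 := by
  have h0 := (en_zero_le_half A u).trans_lt hfin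
  set τ : Freq × Freq → ℝ := fun p => (inner ℂ
    ((Complex.I * ∑ j, (wave p.1 j : ℂ) * u p.2 j) • u (p.1 - p.2)) (u p.1)).re with hτ
  have hanti : ∀ k l, τ (l - k, l) = -τ (k, l) := by
    intro k l
    simp only [hτ]
    have e1 : ∑ j, (wave (l - k) j : ℂ) * u l j = -∑ j, (wave k j : ℂ) * u l j := by
      have := hu.div l
      simp only [wave_sub, Complex.ofReal_sub, sub_mul, Finset.sum_sub_distrib, this, zero_sub]
    have e2 : inner ℂ (u (-k)) (u (l - k)) = inner ℂ (u (k - l)) (u k) := by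
      rw [show l - k = -(k - l) by abel, PiLp.inner_apply, PiLp.inner_apply]
      refine Finset.sum_congr rfl fun i _ => ?_
      simp only [RCLike.inner_apply, hu.conj, Complex.conj_conj]
      ring
    rw [show l - k - l = -k by abel, inner_smul_left, inner_smul_left, e1, e2]
    simp
  have hsum : Summable τ := by
    refine Summable.of_enorm ?_
    rw [ENNReal.tsum_prod (f := fun k l => ‖τ (k, l)‖ₑ)]
    have hk : ∀ k, ∑' l, ‖τ (k, l)‖ₑ
        ≤ (ENNReal.ofReal √(waveSq k) * ∑' l, ‖u l‖ₑ * ‖u (k - l)‖ₑ) * ‖u k‖ₑ := by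
      intro k
      rw [← ENNReal.tsum_mul_left, ← ENNReal.tsum_mul_right]
      refine ENNReal.tsum_le_tsum fun l => (enorm_re_inner_le _ _).trans ?_
      gcongr
      exact enorm_conv_term_le _ _ _
    refine ne_top_of_le_ne_top ?_ (ENNReal.tsum_le_tsum hk)
    intro htop
    obtain ⟨C, hC, hb⟩ := A.exists_en_bil_le
    have h1 := sq_tsum_mul_le (fun k => (ENNReal.ofReal (1 + A.symbol k))⁻¹)
      (fun k => ENNReal.ofReal √(waveSq k) * ∑' l, ‖u l‖ₑ * ‖u (k - l)‖ₑ) (fun k => ‖u k‖ₑ)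
      (by simp) (fun k => by simpa using A.one_add_symbol_pos k)
    rw [htop] at h1
    simp only [inv_inv, ← en_half] at h1
    have h2 : ∑' k, (ENNReal.ofReal (1 + A.symbol k))⁻¹ *
        (ENNReal.ofReal √(waveSq k) * ∑' l, ‖u l‖ₑ * ‖u (k - l)‖ₑ) ^ 2 < ⊤ := by
      have h3 : en A (1 / 4) u < ⊤ := by
        by_contra hcon
        rw [not_lt, top_le_iff] at hcon
        have := en_quarter_sq_le A u
        rw [hcon] at this
        simp only [ne_eq, OfNat.ofNat_ne_zero, not_false_eq_true, ENNReal.top_pow, top_le_iff] at this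
        exact (ENNReal.mul_lt_top h0 hfin).ne this
      refine lt_of_le_of_lt (le_of_eq ?_) ((hb u u).2.trans_lt (by finiteness))
      congr 1
      funext k
      rw [mul_pow, ← ENNReal.ofReal_pow (Real.sqrt_nonneg _), Real.sq_sqrt (waveSq_nonneg k),
        ENNReal.ofReal_div_of_pos (A.one_add_symbol_pos k), div_eq_mul_inv]
      ring
    simp only [ne_eq, OfNat.ofNat_ne_zero, not_false_eq_true, ENNReal.top_pow, top_le_iff] at h1
    exact (ENNReal.mul_lt_top h2 hfin).ne h1
  have hpair : pair (bil u u) u = ∑' p, τ p := by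
    rw [hsum.tsum_prod, pair]
    congr 1
    funext k
    have h1 : HasSum (fun l => inner ℂ ((Complex.I * ∑ j, (wave k j : ℂ) * u l j) • u (k - l)) (u k))
        (inner ℂ (conv u u k) (u k)) := by
      have h2 := (summable_conv h0 h0 k).hasSum.mapL (innerSL ℂ (u k))
      have h3 := h2.star
      simp only [innerSL_apply_apply, ← starRingEnd_apply, inner_conj_symm] at h3
      exact h3
    rw [bil, inner_helmholtz (hu.div k)]
    exact ((Complex.hasSum_re h1).tsum_eq).symm
  have hinv : ∑' p, τ p = -∑' p, τ p := by
    let e : Freq × Freq ≃ Freq × Freq :=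
      { toFun := fun p => (p.2 - p.1, p.2)
        invFun := fun p => (p.2 - p.1, p.2)
        left_inv := fun p => by simp
        right_inv := fun p => by simp }
    conv_lhs => rw [← e.tsum_eq τ]
    rw [← tsum_neg]
    congr 1
    funext p
    exact hanti p.1 p.2
  rw [hpair]
  linarith

/-- The convection term of the equation, in terms of Fourier coefficients. -/
theorem helmholtz_fourier_convection {u : L2} (hu : u ∈ L2sigma) {G : Fin 3 → L2}
    (hG : ∀ j k, fourier (G j) k = (Complex.I * wave k j) • fourier u k) :
    helmholtz (fourier (convection u G)) = bil (fourier u) (fourier u) := by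
  rw [bil]
  congr 1
  funext k
  rw [← (hasSum_fourier_convection u G k).tsum_eq, conv]
  congr 1
  funext l
  simp only [hG, smul_smul]
  rw [← Finset.sum_smul]
  congr 1
  have := sum_wave_mul_fourier hu l
  rw [Finset.mul_sum]
  have e : ∀ j, fourier u l j * (Complex.I * (wave (k - l) j : ℂ))
      = Complex.I * ((wave k j : ℂ) * fourier u l j) - Complex.I * ((wave l j : ℂ) * fourier u l j) :=
    fun j => by
      rw [wave_sub]
      push_cast
      ring
  simp only [e]
  rw [Finset.sum_sub_distrib, ← Finset.mul_sum (f := fun j => (wave l j : ℂ) * fourier u l j), this,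
    mul_zero, sub_zero]

theorem isReal3_fourier {u : L2} (hu : u ∈ L2sigma) : IsReal3 (fourier u) :=
  ⟨fourier_neg_freq u, sum_wave_mul_fourier hu⟩

theorem en_zero_fourier (A : HyperOp) (u : L2) : 2 * en A 0 (fourier u) = ‖u‖ₑ ^ 2 := by
  have h := hasSum_fourier_sq u
  rw [← ofReal_sq_norm, ← h.tsum_eq, ENNReal.ofReal_tsum_of_nonneg (fun _ => by positivity)
    h.summable, en_zero, ← ENNReal.tsum_mul_left]
  congr 1
  funext k
  rw [ENNReal.ofReal_mul (by norm_num), ofReal_sq_norm]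
  simp

theorem waveSq_le_symbol (A : HyperOp) : ∃ C : ℝ, 0 ≤ C ∧ ∀ k, waveSq k ≤ C * (1 + A.symbol k) := by
  obtain ⟨θ, C, hθ, -, hC, -, h⟩ := A.exists_count
  refine ⟨C, by linarith, fun k => ?_⟩
  have h1 := h k
  rw [div_le_iff₀ (A.one_add_symbol_pos k)] at h1
  refine h1.trans ?_
  have h2 : A.sig k ^ (-θ) ≤ 1 := Real.rpow_le_one_of_one_le_of_nonpos (A.one_le_sig k) (by linarith)
  have := A.one_add_symbol_pos k
  gcongr
  nlinarith

/-- Fields in `D(A^{1/2})` have weak gradients in `L²`. -/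
theorem exists_isWeakGradient {A : HyperOp} {u : L2} (hfin : en A (1 / 2) (fourier u) < ⊤) :
    ∃ G : Fin 3 → L2, IsWeakGradient u G := by
  obtain ⟨C, hC, h⟩ := waveSq_le_symbol A
  have hG : ∀ j, ∃ w : L2, fourier w = fun k => (Complex.I * wave k j) • fourier u k := by
    intro j
    refine exists_fourier_eq (fun k i => ?_) ?_
    · simp [fourier_neg_freq, wave_neg]
    · have h1 := (summable_of_en hfin).mul_left C
      refine h1.of_nonneg_of_le (fun _ => by positivity) fun k => ?_
      rw [norm_smul, mul_pow, norm_mul, Complex.norm_I, one_mul, Complex.norm_real, Real.norm_eq_abs,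
        sq_abs, ← mul_assoc]
      gcongr
      refine ((sq_le_waveSq k j).trans (h k)).trans (le_of_eq ?_)
      norm_num
  choose G hG using hG
  exact ⟨G, (isWeakGradient_iff u G).2 fun j k => by rw [hG j]⟩

/-! ### Primitives of integrable functions -/

theorem integrableOn_timeMeasure_iff {X : Type*} [NormedAddCommGroup X] {T : ℝ} (hT : 0 ≤ T)
    {g : ℝ → X} : Integrable g (timeMeasure T) ↔ IntervalIntegrable g volume 0 T := by
  rw [intervalIntegrable_iff_integrableOn_Ioo_of_le hT]
  rfl

theorem intervalIntegrable_of_mem {X : Type*} [NormedAddCommGroup X] {T t : ℝ} {g : ℝ → X}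
    (hg : IntervalIntegrable g volume 0 T) (ht : t ∈ Icc 0 T) : IntervalIntegrable g volume 0 t :=
  hg.mono_set (uIcc_subset_uIcc_left (by rwa [uIcc_of_le (ht.1.trans ht.2)]))

theorem continuousOn_primitive {X : Type*} [NormedAddCommGroup X] [NormedSpace ℝ X] {T : ℝ}
    (hT : 0 ≤ T) {g : ℝ → X} (hg : IntervalIntegrable g volume 0 T) :
    ContinuousOn (fun t => ∫ s in 0..t, g s) (Icc 0 T) := by
  have := intervalIntegral.continuousOn_primitive_interval (f := g) (a := 0) (b := T) (μ := volume)
  rw [uIcc_of_le hT] at this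
  exact this ((intervalIntegrable_iff_integrableOn_Icc_of_le hT).1 hg)

theorem absolutelyContinuousOnInterval_const_add {t : ℝ} {p : ℝ → ℝ} (a : ℝ)
    (hp : IntervalIntegrable p volume 0 t) :
    AbsolutelyContinuousOnInterval (fun s => a + ∫ r in 0..s, p r) 0 t :=
  AbsolutelyContinuousOnInterval.add (contDiffOn_const.absolutelyContinuousOnInterval)
    (hp.absolutelyContinuousOnInterval_intervalIntegral left_mem_uIcc)

theorem ae_deriv_const_add {t : ℝ} {p : ℝ → ℝ} (a : ℝ) (hp : IntervalIntegrable p volume 0 t) :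
    ∀ᵐ s, s ∈ uIoc 0 t → deriv (fun s => a + ∫ r in 0..s, p r) s = p s := by
  filter_upwards [hp.ae_hasDerivAt_integral] with s hs hs2
  exact ((hs (uIoc_subset_uIcc hs2) 0 left_mem_uIcc).const_add a).deriv

theorem sq_const_add_primitive {t : ℝ} {p : ℝ → ℝ} (a : ℝ) (hp : IntervalIntegrable p volume 0 t) :
    (a + ∫ r in 0..t, p r) ^ 2 = a ^ 2 + 2 * ∫ s in 0..t, p s * (a + ∫ r in 0..s, p r) := by
  have h1 := absolutelyContinuousOnInterval_const_add a hp
  have h2 := h1.integral_deriv_mul_eq_sub h1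
  have h3 : ∫ s in 0..t, deriv (fun s => a + ∫ r in 0..s, p r) s * (a + ∫ r in 0..s, p r)
      + (a + ∫ r in 0..s, p r) * deriv (fun s => a + ∫ r in 0..s, p r) s
      = ∫ s in 0..t, 2 * (p s * (a + ∫ r in 0..s, p r)) := by
    refine intervalIntegral.integral_congr_ae ?_
    filter_upwards [ae_deriv_const_add a hp] with s hs hs2
    rw [hs hs2]
    ring
  rw [h3, intervalIntegral.integral_const_mul, intervalIntegral.integral_same] at h2
  linear_combination -h2

/-- Integration by parts against a test function on `(0,T)`. -/
theorem integral_deriv_smul_primitive {X : Type*} [NormedAddCommGroup X] [NormedSpace ℝ X]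
    [CompleteSpace X] {T : ℝ} (hT : 0 < T) {g : ℝ → X} (hg : IntervalIntegrable g volume 0 T) (c : X)
    {φ : ℝ → ℝ} (hφ : ContDiff ℝ ∞ φ) (hsupp : tsupport φ ⊆ Ioo 0 T) :
    ∫ t in 0..T, deriv φ t • (c + ∫ s in 0..t, g s) = -∫ t in 0..T, φ t • g t := by
  have hd : Continuous (deriv φ) := hφ.continuous_deriv (by simp)
  have hcont := continuousOn_primitive hT.le hg
  have hi1 : IntervalIntegrable (fun t => deriv φ t • (c + ∫ s in 0..t, g s)) volume 0 T := by
    refine ContinuousOn.intervalIntegrable ?_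
    rw [uIcc_of_le hT.le]
    exact hd.continuousOn.smul (continuousOn_const.add hcont)
  have hi2 : IntervalIntegrable (fun t => φ t • g t) volume 0 T :=
    hg.continuousOn_smul hφ.continuous.continuousOn
  rw [SeparatingDual.eq_iff_forall_dual_eq (R := ℝ)]
  intro L
  rw [map_neg, ← L.intervalIntegral_comp_comm hi1, ← L.intervalIntegral_comp_comm hi2]
  have hLg : IntervalIntegrable (fun s => L (g s)) volume 0 T :=
    ⟨L.integrable_comp hg.1, L.integrable_comp hg.2⟩
  have e : ∫ t in 0..T, L (deriv φ t • (c + ∫ s in 0..t, g s))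
      = ∫ t in 0..T, deriv φ t * (L c + ∫ s in 0..t, L (g s)) := by
    refine intervalIntegral.integral_congr fun t ht => ?_
    rw [uIcc_of_le hT.le] at ht
    rw [map_smul, map_add, ← L.intervalIntegral_comp_comm (intervalIntegrable_of_mem hg ht), smul_eq_mul]
  rw [e]
  have h1 := absolutelyContinuousOnInterval_const_add (L c) hLg
  have h2 : AbsolutelyContinuousOnInterval φ 0 T :=
    (hφ.of_le (by simp)).contDiffOn.absolutelyContinuousOnInterval
  have h3 := h2.integral_mul_deriv_eq_deriv_mul h1
  have hz : ∀ t, t ∉ Ioo 0 T → φ t = 0 := fun t ht => image_eq_zero_of_notMem_tsupport fun h => ht (hsupp h)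
  rw [hz 0 (by simp), hz T (by simp), zero_mul, zero_mul, sub_zero, zero_sub] at h3
  rw [← neg_eq_iff_eq_neg, ← h3]
  refine intervalIntegral.integral_congr_ae ?_
  filter_upwards [ae_deriv_const_add (L c) hLg] with s hs hs2
  rw [hs hs2, map_smul, smul_eq_mul]

theorem exists_bump {T : ℝ} (hT : 0 < T) : ∃ η : ℝ → ℝ, ContDiff ℝ ∞ η ∧ HasCompactSupport η ∧
    tsupport η ⊆ Ioo 0 T ∧ ∫ t, η t = 1 := by
  let b : ContDiffBump (T / 2) := ⟨T / 8, T / 4, by positivity, by linarith⟩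
  refine ⟨b.normed volume, b.contDiff_normed, b.hasCompactSupport_normed, ?_, b.integral_normed⟩
  rw [b.tsupport_normed_eq, Real.closedBall_eq_Icc]
  have hb : b.rOut = T / 4 := rfl
  exact fun t ht => ⟨by linarith [ht.1], by linarith [ht.2]⟩

/-- A test function with integral zero is the derivative of a test function. -/
theorem exists_primitive_test {T : ℝ} (hT : 0 < T) {χ : ℝ → ℝ} (hχ : ContDiff ℝ ∞ χ)
    (hc : HasCompactSupport χ) (hs : tsupport χ ⊆ Ioo 0 T) (h0 : ∫ t, χ t = 0) :
    ∃ φ : ℝ → ℝ, ContDiff ℝ ∞ φ ∧ HasCompactSupport φ ∧ tsupport φ ⊆ Ioo 0 T ∧ deriv φ = χ := by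
  obtain ⟨a, b, ha, hb, hab⟩ : ∃ a b, 0 < a ∧ b < T ∧ ∀ t, χ t ≠ 0 → t ∈ Icc a b := by
    rcases (tsupport χ).eq_empty_or_nonempty with he | hne
    · refine ⟨T / 2, T / 2, by linarith, by linarith, fun t ht => ?_⟩
      have := subset_tsupport χ ht
      rw [he] at this
      exact absurd this (by simp)
    · obtain ⟨a, ha⟩ := IsCompact.exists_isLeast hc hne
      obtain ⟨b, hb⟩ := IsCompact.exists_isGreatest hc hne
      exact ⟨a, b, (hs ha.1).1, (hs hb.1).2, fun t ht =>
        ⟨ha.2 (subset_tsupport χ ht), hb.2 (subset_tsupport χ ht)⟩⟩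
  set φ : ℝ → ℝ := fun t => ∫ s in 0..t, χ s
  have hd : ∀ t, HasDerivAt φ (χ t) t := fun t =>
    intervalIntegral.integral_hasDerivAt_right (hχ.continuous.intervalIntegrable _ _)
      (hχ.continuous.stronglyMeasurableAtFilter _ _) hχ.continuous.continuousAt
  have hderiv : deriv φ = χ := funext fun t => (hd t).deriv
  have hz1 : ∀ t, t < a → φ t = 0 := by
    intro t ht
    refine (intervalIntegral.integral_congr (g := fun _ => 0) fun s hs => ?_).trans (by simp)
    by_contra hcon
    have h1 := (hab s hcon).1
    rcases le_total 0 t with h | h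
    · rw [uIcc_of_le h] at hs
      linarith [hs.2]
    · rw [uIcc_of_ge h] at hs
      linarith [hs.2]
  have hz2 : ∀ t, b < t → φ t = 0 := by
    intro t ht
    have hsub : Function.support χ ⊆ Ioc (min 0 (a - 1)) t := fun s hs => by
      have := hab s hs
      exact ⟨by linarith [this.1, min_le_right 0 (a - 1)], by linarith [this.2]⟩
    have h1 : ∫ s in (min 0 (a - 1))..t, χ s = 0 := by
      rw [intervalIntegral.integral_eq_integral_of_support_subset hsub, h0]
    have h2 : ∫ s in (0)..(min 0 (a - 1)), χ s = 0 := by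
      by_cases h : (min 0 (a - 1)) = 0
      · rw [h]; simp
      · exact hz1 _ (by linarith [min_le_right 0 (a - 1)])
    calc φ t = (∫ s in (0)..(min 0 (a - 1)), χ s) + ∫ s in (min 0 (a - 1))..t, χ s :=
          (intervalIntegral.integral_add_adjacent_intervals (hχ.continuous.intervalIntegrable _ _)
            (hχ.continuous.intervalIntegrable _ _)).symm
      _ = 0 := by rw [h1, h2, add_zero]
  have hsupp : tsupport φ ⊆ Icc a b := by
    refine closure_minimal (fun t ht => ?_) isClosed_Icc
    by_contra hcon
    rw [mem_Icc, not_and_or, not_le, not_le] at hcon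
    exact ht (hcon.elim (hz1 t) (hz2 t))
  refine ⟨φ, contDiff_infty_iff_deriv.2 ⟨fun t => (hd t).differentiableAt, hderiv ▸ hχ⟩, ?_,
    fun t ht => ?_, hderiv⟩
  · exact HasCompactSupport.of_support_subset_isCompact isCompact_Icc
      ((subset_tsupport φ).trans hsupp)
  · exact ⟨ha.trans_le (hsupp ht).1, (hsupp ht).2.trans_lt hb⟩

theorem integrable_test_smul {X : Type*} [NormedAddCommGroup X] [NormedSpace ℝ X] {μ : Measure ℝ}
    {W : ℝ → X} (hW : Integrable W μ) {χ : ℝ → ℝ} (hχ : Continuous χ) (hc : HasCompactSupport χ) :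
    Integrable (fun t => χ t • W t) μ := by
  obtain ⟨C, hC⟩ := hc.exists_bound_of_continuous hχ
  exact hW.bdd_smul C hχ.aestronglyMeasurable (ae_of_all _ hC)

/-- The lemma of du Bois-Reymond: a function with an integrable weak derivative is a primitive. -/
theorem ae_eq_const_add_primitive {X : Type*} [NormedAddCommGroup X] [NormedSpace ℝ X]
    [CompleteSpace X] {T : ℝ} (hT : 0 < T) {U g : ℝ → X} (hU : Integrable U (timeMeasure T))
    (hg : Integrable g (timeMeasure T)) (h : IsWeakTimeDeriv T U g) :
    ∃ c : X, ∀ᵐ t ∂timeMeasure T, U t = c + ∫ s in 0..t, g s := by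
  obtain ⟨η, hη, hηc, hηs, hη1⟩ := exists_bump hT
  have hg' := (integrableOn_timeMeasure_iff hT.le).1 hg
  set V : ℝ → X := fun t => U t - ∫ s in 0..t, g s
  have hP : Integrable (fun t => ∫ s in 0..t, g s) (timeMeasure T) :=
    ((continuousOn_primitive hT.le hg').integrableOn_compact isCompact_Icc).mono_set Ioo_subset_Icc_self
  have hV : Integrable V (timeMeasure T) := hU.sub hP
  have hVz : ∀ φ : ℝ → ℝ, ContDiff ℝ ∞ φ → HasCompactSupport φ → tsupport φ ⊆ Ioo 0 T →
      ∫ t in Ioo 0 T, deriv φ t • V t = 0 := by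
    intro φ h1 h2 h3
    have h4 := h φ h1 h2 h3
    have h5 := integral_deriv_smul_primitive hT hg' 0 h1 h3
    simp only [zero_add] at h5
    rw [intervalIntegral.integral_of_le hT.le, intervalIntegral.integral_of_le hT.le,
      integral_Ioc_eq_integral_Ioo, integral_Ioc_eq_integral_Ioo, ← h4] at h5
    have hdc : Continuous (deriv φ) := h1.continuous_deriv (by simp)
    simp only [V, smul_sub]
    rw [integral_sub (integrable_test_smul hU hdc h2.deriv) (integrable_test_smul hP hdc h2.deriv), h5, sub_self]
  refine ⟨∫ t in Ioo 0 T, η t • V t, ?_⟩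
  set c := ∫ t in Ioo 0 T, η t • V t with hc
  have hloc : LocallyIntegrableOn (fun t => V t - c) (Ioo 0 T) :=
    IntegrableOn.locallyIntegrableOn (hV.sub (integrable_const c))
  have key := isOpen_Ioo.ae_eq_zero_of_integral_contDiff_smul_eq_zero hloc fun ψ hψ hψc hψs => by
    set m := ∫ t, ψ t
    have hi1 : Integrable ψ := hψ.continuous.integrable_of_hasCompactSupport hψc
    have hi2 : Integrable η := hη.continuous.integrable_of_hasCompactSupport hηc
    obtain ⟨φ, h1, h2, h3, h4⟩ := exists_primitive_test (χ := fun t => ψ t - m * η t) hT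
      (hψ.sub (contDiff_const.mul hη)) (hψc.sub (hηc.mul_left))
      ((tsupport_sub ψ (fun t => m * η t)).trans (union_subset hψs ((tsupport_mul_subset_right).trans hηs)))
      (by
        rw [integral_sub hi1 (hi2.const_mul m), integral_const_mul, hη1]
        simp [m])
    have h5 := hVz φ h1 h2 h3
    rw [h4] at h5
    simp only [sub_smul, mul_smul] at h5
    rw [integral_sub (f := fun t => ψ t • V t) (g := fun t => m • η t • V t)
      (integrable_test_smul hV hψ.continuous hψc) ((integrable_test_smul hV hη.continuous hηc).smul m), integral_smul, ← hc] at h5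
    have h6 : ∫ t, ψ t • (V t - c) = ∫ t in Ioo 0 T, ψ t • (V t - c) := by
      refine (setIntegral_eq_integral_of_forall_compl_eq_zero fun t ht => ?_).symm
      rw [image_eq_zero_of_notMem_tsupport fun h => ht (hψs h), zero_smul]
    have h7 : ∫ t in Ioo 0 T, ψ t = m :=
      setIntegral_eq_integral_of_forall_compl_eq_zero fun t ht =>
        image_eq_zero_of_notMem_tsupport fun h => ht (hψs h)
    rw [h6]
    simp only [smul_sub]
    rw [integral_sub (integrable_test_smul hV hψ.continuous hψc) (hi1.restrict.smul_const c), integral_smul_const,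
      h7, h5]
  rw [ae_restrict_iff' measurableSet_Ioo]
  filter_upwards [key] with t ht htm
  have := ht htm
  simp only [V] at this
  rw [sub_sub, sub_eq_zero] at this
  rw [this, add_comm]

/-! ### Gronwall inequalities -/

theorem le_mul_exp_of_le_add_integral {T K : ℝ} (hT : 0 < T) {y : ℝ → ℝ}
    (hy : ContinuousOn y (Icc 0 T)) (h0 : ∀ t ∈ Icc 0 T, 0 ≤ y t) (hK : 0 ≤ K)
    (h : ∀ t ∈ Icc 0 T, y t ≤ K + ∫ s in 0..t, y s) : ∀ t ∈ Icc 0 T, y t ≤ K * Real.exp t := by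
  intro t ht
  refine (h t ht).trans ?_
  have hyi : IntervalIntegrable y volume 0 T := by
    refine ContinuousOn.intervalIntegrable ?_
    rwa [uIcc_of_le hT.le]
  have hpos : ∀ t ∈ Icc 0 T, 0 ≤ K + ∫ s in 0..t, y s := fun t ht => (h0 t ht).trans (h t ht)
  have key := norm_le_gronwallBound_of_norm_deriv_right_le
    (f := fun t => K + ∫ s in 0..t, y s) (f' := y) (δ := K) (K := 1) (ε := 0) (a := 0) (b := T)
    (continuousOn_const.add (continuousOn_primitive hT.le hyi)) (fun s hs => by
      have hsI : s ∈ Icc 0 T := Ico_subset_Icc_self hs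
      refine HasDerivWithinAt.const_add _ ?_
      have hc : ContinuousWithinAt y (Ioi s) s := by
        refine (hy s hsI).mono_of_mem_nhdsWithin ?_
        filter_upwards [Ioc_mem_nhdsGT hs.2] with r hr
        exact ⟨hsI.1.trans hr.1.le, hr.2⟩
      refine intervalIntegral.integral_hasDerivWithinAt_right (intervalIntegrable_of_mem hyi hsI) (t := Ioi s) ?_ hc
      refine ⟨Ioc s T, Ioc_mem_nhdsGT hs.2, ?_⟩
      exact (hy.mono fun r hr => ⟨hsI.1.trans hr.1.le, hr.2⟩).aestronglyMeasurable measurableSet_Ioc)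
    (by simp [abs_of_nonneg hK]) (fun s hs => by
      have hsI : s ∈ Icc 0 T := Ico_subset_Icc_self hs
      rw [Real.norm_of_nonneg (h0 s hsI), Real.norm_of_nonneg (hpos s hsI), one_mul, add_zero]
      exact h s hsI) t ht
  rw [Real.norm_of_nonneg (hpos t ht), gronwallBound_ε0, one_mul, sub_zero] at key
  exact key

/-- A Gronwall inequality with an integrable coefficient: the time interval is divided into pieces on
which the coefficient has integral less than `1/2`. -/
theorem eq_zero_of_le_integral_mul {T : ℝ} (hT : 0 < T) {y m : ℝ → ℝ}
    (hy : ContinuousOn y (Icc 0 T)) (h0 : ∀ t ∈ Icc 0 T, 0 ≤ y t) (hm0 : ∀ t, 0 ≤ m t)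
    (hm : IntervalIntegrable m volume 0 T)
    (h : ∀ t ∈ Icc 0 T, y t ≤ ∫ s in 0..t, m s * y s) : ∀ t ∈ Icc 0 T, y t = 0 := by
  have hF := continuousOn_primitive hT.le hm
  obtain ⟨δ, hδ, hunif⟩ := Metric.uniformContinuousOn_iff.1
    (isCompact_Icc.uniformContinuousOn_of_continuous hF) (1 / 2) (by norm_num)
  have hmy : IntervalIntegrable (fun s => m s * y s) volume 0 T :=
    hm.mul_continuousOn (by rwa [uIcc_of_le hT.le])
  have main : ∀ n : ℕ, ∀ t ∈ Icc 0 T, t ≤ n * (δ / 2) → y t = 0 := by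
    intro n
    induction n with
    | zero =>
      intro t ht h1
      have : t = 0 := le_antisymm (by simpa using h1) ht.1
      have h2 := h t ht
      subst this
      rw [intervalIntegral.integral_same] at h2
      exact le_antisymm h2 (h0 0 ht)
    | succ n ih =>
      intro t ht htn
      set τ := min ((n : ℝ) * (δ / 2)) T with hτ
      have hτ0 : 0 ≤ τ := le_min (by positivity) hT.le
      have hτm : τ ∈ Icc 0 T := ⟨hτ0, min_le_right _ _⟩
      obtain ⟨t1, ht1, hmax⟩ := (isCompact_Icc (a := 0) (b := t)).exists_isMaxOn
        (nonempty_Icc.2 ht.1) (hy.mono (Icc_subset_Icc_right ht.2))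
      have ht1T : t1 ∈ Icc 0 T := ⟨ht1.1, ht1.2.trans ht.2⟩
      have hzero : ∀ s ∈ Icc 0 τ, y s = 0 := fun s hs =>
        ih s ⟨hs.1, hs.2.trans hτm.2⟩ (hs.2.trans (min_le_left _ _))
      have hyt1 : y t1 = 0 := by
        rcases le_total t1 τ with hle | hle
        · exact hzero t1 ⟨ht1.1, hle⟩
        · have h1 : ∫ s in 0..t1, m s * y s = ∫ s in τ..t1, m s * y s := by
            rw [← intervalIntegral.integral_add_adjacent_intervals (intervalIntegrable_of_mem hmy hτm)
              ((intervalIntegrable_of_mem hmy hτm).symm.trans (intervalIntegrable_of_mem hmy ht1T))]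
            have : ∫ s in 0..τ, m s * y s = 0 := by
              refine (intervalIntegral.integral_congr (g := fun _ => 0) fun s hs => ?_).trans (by simp)
              rw [uIcc_of_le hτ0] at hs
              simp [hzero s hs]
            rw [this, zero_add]
          have h2 : ∫ s in τ..t1, m s * y s ≤ ∫ s in τ..t1, m s * y t1 := by
            refine intervalIntegral.integral_mono_on hle
              ((intervalIntegrable_of_mem hmy hτm).symm.trans (intervalIntegrable_of_mem hmy ht1T))
              (((intervalIntegrable_of_mem hm hτm).symm.trans (intervalIntegrable_of_mem hm ht1T)).mul_const _) fun s hs => ?_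
            exact mul_le_mul_of_nonneg_left (hmax ⟨hτ0.trans hs.1, hs.2.trans ht1.2⟩) (hm0 s)
          have h3 : ∫ s in τ..t1, m s ≤ 1 / 2 := by
            have hd : dist t1 τ < δ := by
              rw [Real.dist_eq, abs_of_nonneg (by linarith)]
              have : t1 ≤ ((n : ℝ) + 1) * (δ / 2) := by
                have := ht1.2.trans htn
                push_cast at this
                exact this
              rcases min_choice ((n : ℝ) * (δ / 2)) T with hc | hc
              · rw [hτ, hc]; linarith
              · have : t1 = τ := le_antisymm (by rw [hτ, hc]; exact ht1T.2) hle
                linarith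
            have := hunif t1 ht1T τ hτm hd
            rw [Real.dist_eq] at this
            rw [← intervalIntegral.integral_interval_sub_left (intervalIntegrable_of_mem hm ht1T) (intervalIntegrable_of_mem hm hτm)]
            exact (le_abs_self _).trans this.le
          have h4 := h t1 ht1T
          rw [h1] at h4
          rw [intervalIntegral.integral_mul_const] at h2
          nlinarith [h0 t1 ht1T]
      exact le_antisymm (hyt1 ▸ hmax ⟨ht.1, le_rfl⟩) (h0 t ht)
  intro t ht
  obtain ⟨n, hn⟩ := exists_nat_ge (t / (δ / 2))
  exact main n t ht ((div_le_iff₀ (by positivity)).1 hn)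

/-! ### Square integrable functions of time with values in `D(A^s)` -/

theorem Dom.norm_coef_le {A : HyperOp} {s : ℝ} (k : Freq) (c : Dom A s) :
    ‖c.coef k‖ ≤ (1 + A.symbol k) ^ (-s) * ‖c‖ := by
  have hw := A.weight_pos s k
  have h : ‖(1 + A.symbol k) ^ s • c.coef k‖ ≤ ‖c‖ :=
    lp.norm_apply_le_norm (by simp) (Dom.toSeq A s c) k
  rw [norm_smul, Real.norm_of_nonneg hw.le] at h
  rw [Real.rpow_neg (A.one_add_symbol_pos k).le, inv_mul_eq_div, le_div_iff₀ hw, mul_comm]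
  exact h

/-- The coefficient of the mode `k` as a continuous linear map. -/
def Dom.coefCLM (A : HyperOp) (s : ℝ) (k : Freq) : Dom A s →L[ℝ] C3 :=
  LinearMap.mkContinuous
    { toFun := fun c => c.coef k
      map_add' := fun _ _ => rfl
      map_smul' := fun _ _ => rfl } _ (Dom.norm_coef_le k)

theorem Dom.coefCLM_apply {A : HyperOp} {s : ℝ} (k : Freq) (c : Dom A s) :
    Dom.coefCLM A s k c = c.coef k := rfl

theorem Dom.aestronglyMeasurable_of_coef {A : HyperOp} {s : ℝ} {μ : Measure ℝ} {U : ℝ → Dom A s}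
    (h : ∀ k, AEStronglyMeasurable (fun t => (U t).coef k) μ) : AEStronglyMeasurable U μ := by
  classical
  have hiso : Isometry (Dom.toSeq A s) := AddMonoidHomClass.isometry_of_norm _ fun _ => rfl
  rw [← hiso.isEmbedding.aestronglyMeasurable_comp_iff]
  refine aestronglyMeasurable_of_tendsto_ae (Filter.atTop : Filter (Finset Freq))
    (f := fun S t => ∑ k ∈ S, lp.single 2 k (Dom.toSeq A s (U t) k)) (fun S => ?_)
    (ae_of_all _ fun t => lp.hasSum_single (by simp) (Dom.toSeq A s (U t)))
  refine Finset.aestronglyMeasurable_fun_sum _ fun k _ => ?_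
  have hc : Continuous fun x : C3 => (lp.single 2 k x : lp (fun _ : Freq => C3) 2) :=
    (lp.singleContinuousAddMonoidHom (fun _ : Freq => C3) 2 k).continuous
  exact hc.comp_aestronglyMeasurable ((h k).const_smul ((1 + A.symbol k) ^ s))

/-- A family of coefficients that depends on time belongs to `L²(0,T; D(A^s))`; reality and
solenoidality of the coefficients are not part of the condition. -/
structure MemEn (A : HyperOp) (s T : ℝ) (c : ℝ → Freq → C3) : Prop where
  meas : ∀ k, AEStronglyMeasurable (fun t => c t k) (timeMeasure T)
  lt_top : ∫⁻ t, en A s (c t) ∂timeMeasure T < ⊤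

theorem aemeasurable_en {A : HyperOp} {s : ℝ} {μ : Measure ℝ} {c : ℝ → Freq → C3}
    (h : ∀ k, AEStronglyMeasurable (fun t => c t k) μ) : AEMeasurable (fun t => en A s (c t)) μ :=
  AEMeasurable.tsum fun k => ((h k).enorm.pow_const 2).const_mul _

theorem MemEn.ae_lt_top {A : HyperOp} {s T : ℝ} {c : ℝ → Freq → C3} (h : MemEn A s T c) :
    ∀ᵐ t ∂timeMeasure T, en A s (c t) < ⊤ :=
  ae_lt_top' (aemeasurable_en h.meas) h.lt_top.ne

theorem integrable_toReal_en {A : HyperOp} {s T : ℝ} {c : ℝ → Freq → C3} (h : MemEn A s T c) :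
    Integrable (fun t => (en A s (c t)).toReal) (timeMeasure T) :=
  integrable_toReal_of_lintegral_ne_top (aemeasurable_en h.meas) h.lt_top.ne

theorem MemEn.add {A : HyperOp} {s T : ℝ} {c d : ℝ → Freq → C3} (hc : MemEn A s T c)
    (hd : MemEn A s T d) : MemEn A s T fun t => c t + d t := by
  refine ⟨fun k => (hc.meas k).add (hd.meas k), (lintegral_mono fun t => en_add_le A s _ _).trans_lt ?_⟩
  rw [lintegral_const_mul' _ _ (by simp), lintegral_add_left' (aemeasurable_en hc.meas)]
  exact ENNReal.mul_lt_top (by simp) (ENNReal.add_lt_top.2 ⟨hc.lt_top, hd.lt_top⟩)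

theorem MemEn.sub {A : HyperOp} {s T : ℝ} {c d : ℝ → Freq → C3} (hc : MemEn A s T c)
    (hd : MemEn A s T d) : MemEn A s T fun t => c t - d t := by
  refine ⟨fun k => (hc.meas k).sub (hd.meas k), (lintegral_mono fun t => en_sub_le A s _ _).trans_lt ?_⟩
  rw [lintegral_const_mul' _ _ (by simp), lintegral_add_left' (aemeasurable_en hc.meas)]
  exact ENNReal.mul_lt_top (by simp) (ENNReal.add_lt_top.2 ⟨hc.lt_top, hd.lt_top⟩)

theorem MemEn.congr {A : HyperOp} {s T : ℝ} {c d : ℝ → Freq → C3} (hc : MemEn A s T c)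
    (h : ∀ᵐ t ∂timeMeasure T, c t = d t) : MemEn A s T d :=
  ⟨fun k => (hc.meas k).congr (h.mono fun t ht => congrFun ht k),
    (lintegral_congr_ae (h.mono fun t ht => by simp only [ht])).symm.trans_lt hc.lt_top⟩

theorem MemEn.symbol_smul {A : HyperOp} {T : ℝ} {c : ℝ → Freq → C3} (hc : MemEn A (1 / 2) T c) :
    MemEn A (-1 / 2) T fun t k => A.symbol k • c t k :=
  ⟨fun k => (hc.meas k).const_smul (A.symbol k),
    (lintegral_mono fun _ => en_symbol_smul_le A _).trans_lt hc.lt_top⟩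

theorem ofReal_weight_mul_sq_le_en (A : HyperOp) (s : ℝ) (c : Freq → C3) (k : Freq) :
    ENNReal.ofReal ((1 + A.symbol k) ^ (2 * s)) * ‖c k‖ₑ ^ 2 ≤ en A s c :=
  ENNReal.le_tsum k

theorem MemEn.memLp {A : HyperOp} {s T : ℝ} {c : ℝ → Freq → C3} (h : MemEn A s T c) (k : Freq) :
    MemLp (fun t => c t k) 2 (timeMeasure T) := by
  refine ⟨h.meas k, (eLpNorm_lt_top_iff_lintegral_rpow_enorm_lt_top (by simp) (by simp)).2 ?_⟩
  simp only [ENNReal.toReal_ofNat, ENNReal.rpow_ofNat]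
  have h1 := (lintegral_mono fun t => ofReal_weight_mul_sq_le_en A s (c t) k).trans_lt h.lt_top
  rw [lintegral_const_mul' _ _ (by simp)] at h1
  exact (ENNReal.mul_lt_top_iff.1 h1).elim (fun h => h.2) fun h => h.elim (fun h => absurd h
    (ENNReal.ofReal_pos.2 (A.weight_pos _ k)).ne') fun h => by simp [h]

theorem MemEn.intervalIntegrable {A : HyperOp} {s T : ℝ} (hT : 0 ≤ T) {c : ℝ → Freq → C3}
    (h : MemEn A s T c) (k : Freq) : IntervalIntegrable (fun t => c t k) volume 0 T :=
  (integrableOn_timeMeasure_iff hT).1 ((h.memLp k).integrable (by simp))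

theorem memEn_of_memLp {A : HyperOp} {s T : ℝ} {U : ℝ → Dom A s} (hU : MemLp U 2 (timeMeasure T)) :
    MemEn A s T fun t => (U t).coef := by
  refine ⟨fun k => (Dom.coefCLM A s k).continuous.comp_aestronglyMeasurable hU.1, ?_⟩
  have := (eLpNorm_lt_top_iff_lintegral_rpow_enorm_lt_top (by simp) (by simp)).1 hU.2
  simpa only [ENNReal.toReal_ofNat, ENNReal.rpow_ofNat, Dom.enorm_sq] using this

theorem MemEn.exists_memLp {A : HyperOp} {s T : ℝ} {c : ℝ → Freq → C3} (h : MemEn A s T c)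
    (hr : ∀ᵐ t ∂timeMeasure T, IsReal3 (c t)) :
    ∃ U : ℝ → Dom A s, MemLp U 2 (timeMeasure T) ∧ ∀ᵐ t ∂timeMeasure T, (U t).coef = c t := by
  classical
  let U : ℝ → Dom A s := fun t =>
    if h : IsReal3 (c t) ∧ en A s (c t) < ⊤ then Dom.of h.1 h.2 else 0
  have hU : ∀ᵐ t ∂timeMeasure T, (U t).coef = c t := by
    filter_upwards [hr, h.ae_lt_top] with t h1 h2
    simp only [U]
    rw [dif_pos ⟨h1, h2⟩, Dom.coef_of]
  refine ⟨U, ⟨Dom.aestronglyMeasurable_of_coef fun k => (h.meas k).congr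
    (hU.mono fun t ht => (congrFun ht k).symm), ?_⟩, hU⟩
  refine (eLpNorm_lt_top_iff_lintegral_rpow_enorm_lt_top (by simp) (by simp)).2 ?_
  simp only [ENNReal.toReal_ofNat, ENNReal.rpow_ofNat, Dom.enorm_sq]
  exact (lintegral_congr_ae (hU.mono fun t ht => by simp only [ht])).trans_lt h.lt_top

/-- The weak time derivative may be tested on each Fourier coefficient. -/
theorem isWeakTimeDeriv_iff {A : HyperOp} {s T : ℝ} {U g : ℝ → Dom A s}
    (hU : Integrable U (timeMeasure T)) (hg : Integrable g (timeMeasure T)) :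
    IsWeakTimeDeriv T U g ↔
      ∀ k, IsWeakTimeDeriv T (fun t => (U t).coef k) fun t => (g t).coef k := by
  have e : ∀ φ : ℝ → ℝ, ContDiff ℝ ∞ φ → HasCompactSupport φ → ∀ k,
      (∫ t in Ioo 0 T, deriv φ t • U t).coef k = ∫ t in Ioo 0 T, deriv φ t • (U t).coef k ∧
      (-∫ t in Ioo 0 T, φ t • g t).coef k = -∫ t in Ioo 0 T, φ t • (g t).coef k := by
    intro φ h1 h2 k
    constructor
    · rw [← Dom.coefCLM_apply, ← (Dom.coefCLM A s k).integral_comp_comm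
        (integrable_test_smul hU (h1.continuous_deriv (by simp)) h2.deriv)]
      rfl
    · rw [← Dom.coefCLM_apply, map_neg, ← (Dom.coefCLM A s k).integral_comp_comm
        (integrable_test_smul hg h1.continuous h2)]
      rfl
  constructor
  · intro h k φ h1 h2 h3
    rw [← (e φ h1 h2 k).1, ← (e φ h1 h2 k).2, h φ h1 h2 h3]
  · intro h φ h1 h2 h3
    refine Dom.ext (funext fun k => ?_)
    rw [(e φ h1 h2 k).1, (e φ h1 h2 k).2, h k φ h1 h2 h3]

/-! ### The energy identity for families of coefficients -/

theorem re_inner_C3 (x y : C3) :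
    (inner ℂ x y).re = ∑ j, ((x j).re * (y j).re + (x j).im * (y j).im) := by
  simp [PiLp.inner_apply, Complex.mul_re, mul_comm]

theorem norm_sq_const_add_primitive {t : ℝ} {p : ℝ → C3} (a : C3)
    (hp : IntervalIntegrable p volume 0 t) (ht : 0 ≤ t) :
    ‖a + ∫ r in 0..t, p r‖ ^ 2
      = ‖a‖ ^ 2 + 2 * ∫ s in 0..t, (inner ℂ (p s) (a + ∫ r in 0..s, p r)).re := by
  have hL : ∀ L : C3 →L[ℝ] ℝ, IntervalIntegrable (fun s => L (p s) * L (a + ∫ r in 0..s, p r))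
      volume 0 t ∧ L (a + ∫ r in 0..t, p r) ^ 2
        = L a ^ 2 + 2 * ∫ s in 0..t, L (p s) * L (a + ∫ r in 0..s, p r) := by
    intro L
    have hi : IntervalIntegrable (fun s => L (p s)) volume 0 t :=
      ⟨L.integrable_comp hp.1, L.integrable_comp hp.2⟩
    refine ⟨hi.mul_continuousOn ?_, ?_⟩
    · rw [uIcc_of_le ht]
      exact L.continuous.comp_continuousOn (continuousOn_const.add (continuousOn_primitive ht hp))
    · rw [map_add, ← L.intervalIntegral_comp_comm hp, sq_const_add_primitive (L a) hi]
      congr 2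
      refine intervalIntegral.integral_congr fun s hs => ?_
      rw [uIcc_of_le ht] at hs
      rw [map_add, ← L.intervalIntegral_comp_comm (intervalIntegrable_of_mem hp hs)]
  let R : Fin 3 → C3 →L[ℝ] ℝ := fun j =>
    Complex.reCLM.comp ((EuclideanSpace.proj j : C3 →L[ℂ] ℂ).restrictScalars ℝ)
  let I : Fin 3 → C3 →L[ℝ] ℝ := fun j =>
    Complex.imCLM.comp ((EuclideanSpace.proj j : C3 →L[ℂ] ℂ).restrictScalars ℝ)
  have hn : ∀ x : C3, ‖x‖ ^ 2 = ∑ j, (R j x ^ 2 + I j x ^ 2) := by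
    intro x
    rw [EuclideanSpace.norm_sq_eq]
    refine Finset.sum_congr rfl fun j _ => ?_
    rw [Complex.sq_norm, Complex.normSq_apply]
    simp [R, I, sq]
  have hi : ∀ x y : C3, (inner ℂ x y).re = ∑ j, (R j x * R j y + I j x * I j y) := re_inner_C3
  simp only [hi]
  rw [intervalIntegral.integral_finsetSum fun j _ => (hL (R j)).1.add (hL (I j)).1, hn, hn,
    Finset.mul_sum, ← Finset.sum_add_distrib]
  refine Finset.sum_congr rfl fun j _ => ?_
  rw [intervalIntegral.integral_add (hL (R j)).1 (hL (I j)).1, (hL (R j)).2, (hL (I j)).2]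
  ring

theorem le_add_of_sq_le_mul {x a b : ℝ≥0∞} (h : x ^ 2 ≤ a * b) : x ≤ a + b := by
  by_contra hcon
  rw [not_le] at hcon
  have h1 : (a + b) ^ 2 < x ^ 2 := ENNReal.pow_lt_pow_left two_ne_zero hcon
  have h2 : a * b ≤ (a + b) ^ 2 := by
    rw [sq]
    gcongr <;> simp
  exact absurd (h2.trans_lt h1) (not_lt.2 h)

theorem lintegral_tsum_enorm_mul_lt_top {A : HyperOp} {T : ℝ} {g y : ℝ → Freq → C3}
    (hg : MemEn A (-1 / 2) T g) (hy : MemEn A (1 / 2) T y) :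
    ∫⁻ t, ∑' k, ‖g t k‖ₑ * ‖y t k‖ₑ ∂timeMeasure T < ⊤ := by
  refine (lintegral_mono fun t => le_add_of_sq_le_mul
    (sq_tsum_enorm_mul_le A (g t) (y t))).trans_lt ?_
  rw [lintegral_add_left' (aemeasurable_en hg.meas)]
  exact ENNReal.add_lt_top.2 ⟨hg.lt_top, hy.lt_top⟩

theorem aestronglyMeasurable_inner {T : ℝ} {x y : ℝ → C3}
    (hx : AEStronglyMeasurable x (timeMeasure T)) (hy : AEStronglyMeasurable y (timeMeasure T)) :
    AEStronglyMeasurable (fun t => (inner ℂ (x t) (y t)).re) (timeMeasure T) :=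
  Complex.continuous_re.comp_aestronglyMeasurable (hx.inner hy)

theorem aestronglyMeasurable_pair {A : HyperOp} {T : ℝ} {g y : ℝ → Freq → C3}
    (hg : MemEn A (-1 / 2) T g) (hy : MemEn A (1 / 2) T y) :
    AEStronglyMeasurable (fun t => pair (g t) (y t)) (timeMeasure T) := by
  refine aestronglyMeasurable_of_tendsto_ae (Filter.atTop : Filter (Finset Freq))
    (f := fun S t => ∑ k ∈ S, (inner ℂ (g t k) (y t k)).re)
    (fun S => Finset.aestronglyMeasurable_fun_sum _ fun k _ =>
      aestronglyMeasurable_inner (hg.meas k) (hy.meas k)) ?_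
  filter_upwards [hg.ae_lt_top, hy.ae_lt_top] with t h1 h2
  exact (summable_pair h1 h2).hasSum

theorem integrable_pair {A : HyperOp} {T : ℝ} {g y : ℝ → Freq → C3}
    (hg : MemEn A (-1 / 2) T g) (hy : MemEn A (1 / 2) T y) :
    Integrable (fun t => pair (g t) (y t)) (timeMeasure T) := by
  refine ⟨aestronglyMeasurable_pair hg hy, lt_of_le_of_lt (lintegral_mono fun t => ?_)
    (lintegral_tsum_enorm_mul_lt_top hg hy)⟩
  exact enorm_tsum_le_tsum_enorm.trans (ENNReal.tsum_le_tsum fun k => enorm_re_inner_le _ _)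

/-- The pairing is integrated mode by mode. -/
theorem hasSum_integral_pair {A : HyperOp} {T : ℝ} {g y : ℝ → Freq → C3}
    (hg : MemEn A (-1 / 2) T g) (hy : MemEn A (1 / 2) T y) :
    ∃ M : Freq → ℝ, Summable M ∧ ∀ t ∈ Icc 0 T,
      (∀ k, |∫ s in 0..t, (inner ℂ (g s k) (y s k)).re| ≤ M k) ∧
      HasSum (fun k => ∫ s in 0..t, (inner ℂ (g s k) (y s k)).re)
        (∫ s in 0..t, pair (g s) (y s)) := by
  have hb := lintegral_tsum_enorm_mul_lt_top hg hy
  have hb2 : ∑' k, ∫⁻ t, ‖(inner ℂ (g t k) (y t k)).re‖ₑ ∂timeMeasure T < ⊤ := by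
    rw [← lintegral_tsum fun k => (aestronglyMeasurable_inner (hg.meas k) (hy.meas k)).enorm]
    exact (lintegral_mono fun t => ENNReal.tsum_le_tsum fun k => enorm_re_inner_le _ _).trans_lt hb
  have hi : ∀ k, Integrable (fun t => (inner ℂ (g t k) (y t k)).re) (timeMeasure T) := fun k =>
    ⟨aestronglyMeasurable_inner (hg.meas k) (hy.meas k), (ENNReal.le_tsum k).trans_lt hb2⟩
  have hn : ∀ k, ∫ t, ‖(inner ℂ (g t k) (y t k)).re‖ ∂timeMeasure T
      = (∫⁻ t, ‖(inner ℂ (g t k) (y t k)).re‖ₑ ∂timeMeasure T).toReal := fun k =>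
    integral_norm_eq_lintegral_enorm (hi k).1
  have hs : Summable fun k => ∫ t, ‖(inner ℂ (g t k) (y t k)).re‖ ∂timeMeasure T := by
    simp only [hn]
    exact ENNReal.summable_toReal hb2.ne
  refine ⟨_, hs, fun t ht => ?_⟩
  have hsub : ∀ {F : ℝ → ℝ}, ∫ s in 0..t, F s = ∫ s in Ioo 0 t, F s := by
    intro F
    rw [intervalIntegral.integral_of_le ht.1, integral_Ioc_eq_integral_Ioo]
  have hmono : timeMeasure t ≤ timeMeasure T := Measure.restrict_mono (Ioo_subset_Ioo_right ht.2) le_rfl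
  have hle : ∀ k, ∫ s in Ioo 0 t, ‖(inner ℂ (g s k) (y s k)).re‖
      ≤ ∫ s, ‖(inner ℂ (g s k) (y s k)).re‖ ∂timeMeasure T := fun k =>
    integral_mono_measure hmono (ae_of_all _ fun _ => norm_nonneg _) (hi k).norm
  refine ⟨fun k => ?_, ?_⟩
  · rw [hsub]
    exact (norm_integral_le_integral_norm _).trans (hle k)
  · simp only [hsub]
    exact hasSum_integral_of_summable_integral_norm (fun k => (hi k).mono_measure hmono)
      (hs.of_nonneg_of_le (fun k => integral_nonneg fun _ => norm_nonneg _) hle)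

/-- The energy identity: if `∂_t y = g` with `y ∈ L²(0,T; D(A^{1/2}))` and
`g ∈ L²(0,T; D(A^{-1/2}))`, then `‖y‖²` is a primitive of `2 ⟨g, y⟩`. Moreover, the squares
of the coefficients have a summable majorant that does not depend on time. -/
theorem energy_identity {A : HyperOp} {T : ℝ} {g y : ℝ → Freq → C3}
    (hg : MemEn A (-1 / 2) T g) (hy : MemEn A (1 / 2) T y) (h0 : en A 0 (y 0) < ⊤)
    (h : ∀ k, ∀ t ∈ Icc 0 T, y t k = y 0 k + ∫ s in 0..t, g s k) :
    (∀ t ∈ Icc 0 T, HasSum (fun k => ‖y t k‖ ^ 2)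
      (∑' k, ‖y 0 k‖ ^ 2 + 2 * ∫ s in 0..t, pair (g s) (y s))) ∧
    ∃ M : Freq → ℝ, Summable M ∧ ∀ t ∈ Icc 0 T, ∀ k, ‖y t k‖ ^ 2 ≤ M k := by
  have hs0 : Summable fun k => ‖y 0 k‖ ^ 2 := by
    simpa using summable_of_en h0
  obtain ⟨M, hM, hM2⟩ := hasSum_integral_pair hg hy
  have hk : ∀ t ∈ Icc 0 T, ∀ k,
      ‖y t k‖ ^ 2 = ‖y 0 k‖ ^ 2 + 2 * ∫ s in 0..t, (inner ℂ (g s k) (y s k)).re := by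
    intro t ht k
    rw [h k t ht, norm_sq_const_add_primitive _
      (intervalIntegrable_of_mem (hg.intervalIntegrable (ht.1.trans ht.2) k) ht) ht.1]
    congr 2
    refine intervalIntegral.integral_congr fun s hs => ?_
    rw [uIcc_of_le ht.1] at hs
    rw [h k s ⟨hs.1, hs.2.trans ht.2⟩]
  refine ⟨fun t ht => ?_, fun k => ‖y 0 k‖ ^ 2 + 2 * M k, hs0.add (hM.mul_left 2),
    fun t ht k => ?_⟩
  · simp only [hk t ht]
    exact hs0.hasSum.add ((hM2 t ht).2.mul_left 2)
  · rw [hk t ht]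
    have := (le_abs_self _).trans ((hM2 t ht).1 k)
    linarith

/-- A curve in `L²_σ(Ω)` is continuous if its Fourier coefficients are, and if these have a square
summable majorant. -/
theorem continuousOn_of_fourier {S : Set ℝ} {u : ℝ → L2sigma} {M : Freq → ℝ} (hM : Summable M)
    (h : ∀ t ∈ S, ∀ k, ‖fourier (u t : L2) k‖ ^ 2 ≤ M k)
    (hc : ∀ k, ContinuousOn (fun t => fourier (u t : L2) k) S) : ContinuousOn u S := by
  intro t ht
  rw [ContinuousWithinAt, tendsto_iff_norm_sub_tendsto_zero]
  have hsq : ∀ r, ‖u r - u t‖ ^ 2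
      = ∑' k, 2 * ‖fourier (u r : L2) k - fourier (u t : L2) k‖ ^ 2 := by
    intro r
    have h1 := hasSum_fourier_sq ((u r : L2) - (u t : L2))
    have e : ‖u r - u t‖ = ‖(u r : L2) - (u t : L2)‖ := rfl
    rw [e, ← h1.tsum_eq]
    simp only [fourier_sub, Pi.sub_apply]
  have h2 : Filter.Tendsto (fun r => ‖u r - u t‖ ^ 2) (nhdsWithin t S) (nhds 0) := by
    simp only [hsq]
    have h0 : (0 : ℝ) = ∑' k, 2 * ‖fourier (u t : L2) k - fourier (u t : L2) k‖ ^ 2 := by simp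
    rw [h0]
    refine tendsto_tsum_of_dominated_convergence (bound := fun k => 8 * M k) (hM.mul_left 8)
      (fun k => ?_) ?_
    · exact ((((hc k) t ht).sub_const _).norm.pow 2).const_mul 2
    · filter_upwards [self_mem_nhdsWithin] with r hr k
      rw [Real.norm_of_nonneg (by positivity)]
      have h3 := norm_sub_le (fourier (u r : L2) k) (fourier (u t : L2) k)
      have h4 := h r hr k
      have h5 := h t ht k
      have h6 : ‖fourier (u r : L2) k - fourier (u t : L2) k‖ ^ 2
          ≤ (‖fourier (u r : L2) k‖ + ‖fourier (u t : L2) k‖) ^ 2 := by gcongr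
      nlinarith [sq_nonneg (‖fourier (u r : L2) k‖ - ‖fourier (u t : L2) k‖)]
  have h3 := h2.sqrt
  simpa [Real.sqrt_sq] using h3

/-! ### The equation for the Fourier coefficients -/

theorem aestronglyMeasurable_bil {μ : Measure ℝ} {u v : ℝ → Freq → C3}
    (hu : ∀ k, AEStronglyMeasurable (fun t => u t k) μ)
    (hv : ∀ k, AEStronglyMeasurable (fun t => v t k) μ) (k : Freq) :
    AEStronglyMeasurable (fun t => bil (u t) (v t) k) μ := by
  have hj : ∀ {w : ℝ → C3}, AEStronglyMeasurable w μ → ∀ j, AEStronglyMeasurable (fun t => w t j) μ :=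
    fun hw j => (PiLp.continuous_apply 2 (fun _ : Fin 3 => ℂ) j).comp_aestronglyMeasurable hw
  have hc : AEStronglyMeasurable (fun t => conv (u t) (v t) k) μ := by
    refine (AEMeasurable.tsum fun l => ?_).aestronglyMeasurable
    have h : AEStronglyMeasurable (fun t => Complex.I * ∑ j, (wave k j : ℂ) * u t l j) μ :=
      (Finset.aestronglyMeasurable_fun_sum _ fun j _ => (hj (hu l) j).const_mul _).const_mul _
    exact (h.smul (hv (k - l))).aemeasurable
  have hS : AEStronglyMeasurable (fun t => ∑ j, (wave k j : ℂ) * conv (u t) (v t) k j) μ :=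
    Finset.aestronglyMeasurable_fun_sum _ fun j _ => (hj hc j).const_mul _
  refine (PiLp.continuous_toLp 2 fun _ : Fin 3 => ℂ).comp_aestronglyMeasurable
    (aemeasurable_pi_lambda _ fun i => AEStronglyMeasurable.aemeasurable ?_).aestronglyMeasurable
  simp only [div_eq_mul_inv]
  exact (hj hc i).sub ((hS.const_mul _).mul_const _)

/-- The estimate of the convection term as used in the energy estimates. -/
theorem HyperOp.exists_en_bil_le_mul (A : HyperOp) {K : ℝ≥0∞} (hK : K ≠ ⊤) : ∃ C : ℝ≥0∞, C ≠ ⊤ ∧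
    ∀ u : Freq → C3, en A 0 u ≤ K → en A (-1 / 2) (bil u u) ≤ C * en A (1 / 2) u := by
  obtain ⟨C, hC, h⟩ := A.exists_en_bil_sq_le
  refine ⟨C + K ^ 2, by finiteness, fun u hu => ?_⟩
  by_contra hcon
  rw [not_le] at hcon
  have h1 := ENNReal.pow_lt_pow_left two_ne_zero hcon
  have h2 : en A (-1 / 2) (bil u u) ^ 2 ≤ ((C + K ^ 2) * en A (1 / 2) u) ^ 2 := by
    calc _ ≤ _ := h u u
      _ ≤ C * (K * en A (1 / 2) u * (K * en A (1 / 2) u)) := by gcongr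
      _ = C * K ^ 2 * en A (1 / 2) u ^ 2 := by ring
      _ ≤ (C + K ^ 2) * (C + K ^ 2) * en A (1 / 2) u ^ 2 := by
          gcongr <;> simp
      _ = _ := by ring
  exact absurd (h1.trans_le h2) (lt_irrefl _)

/-- The right-hand side `F - A y - ℙ_σ (y · ∇ y)` of the equation, in Fourier coefficients. -/
def rhs (A : HyperOp) (F y : Freq → C3) : Freq → C3 :=
  F - (fun k => A.symbol k • y k) - bil y y

/-- `y` is a solution of the equation for the Fourier coefficients with force `F` and initial value
`c`, in integrated form. -/
structure IsModalSolution (A : HyperOp) (T : ℝ) (F : ℝ → Freq → C3) (c : Freq → C3)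
    (y : ℝ → Freq → C3) : Prop where
  isReal3 : ∀ t ∈ Icc 0 T, IsReal3 (y t)
  bounded : ∃ K : ℝ≥0∞, K ≠ ⊤ ∧ ∀ t ∈ Icc 0 T, en A 0 (y t) ≤ K
  memEn : MemEn A (1 / 2) T y
  eq : ∀ k, ∀ t ∈ Icc 0 T, y t k = c k + ∫ s in 0..t, rhs A (F s) (y s) k

theorem ae_timeMeasure_of_forall {T : ℝ} {p : ℝ → Prop} (h : ∀ t ∈ Icc 0 T, p t) :
    ∀ᵐ t ∂timeMeasure T, p t :=
  (ae_restrict_iff' measurableSet_Ioo).2 (ae_of_all _ fun t ht => h t (Ioo_subset_Icc_self ht))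

theorem intervalIntegral_congr_timeMeasure {X : Type*} [NormedAddCommGroup X] [NormedSpace ℝ X]
    {T t : ℝ} (ht : t ∈ Icc 0 T) {f g : ℝ → X} (h : ∀ᵐ s ∂timeMeasure T, f s = g s) :
    ∫ s in 0..t, f s = ∫ s in 0..t, g s := by
  rw [intervalIntegral.integral_of_le ht.1, intervalIntegral.integral_of_le ht.1,
    integral_Ioc_eq_integral_Ioo, integral_Ioc_eq_integral_Ioo]
  exact integral_congr_ae (ae_mono (Measure.restrict_mono (Ioo_subset_Ioo_right ht.2) le_rfl) h)

theorem intervalIntegral_mono_timeMeasure {T t : ℝ} (ht : t ∈ Icc 0 T) {f g : ℝ → ℝ}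
    (hf : IntervalIntegrable f volume 0 T) (hg : IntervalIntegrable g volume 0 T)
    (h : ∀ᵐ s ∂timeMeasure T, f s ≤ g s) : ∫ s in 0..t, f s ≤ ∫ s in 0..t, g s := by
  refine intervalIntegral.integral_mono_ae_restrict ht.1
    (intervalIntegrable_of_mem hf ht) (intervalIntegrable_of_mem hg ht) ?_
  rw [← Measure.restrict_congr_set Ioo_ae_eq_Icc]
  exact ae_mono (Measure.restrict_mono (Ioo_subset_Ioo_right ht.2) le_rfl) h

theorem memEn_bil_self {A : HyperOp} {T : ℝ} {y : ℝ → Freq → C3} {K : ℝ≥0∞} (hK : K ≠ ⊤)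
    (hb : ∀ t ∈ Icc 0 T, en A 0 (y t) ≤ K) (hy : MemEn A (1 / 2) T y) :
    MemEn A (-1 / 2) T fun t => bil (y t) (y t) := by
  obtain ⟨C, hC, h⟩ := A.exists_en_bil_le_mul hK
  refine ⟨aestronglyMeasurable_bil hy.meas hy.meas, (lintegral_mono_ae (ae_timeMeasure_of_forall
    fun t ht => h _ (hb t ht))).trans_lt ?_⟩
  rw [lintegral_const_mul' _ _ hC]
  exact ENNReal.mul_lt_top hC.lt_top hy.lt_top

theorem memEn_rhs {A : HyperOp} {T : ℝ} {F y : ℝ → Freq → C3} (hF : MemEn A (-1 / 2) T F)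
    {K : ℝ≥0∞} (hK : K ≠ ⊤) (hb : ∀ t ∈ Icc 0 T, en A 0 (y t) ≤ K) (hy : MemEn A (1 / 2) T y) :
    MemEn A (-1 / 2) T fun t => rhs A (F t) (y t) :=
  (hF.sub hy.symbol_smul).sub (memEn_bil_self hK hb hy)

theorem MemEn.neg_half_of_half {A : HyperOp} {T : ℝ} {y : ℝ → Freq → C3} (hy : MemEn A (1 / 2) T y) :
    MemEn A (-1 / 2) T y := by
  refine ⟨hy.meas, (lintegral_mono fun t => ?_).trans_lt hy.lt_top⟩
  rw [en_neg_half, en_half]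
  refine ENNReal.tsum_le_tsum fun k => ?_
  have h1 : 1 ≤ ENNReal.ofReal (1 + A.symbol k) := by
    rw [ENNReal.one_le_ofReal]
    linarith [A.symbol_nonneg k]
  gcongr
  exact (ENNReal.inv_le_one.2 h1).trans h1

/-- A strong solution has a continuous representative whose Fourier coefficients solve the
equation. -/
theorem IsStrongSolution.exists_isModalSolution {A : HyperOp} {T : ℝ} (hT : 0 < T) {u₀ : L2sigma}
    {f : ℝ → Dom A (-1 / 2)} {v : ℝ → L2sigma} (h : IsStrongSolution A T u₀ f v) :
    ∃ w : ℝ → L2sigma, v =ᵐ[timeMeasure T] w ∧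
      IsModalSolution A T (fun t => (f t).coef) (fourier (u₀ : L2)) fun t => fourier (w t : L2) := by
  obtain ⟨w, hwc, hvw, hw0⟩ := h.initial
  obtain ⟨U', hU', hrep'⟩ := h.memE1.1
  obtain ⟨g, ⟨hg, U, hU, hrep, hder⟩, heq⟩ := h.equation
  have hUi : Integrable U (timeMeasure T) := hU.integrable (by norm_num)
  have hgi : Integrable g (timeMeasure T) := hg.integrable (by norm_num)
  have hmem : MemEn A (1 / 2) T fun t => fourier (w t : L2) :=
    (memEn_of_memLp hU').congr (by filter_upwards [hrep', hvw] with t h1 h2; rw [h1, h2])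
  refine ⟨w, hvw, fun t _ => isReal3_fourier (w t).2, ?_, hmem, fun k => ?_⟩
  · obtain ⟨C, hC⟩ := isCompact_Icc.exists_bound_of_continuousOn hwc
    refine ⟨ENNReal.ofReal C ^ 2, by finiteness, fun t ht => ?_⟩
    calc en A 0 (fourier (w t : L2)) ≤ 2 * en A 0 (fourier (w t : L2)) :=
          le_mul_of_one_le_left' (by norm_num)
      _ = ‖(w t : L2)‖ₑ ^ 2 := en_zero_fourier A _
      _ ≤ _ := by
          gcongr
          rw [← ofReal_norm]
          exact ENNReal.ofReal_le_ofReal (hC t ht)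
  · have hgk : ∀ᵐ t ∂timeMeasure T, (g t).coef k
        = rhs A (f t).coef (fourier (w t : L2)) k := by
      filter_upwards [heq, hvw] with t ⟨G, hG, h1⟩ h2
      have h3 := h1 k
      rw [helmholtz_fourier_convection (v t).2 ((isWeakGradient_iff _ _).1 hG), h2] at h3
      simp only [rhs, Pi.sub_apply]
      rw [← h3]
      abel
    have hgik := (Dom.coefCLM A (-1 / 2) k).integrable_comp hgi
    obtain ⟨c, hc⟩ := ae_eq_const_add_primitive hT ((Dom.coefCLM A (-1 / 2) k).integrable_comp hUi)
      hgik ((isWeakTimeDeriv_iff hUi hgi).1 hder k)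
    have hwk : ContinuousOn (fun t => fourier (w t : L2) k) (Icc 0 T) :=
      (fourierCLM k).continuous.comp_continuousOn (continuous_subtype_val.comp_continuousOn hwc)
    have hprim := continuousOn_primitive hT.le ((integrableOn_timeMeasure_iff hT.le).1 hgik)
    have hall : EqOn (fun t => fourier (w t : L2) k)
        (fun t => c + ∫ s in 0..t, Dom.coefCLM A (-1 / 2) k (g s)) (Icc 0 T) := by
      refine Measure.eqOn_Icc_of_ae_eq volume hT.ne ?_ hwk (continuousOn_const.add hprim)
      rw [← Measure.restrict_congr_set Ioo_ae_eq_Icc]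
      filter_upwards [hc, hrep, hvw] with t h1 h2 h3
      rw [← h1, Dom.coefCLM_apply, h2, h3]
    have hc0 : c = fourier (u₀ : L2) k := by
      have := hall (left_mem_Icc.2 hT.le)
      simp only [intervalIntegral.integral_same, add_zero, hw0] at this
      exact this.symm
    intro t ht
    rw [← hc0, ← intervalIntegral_congr_timeMeasure ht hgk]
    exact hall ht

/-- Conversely, a solution of the equation for the Fourier coefficients is a strong solution, and it
is continuous with values in `L²_σ(Ω)`. -/
theorem IsModalSolution.exists_isStrongSolution {A : HyperOp} {T : ℝ} (hT : 0 < T) {u₀ : L2sigma}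
    {f : ℝ → Dom A (-1 / 2)} (hf : MemLp f 2 (timeMeasure T)) {y : ℝ → Freq → C3}
    (h : IsModalSolution A T (fun t => (f t).coef) (fourier (u₀ : L2)) y) :
    ∃ u : ℝ → L2sigma, IsStrongSolution A T u₀ f u ∧ ContinuousOn u (Icc 0 T) ∧ u 0 = u₀ ∧
      ∀ t ∈ Icc 0 T, fourier (u t : L2) = y t := by
  classical
  obtain ⟨K, hK, hb⟩ := h.bounded
  have hF := memEn_of_memLp hf
  have hg := memEn_rhs hF hK hb h.memEn
  have h0 : y 0 = fourier (u₀ : L2) := by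
    funext k
    simpa using h.eq k 0 (left_mem_Icc.2 hT.le)
  have h00 : en A 0 (y 0) < ⊤ := (hb 0 (left_mem_Icc.2 hT.le)).trans_lt hK.lt_top
  obtain ⟨-, M, hM, hyM⟩ := energy_identity hg h.memEn h00 fun k t ht => by rw [h0]; exact h.eq k t ht
  have hex : ∀ t, ∃ v : L2sigma, t ∈ Icc 0 T → fourier (v : L2) = y t := by
    intro t
    by_cases ht : t ∈ Icc 0 T
    · have hr := h.isReal3 t ht
      obtain ⟨v, hv⟩ := exists_L2sigma_fourier_eq hr.conj hr.div
        (hM.of_nonneg_of_le (fun _ => by positivity) (hyM t ht))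
      exact ⟨v, fun _ => hv⟩
    · exact ⟨0, fun h => absurd h ht⟩
  choose u hu using hex
  have hcont : ContinuousOn u (Icc 0 T) := by
    refine continuousOn_of_fourier hM (fun t ht k => by rw [hu t ht]; exact hyM t ht k) fun k => ?_
    refine (continuousOn_const.add (continuousOn_primitive hT.le
      (hg.intervalIntegrable hT.le k))).congr (f := fun t => fourier (u₀ : L2) k + _) fun t ht => ?_
    simp only
    rw [hu t ht]
    exact h.eq k t ht
  have hu0 : u 0 = u₀ := by
    refine Subtype.ext (fourier_injective ?_)
    rw [hu 0 (left_mem_Icc.2 hT.le), h0]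
  have hur : ∀ᵐ t ∂timeMeasure T, y t = fourier (u t : L2) :=
    ae_timeMeasure_of_forall fun t ht => (hu t ht).symm
  have hyr : ∀ᵐ t ∂timeMeasure T, IsReal3 (y t) := ae_timeMeasure_of_forall h.isReal3
  obtain ⟨U', hU', hrep'⟩ := h.memEn.exists_memLp hyr
  obtain ⟨U, hU, hrep⟩ := h.memEn.neg_half_of_half.exists_memLp hyr
  obtain ⟨g, hgm, hgrep⟩ := hg.exists_memLp (by
    filter_upwards [hyr] with t ht
    exact ((f t).isReal3.sub (ht.symbol_smul A.symbol_neg)).sub (isReal3_bil ht ht))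
  have hUi : Integrable U (timeMeasure T) := hU.integrable (by norm_num)
  have hgi : Integrable g (timeMeasure T) := hgm.integrable (by norm_num)
  have hder : HasH1DomDeriv A (-1 / 2) T u g := by
    refine ⟨hgm, U, hU, by filter_upwards [hrep, hur] with t h1 h2; rw [h1, h2], ?_⟩
    refine (isWeakTimeDeriv_iff hUi hgi).2 fun k φ h1 h2 h3 => ?_
    have hgik := (integrableOn_timeMeasure_iff hT.le).1 ((Dom.coefCLM A (-1 / 2) k).integrable_comp hgi)
    have h4 := integral_deriv_smul_primitive hT hgik (fourier (u₀ : L2) k) h1 h3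
    rw [intervalIntegral.integral_of_le hT.le, intervalIntegral.integral_of_le hT.le,
      integral_Ioc_eq_integral_Ioo, integral_Ioc_eq_integral_Ioo] at h4
    refine Eq.trans (setIntegral_congr_ae measurableSet_Ioo ?_) h4
    filter_upwards [(ae_restrict_iff' measurableSet_Ioo).1 hrep] with t h5 ht
    rw [h5 ht, h.eq k t (Ioo_subset_Icc_self ht)]
    congr 2
    refine intervalIntegral_congr_timeMeasure (Ioo_subset_Icc_self ht) ?_
    filter_upwards [hgrep] with s hs
    rw [Dom.coefCLM_apply, hs]
  refine ⟨u, ⟨⟨⟨U', hU', by filter_upwards [hrep', hur] with t h1 h2; rw [h1, h2]⟩, g, hder⟩,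
    ⟨g, hder, ?_⟩, u, hcont, Filter.EventuallyEq.rfl, hu0⟩, hcont, hu0, hu⟩
  filter_upwards [hgrep, hur, h.memEn.ae_lt_top] with t h1 h2 h3
  rw [h2] at h3
  obtain ⟨G, hG⟩ := exists_isWeakGradient h3
  refine ⟨G, hG, fun k => ?_⟩
  rw [h1, helmholtz_fourier_convection (u t).2 ((isWeakGradient_iff _ _).1 hG), h2]
  simp only [rhs, Pi.sub_apply]
  abel

theorem re_inner_smul_self (a : ℝ) (x : C3) : (inner ℂ (a • x) x).re = a * ‖x‖ ^ 2 := by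
  rw [RCLike.real_smul_eq_coe_smul (K := ℂ), inner_smul_left, inner_self_eq_norm_sq_to_K]
  simp [← Complex.ofReal_pow]

theorem pair_rhs {A : HyperOp} {F y : Freq → C3} (hF : en A (-1 / 2) F < ⊤) (hr : IsReal3 y)
    (hy : en A (1 / 2) y < ⊤) :
    pair (rhs A F y) y = pair F y - pair (fun k => A.symbol k • y k) y := by
  have h1 := (en_symbol_smul_le A y).trans_lt hy
  have h2 := (en_sub_le A (-1 / 2) F fun k => A.symbol k • y k).trans_lt (by finiteness)
  rw [rhs, pair_sub h2 (en_bil_lt_top hy hy) hy, pair_sub hF h1 hy, pair_bil_self hr hy, sub_zero]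

/-- The energy equality for the Fourier coefficients. -/
theorem IsModalSolution.energy {A : HyperOp} {T : ℝ} (hT : 0 < T) {F y : ℝ → Freq → C3}
    {c : Freq → C3} (hF : MemEn A (-1 / 2) T F) (h : IsModalSolution A T F c y) {t : ℝ}
    (ht : t ∈ Icc 0 T) :
    ∑' k, ‖y t k‖ ^ 2 + 2 * ∫ s in 0..t, pair (fun k => A.symbol k • y s k) (y s)
      = ∑' k, ‖y 0 k‖ ^ 2 + 2 * ∫ s in 0..t, pair (F s) (y s) := by
  obtain ⟨K, hK, hb⟩ := h.bounded
  have hc : y 0 = c := by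
    funext k
    simpa using h.eq k 0 (left_mem_Icc.2 hT.le)
  have h1 := (energy_identity (memEn_rhs hF hK hb h.memEn) h.memEn
    ((hb 0 (left_mem_Icc.2 hT.le)).trans_lt hK.lt_top) (fun k t ht => by rw [hc]; exact h.eq k t ht)).1
      t ht
  have hi : ∀ {G : ℝ → Freq → C3}, MemEn A (-1 / 2) T G →
      IntervalIntegrable (fun s => pair (G s) (y s)) volume 0 t := fun hG =>
    intervalIntegrable_of_mem ((integrableOn_timeMeasure_iff hT.le).1 (integrable_pair hG h.memEn)) ht
  have h2 : ∫ s in 0..t, pair (rhs A (F s) (y s)) (y s) = (∫ s in 0..t, pair (F s) (y s))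
      - ∫ s in 0..t, pair (fun k => A.symbol k • y s k) (y s) := by
    rw [← intervalIntegral.integral_sub (hi hF) (hi h.memEn.symbol_smul)]
    refine intervalIntegral_congr_timeMeasure ht ?_
    filter_upwards [hF.ae_lt_top, h.memEn.ae_lt_top, ae_timeMeasure_of_forall h.isReal3] with s h3 h4 h5
    exact pair_rhs h3 h5 h4
  rw [h1.tsum_eq, h2]
  ring

/-! ### Uniqueness -/

theorem toReal_en {A : HyperOp} {s : ℝ} (c : Freq → C3) :
    (en A s c).toReal = ∑' k, (1 + A.symbol k) ^ (2 * s) * ‖c k‖ ^ 2 := by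
  rw [en, ENNReal.tsum_toReal_eq fun k => by finiteness]
  congr 1
  funext k
  rw [ENNReal.toReal_mul, ENNReal.toReal_ofReal (A.weight_pos _ k).le]
  simp

theorem toReal_en_zero {A : HyperOp} (c : Freq → C3) : (en A 0 c).toReal = ∑' k, ‖c k‖ ^ 2 := by
  simp [toReal_en]

theorem toReal_en_half {A : HyperOp} {c : Freq → C3} (h : en A (1 / 2) c < ⊤) :
    (en A (1 / 2) c).toReal = ∑' k, ‖c k‖ ^ 2 + pair (fun k => A.symbol k • c k) c := by
  have h0 := summable_of_en ((en_zero_le_half A c).trans_lt h)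
  have h1 := summable_pair ((en_symbol_smul_le A c).trans_lt h) h
  simp only [mul_zero, Real.rpow_zero, one_mul] at h0
  rw [toReal_en, pair, ← h0.tsum_add h1]
  congr 1
  funext k
  rw [re_inner_smul_self]
  norm_num
  ring

theorem pair_symbol_smul_nonneg (A : HyperOp) (c : Freq → C3) :
    0 ≤ pair (fun k => A.symbol k • c k) c :=
  tsum_nonneg fun k => by
    rw [re_inner_smul_self]
    exact mul_nonneg (A.symbol_nonneg k) (sq_nonneg _)

theorem HyperOp.exists_abs_pair_bil_le (A : HyperOp) : ∃ C : ℝ, 0 ≤ C ∧ ∀ u v w : Freq → C3,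
    en A (1 / 2) u < ⊤ → en A (1 / 2) v < ⊤ → en A (1 / 2) w < ⊤ →
    |pair (bil u v) w| ^ 4 ≤ C * ((en A 0 u).toReal * (en A (1 / 2) u).toReal *
      ((en A 0 v).toReal * (en A (1 / 2) v).toReal)) * (en A (1 / 2) w).toReal ^ 2 := by
  obtain ⟨C, hC, h⟩ := A.exists_en_bil_sq_le
  refine ⟨C.toReal, ENNReal.toReal_nonneg, fun u v w hu hv hw => ?_⟩
  have hu0 := (en_zero_le_half A u).trans_lt hu
  have hv0 := (en_zero_le_half A v).trans_lt hv
  have h1 : ‖pair (bil u v) w‖ₑ ^ 4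
      ≤ C * (en A 0 u * en A (1 / 2) u * (en A 0 v * en A (1 / 2) v)) * en A (1 / 2) w ^ 2 := by
    calc _ = (‖pair (bil u v) w‖ₑ ^ 2) ^ 2 := by rw [← pow_mul]
      _ ≤ (en A (-1 / 2) (bil u v) * en A (1 / 2) w) ^ 2 := by
          gcongr
          exact enorm_pair_sq_le A _ _
      _ = en A (-1 / 2) (bil u v) ^ 2 * en A (1 / 2) w ^ 2 := mul_pow _ _ _
      _ ≤ _ := by
          gcongr
          exact h u v
  have h2 := ENNReal.toReal_mono (by finiteness) h1
  simpa using h2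

/-- Young's inequality in the form in which it absorbs the convection term in the dissipation. -/
theorem le_of_pow_four_le {p X H : ℝ} (hX : 0 ≤ X) (hH : 0 ≤ H)
    (h : p ^ 4 ≤ X * H ^ 3) : p ≤ H / 4 + 64 * X := by
  by_contra hcon
  rw [not_le] at hcon
  have hp : 0 < p := lt_of_le_of_lt (by positivity) hcon
  have h1 : H ^ 3 ≤ (4 * p) ^ 3 := by
    gcongr
    linarith
  have h2 : p ^ 3 * p ≤ p ^ 3 * (64 * X) := by nlinarith [mul_le_mul_of_nonneg_left h1 hX]
  have h3 := le_of_mul_le_mul_left h2 (by positivity)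
  linarith

theorem rhs_sub_rhs {A : HyperOp} {F y z : Freq → C3} (hy : en A 0 y < ⊤) (hz : en A 0 z < ⊤) :
    rhs A F y - rhs A F z
      = -(fun k => A.symbol k • (y - z) k) - bil (y - z) y - bil z (y - z) := by
  have h := bil_sub_bil hy hz
  have e : (fun k => A.symbol k • (y - z) k)
      = (fun k => A.symbol k • y k) - fun k => A.symbol k • z k := by
    funext k
    simp [smul_sub]
  rw [e, sub_sub _ (bil (y - z) y), ← h, rhs, rhs]
  abel

theorem pair_neg (g y : Freq → C3) : pair (-g) y = -pair g y := by
  simp [pair, tsum_neg]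

theorem en_neg (A : HyperOp) (s : ℝ) (c : Freq → C3) : en A s (-c) = en A s c := by
  simp [en]

theorem two_mul_pair_rhs_sub_rhs_le {A : HyperOp} {C K : ℝ} (hC0 : 0 ≤ C) (hK0 : 0 ≤ K)
    (hC : ∀ u v w : Freq → C3,
    en A (1 / 2) u < ⊤ → en A (1 / 2) v < ⊤ → en A (1 / 2) w < ⊤ →
    |pair (bil u v) w| ^ 4 ≤ C * ((en A 0 u).toReal * (en A (1 / 2) u).toReal *
      ((en A 0 v).toReal * (en A (1 / 2) v).toReal)) * (en A (1 / 2) w).toReal ^ 2)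
    {F y z : Freq → C3} (hy : en A (1 / 2) y < ⊤) (hz : en A (1 / 2) z < ⊤)
    (hyK : (en A 0 y).toReal ≤ K) (hzK : (en A 0 z).toReal ≤ K) :
    2 * pair (rhs A F y - rhs A F z) (y - z)
      ≤ (1 + 128 * (C * K) * ((en A (1 / 2) y).toReal + (en A (1 / 2) z).toReal))
        * ∑' k, ‖(y - z) k‖ ^ 2 := by
  have hw : en A (1 / 2) (y - z) < ⊤ := (en_sub_le A _ y z).trans_lt (by finiteness)
  rw [rhs_sub_rhs ((en_zero_le_half A y).trans_lt hy) ((en_zero_le_half A z).trans_lt hz)]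
  set w := y - z
  have ha : en A (-1 / 2) (-(fun k => A.symbol k • w k)) < ⊤ := by
    rw [en_neg]
    exact (en_symbol_smul_le A w).trans_lt hw
  have hb1 := en_bil_lt_top hw hy
  have hb2 := en_bil_lt_top hz hw
  rw [pair_sub ((en_sub_le A _ _ _).trans_lt (by finiteness)) hb2 hw, pair_sub ha hb1 hw, pair_neg]
  have hH := toReal_en_half hw
  have hD := pair_symbol_smul_nonneg A w
  have h1 := hC w y w hw hy hw
  have h2 := hC z w w hz hw hw
  rw [toReal_en_zero w] at h1 h2
  set E := ∑' k, ‖w k‖ ^ 2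
  have hE : 0 ≤ E := tsum_nonneg fun k => sq_nonneg _
  set H := (en A (1 / 2) w).toReal
  have hH0 : 0 ≤ H := ENNReal.toReal_nonneg
  set Hy := (en A (1 / 2) y).toReal
  have hHy0 : 0 ≤ Hy := ENNReal.toReal_nonneg
  set Hz := (en A (1 / 2) z).toReal
  have hHz0 : 0 ≤ Hz := ENNReal.toReal_nonneg
  have h3 : |pair (bil w y) w| ^ 4 ≤ (C * K * Hy * E) * H ^ 3 := by
    refine h1.trans (le_of_eq_of_le (b := (C * (en A 0 y).toReal * Hy * E) * H ^ 3) (by ring) ?_)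
    gcongr
  have h4 : |pair (bil z w) w| ^ 4 ≤ (C * K * Hz * E) * H ^ 3 := by
    refine h2.trans (le_of_eq_of_le (b := (C * (en A 0 z).toReal * Hz * E) * H ^ 3) (by ring) ?_)
    gcongr
  have h5 := le_of_pow_four_le (by positivity) hH0 h3
  have h6 := le_of_pow_four_le (by positivity) hH0 h4
  have h7 := neg_abs_le (pair (bil w y) w)
  have h8 := neg_abs_le (pair (bil z w) w)
  nlinarith

/-- Solutions are unique. The energy identity for the difference of two solutions yields a Gronwall
inequality, in which the square of the norm of the solutions in `D(A^{1/2})` is the coefficient. -/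
theorem IsModalSolution.unique {A : HyperOp} {T : ℝ} (hT : 0 < T) {F y z : ℝ → Freq → C3}
    {c : Freq → C3} (hF : MemEn A (-1 / 2) T F) (hy : IsModalSolution A T F c y)
    (hz : IsModalSolution A T F c z) : ∀ t ∈ Icc 0 T, y t = z t := by
  obtain ⟨K₁, hK₁, hb₁⟩ := hy.bounded
  obtain ⟨K₂, hK₂, hb₂⟩ := hz.bounded
  obtain ⟨C, hC0, hC⟩ := A.exists_abs_pair_bil_le
  have hg₁ := memEn_rhs hF hK₁ hb₁ hy.memEn
  have hg₂ := memEn_rhs hF hK₂ hb₂ hz.memEn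
  have hw := hy.memEn.sub hz.memEn
  have hg := hg₁.sub hg₂
  have h0T := left_mem_Icc.2 hT.le
  have hw0 : y 0 - z 0 = 0 := by
    funext k
    simp [hy.eq k 0 h0T, hz.eq k 0 h0T]
  have hen := (energy_identity hg hw (by rw [hw0]; simp [en]) fun k t ht => by
    rw [hw0]
    simp only [Pi.sub_apply, Pi.zero_apply, zero_add]
    rw [hy.eq k t ht, hz.eq k t ht, intervalIntegral.integral_sub
      (intervalIntegrable_of_mem (hg₁.intervalIntegrable hT.le k) ht)
      (intervalIntegrable_of_mem (hg₂.intervalIntegrable hT.le k) ht)]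
    abel).1
  set E : ℝ → ℝ := fun t => ∑' k, ‖(y t - z t) k‖ ^ 2
  set p : ℝ → ℝ := fun s => pair (rhs A (F s) (y s) - rhs A (F s) (z s)) (y s - z s)
  have hE : ∀ t ∈ Icc 0 T, E t = 2 * ∫ s in 0..t, p s := fun t ht => by
    refine (hen t ht).tsum_eq.trans ?_
    rw [hw0]
    simp
  have hp : IntervalIntegrable p volume 0 T :=
    (integrableOn_timeMeasure_iff hT.le).1 (integrable_pair hg hw)
  have hEc : ContinuousOn E (Icc 0 T) :=
    ((continuousOn_primitive hT.le hp).const_mul 2).congr hE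
  set K := (K₁ + K₂).toReal
  have hK : K₁ + K₂ ≠ ⊤ := by finiteness
  set m : ℝ → ℝ := fun s =>
    1 + 128 * (C * K) * ((en A (1 / 2) (y s)).toReal + (en A (1 / 2) (z s)).toReal)
  have hi : ∀ {x : ℝ → Freq → C3}, MemEn A (1 / 2) T x →
      IntervalIntegrable (fun s => (en A (1 / 2) (x s)).toReal) volume 0 T := fun hx =>
    (integrableOn_timeMeasure_iff hT.le).1 (integrable_toReal_en hx)
  have hm : IntervalIntegrable m volume 0 T :=
    (intervalIntegrable_const).add (((hi hy.memEn).add (hi hz.memEn)).const_mul _)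
  have hm0 : ∀ s, 0 ≤ m s := fun s => by positivity
  have hle : ∀ᵐ s ∂timeMeasure T, 2 * p s ≤ m s * E s := by
    filter_upwards [hy.memEn.ae_lt_top, hz.memEn.ae_lt_top, ae_timeMeasure_of_forall hb₁,
      ae_timeMeasure_of_forall hb₂] with s h1 h2 h3 h4
    exact two_mul_pair_rhs_sub_rhs_le hC0 ENNReal.toReal_nonneg hC h1 h2
      (ENNReal.toReal_mono hK (h3.trans le_self_add)) (ENNReal.toReal_mono hK (h4.trans le_add_self))
  have hzero := eq_zero_of_le_integral_mul hT hEc (fun t _ => tsum_nonneg fun _ => sq_nonneg _) hm0 hm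
    fun t ht => by
      rw [hE t ht, ← intervalIntegral.integral_const_mul]
      have hmE : IntervalIntegrable (fun s => m s * E s) volume 0 T :=
        hm.mul_continuousOn (by rwa [uIcc_of_le hT.le])
      exact intervalIntegral_mono_timeMeasure ht (hp.const_mul 2) hmE hle
  intro t ht
  funext k
  have h1 := hen t ht
  have h2 : ∑' k, ‖(y t - z t) k‖ ^ 2 = 0 := hzero t ht
  have h3 := h1.summable.hasSum
  rw [h2] at h3
  have h4 := (hasSum_zero_iff_of_nonneg fun k => sq_nonneg ‖(y t - z t) k‖).1 h3
  have h5 := congrFun h4 k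
  simp only [Pi.zero_apply, ne_eq, OfNat.ofNat_ne_zero, not_false_eq_true, pow_eq_zero_iff,
    norm_eq_zero, Pi.sub_apply] at h5
  exact sub_eq_zero.1 h5

/-! ### Differential equations with a truncated nonlinearity -/

/-- The integral equation `u = x₀ + G + ∫ Ψ(u)` with a bounded Lipschitz function `Ψ` and a continuous
function `G` of time is solvable on the whole time interval. -/
theorem exists_continuousOn_eq_add_integral {E : Type*} [NormedAddCommGroup E] [NormedSpace ℝ E]
    [CompleteSpace E] {Ψ : E → E} {K B : NNReal} (hK : LipschitzWith K Ψ) (hB : ∀ x, ‖Ψ x‖ ≤ B)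
    {T : ℝ} (hT : 0 ≤ T) {G : ℝ → E} (hG : ContinuousOn G (Icc 0 T)) (x₀ : E) :
    ∃ u : ℝ → E, ContinuousOn u (Icc 0 T) ∧
      ∀ t ∈ Icc 0 T, u t = x₀ + G t + ∫ s in 0..t, Ψ (u s) := by
  let t₀ : Icc 0 T := ⟨0, left_mem_Icc.2 hT⟩
  have hf : IsPicardLindelof (fun t x => Ψ (x + G t)) t₀ x₀ (B * T.toNNReal) 0 B K :=
    { lipschitzOnWith := fun t _ => by
        have h := hK.comp ((LipschitzWith.id (α := E)).add (LipschitzWith.const (G t)))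
        rw [add_zero, mul_one] at h
        exact h.lipschitzOnWith
      continuousOn := fun x _ => hK.continuous.comp_continuousOn (continuousOn_const.add hG)
      norm_le := fun t _ x _ => hB _
      mul_max_le := by simp [t₀, hT, Real.coe_toNNReal T hT] }
  obtain ⟨α, hα⟩ := ODE.FunSpace.exists_isFixedPt_next hf (Metric.mem_closedBall_self le_rfl)
  rw [ODE.FunSpace.isFixedPt_next_iff] at hα
  refine ⟨fun t => α.compProj t + G t, α.continuous_compProj.continuousOn.add hG, fun t ht => ?_⟩
  simp only
  rw [α.compProj_of_mem ht, hα, ODE.picard_apply]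
  abel

/-- A Lipschitz cutoff function, equal to `1` for `r ≤ R` and to `0` for `R + 1 ≤ r`. -/
def cutoff (R r : ℝ) : ℝ := max 0 (min 1 (R + 1 - r))

theorem cutoff_nonneg (R r : ℝ) : 0 ≤ cutoff R r := le_max_left _ _

theorem cutoff_le_one (R r : ℝ) : cutoff R r ≤ 1 := max_le zero_le_one (min_le_left _ _)

theorem cutoff_of_le {R r : ℝ} (h : r ≤ R) : cutoff R r = 1 := by
  rw [cutoff, min_eq_left (by linarith), max_eq_right zero_le_one]

theorem cutoff_of_ge {R r : ℝ} (h : R + 1 ≤ r) : cutoff R r = 0 :=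
  max_eq_left ((min_le_right _ _).trans (by linarith))

theorem abs_cutoff_sub_le (R r s : ℝ) : |cutoff R r - cutoff R s| ≤ |r - s| := by
  unfold cutoff
  refine (abs_max_sub_max_le_max _ _ _ _).trans (max_le (by simp) ?_)
  · exact (abs_min_sub_min_le_max _ _ _ _).trans (by
      simp only [sub_self, abs_zero]
      rw [max_eq_right (abs_nonneg _), show R + 1 - r - (R + 1 - s) = -(r - s) by ring, abs_neg])

/-- A function that is Lipschitz on bounded sets becomes bounded and Lipschitz if it is multiplied
with a cutoff function. -/
theorem exists_lipschitzWith_cutoff {E : Type*} [NormedAddCommGroup E] [NormedSpace ℝ E] {N : E → E}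
    {L : ℝ} (hL : 0 ≤ L) (h0 : N 0 = 0) (hN : ∀ x y, ‖N x - N y‖ ≤ L * (1 + ‖x‖ + ‖y‖) * ‖x - y‖)
    {R : ℝ} (hR : 0 ≤ R) : ∃ K B : NNReal, LipschitzWith K (fun x => -(cutoff R ‖x‖ • N x)) ∧
      ∀ x, ‖-(cutoff R ‖x‖ • N x)‖ ≤ B := by
  set B : ℝ := L * (2 + R) * (R + 1) with hBdef
  have hB0 : 0 ≤ B := by positivity
  have hb : ∀ x, ‖x‖ ≤ R + 1 → ‖N x‖ ≤ B := by
    intro x hx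
    have := hN x 0
    rw [h0, sub_zero, sub_zero, norm_zero, add_zero] at this
    have h2 : 1 + ‖x‖ ≤ 2 + R := by linarith
    refine this.trans ?_
    rw [hBdef]
    gcongr
  set K : ℝ := B + L * (2 * R + 3) with hKdef
  have hK0 : 0 ≤ K := by positivity
  have key : ∀ x y, ‖x‖ ≤ R + 1 →
      ‖cutoff R ‖x‖ • N x - cutoff R ‖y‖ • N y‖ ≤ K * ‖x - y‖ := by
    intro x y hx
    have e : cutoff R ‖x‖ • N x - cutoff R ‖y‖ • N y
        = (cutoff R ‖x‖ - cutoff R ‖y‖) • N x + cutoff R ‖y‖ • (N x - N y) := by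
      rw [sub_smul, smul_sub]
      abel
    have h1 : ‖(cutoff R ‖x‖ - cutoff R ‖y‖) • N x‖ ≤ ‖x - y‖ * B := by
      rw [norm_smul, Real.norm_eq_abs]
      have := (abs_cutoff_sub_le R ‖x‖ ‖y‖).trans (abs_norm_sub_norm_le x y)
      gcongr
      exact hb x hx
    have h2 : ‖cutoff R ‖y‖ • (N x - N y)‖ ≤ L * (2 * R + 3) * ‖x - y‖ := by
      rw [norm_smul, Real.norm_of_nonneg (cutoff_nonneg _ _)]
      rcases le_total (R + 1) ‖y‖ with hy | hy
      · rw [cutoff_of_ge hy, zero_mul]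
        positivity
      · refine (mul_le_of_le_one_left (norm_nonneg _) (cutoff_le_one _ _)).trans ((hN x y).trans ?_)
        have h3 : 1 + ‖x‖ + ‖y‖ ≤ 2 * R + 3 := by linarith
        gcongr
    rw [e]
    refine (norm_add_le _ _).trans ?_
    rw [hKdef]
    linarith
  refine ⟨K.toNNReal, B.toNNReal, LipschitzWith.of_dist_le_mul fun x y => ?_, fun x => ?_⟩
  · rw [dist_eq_norm, dist_eq_norm, neg_sub_neg, Real.coe_toNNReal K hK0]
    rcases le_total ‖x‖ (R + 1) with hx | hx
    · rw [norm_sub_rev]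
      exact key x y hx
    · rcases le_total ‖y‖ (R + 1) with hy | hy
      · rw [norm_sub_rev x y]
        exact key y x hy
      · rw [cutoff_of_ge hx, cutoff_of_ge hy, zero_smul, zero_smul, sub_zero, norm_zero]
        positivity
  · rw [norm_neg, norm_smul, Real.norm_of_nonneg (cutoff_nonneg _ _), Real.coe_toNNReal B hB0]
    rcases le_total ‖x‖ (R + 1) with hx | hx
    · exact (mul_le_of_le_one_left (norm_nonneg _) (cutoff_le_one _ _)).trans (hb x hx)
    · rw [cutoff_of_ge hx, zero_mul]
      exact hB0

/-! ### Extraction of convergent subsequences -/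

/-- A version of the theorem of Arzelà and Ascoli for countably many components. -/
theorem exists_subseq_tendsto {ι E : Type*} [Countable ι] [NormedAddCommGroup E] [ProperSpace E]
    {T : ℝ} (hT : 0 ≤ T) {z : ℕ → ι → ℝ → E} {B L : ι → ℝ}
    (hB : ∀ n i, ∀ t ∈ Icc 0 T, ‖z n i t‖ ≤ B i)
    (hL : ∀ n i, ∀ s ∈ Icc 0 T, ∀ t ∈ Icc 0 T, ‖z n i s - z n i t‖ ≤ L i * |s - t|) :
    ∃ φ : ℕ → ℕ, StrictMono φ ∧ ∃ Z : ι → ℝ → E, ∀ i, ∀ t ∈ Icc 0 T,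
      Filter.Tendsto (fun n => z (φ n) i t) Filter.atTop (nhds (Z i t)) := by
  let x : ℕ → ι × ℚ → E := fun n p => z n p.1 (projIcc 0 T hT p.2)
  have hc : IsCompact (Set.pi univ fun p : ι × ℚ => Metric.closedBall (0 : E) (B p.1)) :=
    isCompact_univ_pi fun p => isCompact_closedBall _ _
  obtain ⟨X, -, φ, hφ, hX⟩ := hc.isSeqCompact (x := x) fun n p _ =>
    mem_closedBall_zero_iff.2 (hB n p.1 _ (Subtype.coe_prop _))
  rw [tendsto_pi_nhds] at hX
  have hcauchy : ∀ i, ∀ t ∈ Icc 0 T, CauchySeq fun n => z (φ n) i t := by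
    intro i t ht
    rw [Metric.cauchySeq_iff']
    intro ε hε
    set l := |L i| + 1
    have hl : 0 < l := by positivity
    obtain ⟨q, hq1, hq2⟩ := exists_rat_btwn (show t - ε / (4 * l) < t by linarith [show 0 < ε / (4 * l) by positivity])
    set τ := projIcc 0 T hT q
    have hτ : |t - τ| ≤ ε / (4 * l) := by
      have h1 := abs_projIcc_sub_projIcc hT (c := t) (d := q)
      rw [projIcc_of_mem hT ht] at h1
      refine h1.trans ?_
      rw [abs_of_nonneg (by linarith)]
      linarith
    have hlip : ∀ n, ‖z n i t - z n i τ‖ ≤ ε / 4 := by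
      intro n
      calc _ ≤ L i * |t - τ| := hL n i t ht τ τ.2
        _ ≤ l * (ε / (4 * l)) := by
          gcongr
          exact (le_abs_self _).trans (by simp [l])
        _ = ε / 4 := by field_simp
    obtain ⟨N, hN⟩ := Metric.cauchySeq_iff'.1 (hX (i, q)).cauchySeq (ε / 4) (by positivity)
    refine ⟨N, fun n hn => ?_⟩
    have h1 := hN n hn
    rw [dist_eq_norm] at h1 ⊢
    have h2 := hlip (φ n)
    have h3 := hlip (φ N)
    have e : z (φ n) i t - z (φ N) i t = (z (φ n) i t - z (φ n) i τ)
        + (z (φ n) i τ - z (φ N) i τ) - (z (φ N) i t - z (φ N) i τ) := by abel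
    rw [e]
    have h4 := norm_sub_le ((z (φ n) i t - z (φ n) i τ) + (z (φ n) i τ - z (φ N) i τ))
      (z (φ N) i t - z (φ N) i τ)
    have h5 := norm_add_le (z (φ n) i t - z (φ n) i τ) (z (φ n) i τ - z (φ N) i τ)
    have h1' : ‖z (φ n) i τ - z (φ N) i τ‖ < ε / 4 := h1
    linarith
  have hex : ∀ i t, ∃ a, t ∈ Icc 0 T →
      Filter.Tendsto (fun n => z (φ n) i t) Filter.atTop (nhds a) := by
    intro i t
    by_cases ht : t ∈ Icc 0 T
    · obtain ⟨a, ha⟩ := cauchySeq_tendsto_of_complete (hcauchy i t ht)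
      exact ⟨a, fun _ => ha⟩
    · exact ⟨0, fun h => absurd h ht⟩
  choose Z hZ using hex
  exact ⟨φ, hφ, Z, hZ⟩

/-! ### Galerkin approximations -/

/-- The truncation of a family of coefficients to the modes in `S`. -/
def trunc (S : Finset Freq) (c : Freq → C3) : Freq → C3 := fun k => if k ∈ S then c k else 0

theorem trunc_of_mem {S : Finset Freq} {k : Freq} (hk : k ∈ S) (c : Freq → C3) :
    trunc S c k = c k := if_pos hk

theorem trunc_of_notMem {S : Finset Freq} {k : Freq} (hk : k ∉ S) (c : Freq → C3) :
    trunc S c k = 0 := if_neg hk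

theorem IsReal3.trunc {S : Finset Freq} (hS : ∀ k, -k ∈ S ↔ k ∈ S) {c : Freq → C3} (hc : IsReal3 c) :
    IsReal3 (trunc S c) := by
  constructor
  · intro k j
    by_cases hk : k ∈ S
    · rw [trunc_of_mem hk, trunc_of_mem ((hS k).2 hk), hc.conj]
    · rw [trunc_of_notMem hk, trunc_of_notMem (mt (hS k).1 hk)]
      simp
  · intro k
    by_cases hk : k ∈ S
    · rw [trunc_of_mem hk, hc.div]
    · rw [trunc_of_notMem hk]
      simp

theorem enorm_trunc_le (S : Finset Freq) (c : Freq → C3) (k : Freq) : ‖trunc S c k‖ₑ ≤ ‖c k‖ₑ := by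
  by_cases hk : k ∈ S
  · rw [trunc_of_mem hk]
  · rw [trunc_of_notMem hk]
    simp

theorem en_trunc_le (A : HyperOp) (s : ℝ) (S : Finset Freq) (c : Freq → C3) :
    en A s (trunc S c) ≤ en A s c :=
  ENNReal.tsum_le_tsum fun k => by
    gcongr
    exact enorm_trunc_le S c k

/-- All the norms are equivalent on truncated families. -/
theorem exists_en_trunc_le_mul (A : HyperOp) (s s' : ℝ) (S : Finset Freq) :
    ∃ C : ℝ≥0∞, C ≠ ⊤ ∧ ∀ c : Freq → C3, en A s (trunc S c) ≤ C * en A s' c := by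
  refine ⟨∑ k ∈ S, ENNReal.ofReal ((1 + A.symbol k) ^ (2 * s - 2 * s')),
    (ENNReal.sum_lt_top.2 fun _ _ => by finiteness).ne, fun c => ?_⟩
  rw [en, tsum_eq_sum (s := S) fun k hk => by rw [trunc_of_notMem hk]; simp, Finset.sum_mul]
  refine Finset.sum_le_sum fun k hk => ?_
  rw [trunc_of_mem hk]
  calc _ = ENNReal.ofReal ((1 + A.symbol k) ^ (2 * s - 2 * s')) *
        (ENNReal.ofReal ((1 + A.symbol k) ^ (2 * s')) * ‖c k‖ₑ ^ 2) := by
        rw [← mul_assoc, ← ENNReal.ofReal_mul (A.weight_pos _ k).le,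
          ← Real.rpow_add (A.one_add_symbol_pos k), sub_add_cancel]
    _ ≤ _ := by
        gcongr
        exact ofReal_weight_mul_sq_le_en A s' c k

theorem en_trunc_lt_top (A : HyperOp) (s : ℝ) (S : Finset Freq) (c : Freq → C3) :
    en A s (trunc S c) < ⊤ := by
  rw [en, tsum_eq_sum (s := S) fun k hk => by rw [trunc_of_notMem hk]; simp]
  exact ENNReal.sum_lt_top.2 fun _ _ => by finiteness

theorem MemEn.trunc {A : HyperOp} {s s' T : ℝ} {c : ℝ → Freq → C3} (h : MemEn A s' T c)
    (S : Finset Freq) : MemEn A s T fun t => trunc S (c t) := by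
  obtain ⟨C, hC, hle⟩ := exists_en_trunc_le_mul A s s' S
  refine ⟨fun k => ?_, (lintegral_mono fun t => hle (c t)).trans_lt ?_⟩
  · by_cases hk : k ∈ S
    · simp only [trunc_of_mem hk]
      exact h.meas k
    · simp only [trunc_of_notMem hk]
      exact aestronglyMeasurable_const
  · rw [lintegral_const_mul' _ _ hC]
    exact ENNReal.mul_lt_top hC.lt_top h.lt_top

theorem memEn_of_continuousOn {A : HyperOp} {s T : ℝ} {V : ℝ → Dom A s}
    (hV : ContinuousOn V (Icc 0 T)) : MemEn A s T fun t => (V t).coef := by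
  refine memEn_of_memLp ?_
  obtain ⟨C, hC⟩ := isCompact_Icc.exists_bound_of_continuousOn hV
  exact MemLp.of_bound ((hV.mono Ioo_subset_Icc_self).aestronglyMeasurable measurableSet_Ioo) C
    (ae_timeMeasure_of_forall hC)

theorem pair_trunc_left {S : Finset Freq} {g y : Freq → C3} (hy : trunc S y = y) :
    pair (trunc S g) y = pair g y := by
  rw [pair, pair]
  congr 1
  funext k
  by_cases hk : k ∈ S
  · rw [trunc_of_mem hk]
  · have h : y k = 0 := by rw [← hy, trunc_of_notMem hk]
    simp [h]

/-- Young's inequality for the duality pairing. -/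
theorem two_mul_pair_le {A : HyperOp} {s s' : ℝ} (hs : s' = -s) {g y : Freq → C3}
    (hg : en A s' g < ⊤) (hy : en A s y < ⊤) :
    2 * pair g y ≤ (en A s' g).toReal + (en A s y).toReal := by
  have h1 := summable_of_en hg
  have h2 := summable_of_en hy
  have hk : ∀ k, 2 * |(inner ℂ (g k) (y k)).re| ≤ (1 + A.symbol k) ^ (2 * s') * ‖g k‖ ^ 2
      + (1 + A.symbol k) ^ (2 * s) * ‖y k‖ ^ 2 := by
    intro k
    have h3 := (Complex.abs_re_le_norm _).trans (norm_inner_le_norm (𝕜 := ℂ) (g k) (y k))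
    have hp := A.weight_pos s k
    have e1 : (1 + A.symbol k) ^ (2 * s) = ((1 + A.symbol k) ^ s) ^ 2 := by
      rw [mul_comm, Real.rpow_mul (A.one_add_symbol_pos k).le, Real.rpow_two]
    have e2 : (1 + A.symbol k) ^ (2 * s') = (((1 + A.symbol k) ^ s)⁻¹) ^ 2 := by
      rw [hs, mul_comm, Real.rpow_mul (A.one_add_symbol_pos k).le, Real.rpow_two,
        Real.rpow_neg (A.one_add_symbol_pos k).le]
    rw [e1, e2]
    have h4 := sq_nonneg (((1 + A.symbol k) ^ s)⁻¹ * ‖g k‖ - (1 + A.symbol k) ^ s * ‖y k‖)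
    have h5 : ((1 + A.symbol k) ^ s)⁻¹ * ‖g k‖ * ((1 + A.symbol k) ^ s * ‖y k‖) = ‖g k‖ * ‖y k‖ := by
      field_simp
    nlinarith
  have h0 : Summable fun k => (inner ℂ (g k) (y k)).re :=
    Summable.of_norm_bounded (h1.add h2) fun k => by
      have := hk k
      rw [Real.norm_eq_abs]
      linarith [abs_nonneg (inner ℂ (g k) (y k)).re]
  rw [toReal_en, toReal_en, ← h1.tsum_add h2, pair, ← tsum_mul_left]
  exact (h0.mul_left 2).tsum_le_tsum (fun k => by linarith [hk k, le_abs_self (inner ℂ (g k) (y k)).re])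
    (h1.add h2)

theorem norm_bil_le {A : HyperOp} (u v : Dom A 0) (k : Freq) :
    ‖bil u.coef v.coef k‖ ≤ 2 * √(waveSq k) * (‖u‖ * ‖v‖) := by
  have h := enorm_bil_sq_le A u.coef v.coef k
  rw [← Dom.enorm_sq, ← Dom.enorm_sq] at h
  have h2 := ENNReal.toReal_mono (by finiteness) h
  simp only [ENNReal.toReal_pow, toReal_enorm, ENNReal.toReal_mul, ENNReal.toReal_ofNat,
    ENNReal.toReal_ofReal (waveSq_nonneg k)] at h2
  refine le_of_sq_le_sq (a := ‖bil u.coef v.coef k‖) ?_ (by positivity)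
  calc _ ≤ _ := h2
    _ = 4 * √(waveSq k) ^ 2 * (‖u‖ ^ 2 * ‖v‖ ^ 2) := by rw [Real.sq_sqrt (waveSq_nonneg k)]
    _ = _ := by ring

theorem Dom.norm_le_sum {A : HyperOp} {S : Finset Freq} {c : Dom A 0} (hc : ∀ k ∉ S, c.coef k = 0) :
    ‖c‖ ≤ ∑ k ∈ S, ‖c.coef k‖ := by
  have h := c.hasSum
  simp only [mul_zero, Real.rpow_zero, one_mul] at h
  have h2 := h.unique (hasSum_sum_of_ne_finset_zero (s := S) fun k hk => by rw [hc k hk]; simp)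
  refine le_of_sq_le_sq (a := ‖c‖) ?_ (Finset.sum_nonneg fun _ _ => norm_nonneg _)
  rw [h2]
  exact Finset.sum_sq_le_sq_sum_of_nonneg fun _ _ => norm_nonneg _

theorem isReal3_symbol_add_bil {A : HyperOp} {y : Freq → C3} (hy : IsReal3 y) :
    IsReal3 ((fun k => A.symbol k • y k) + bil y y) :=
  (hy.symbol_smul A.symbol_neg).add (isReal3_bil hy hy)

/-- The truncation of `A u + ℙ_σ (u · ∇ u)` to the modes in `S`. -/
def galerkinField (A : HyperOp) {S : Finset Freq} (hS : ∀ k, -k ∈ S ↔ k ∈ S) (u : Dom A 0) :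
    Dom A 0 :=
  Dom.of ((isReal3_symbol_add_bil (A := A) u.isReal3).trunc hS) (en_trunc_lt_top A 0 S _)

theorem coef_galerkinField (A : HyperOp) {S : Finset Freq} (hS : ∀ k, -k ∈ S ↔ k ∈ S) (u : Dom A 0) :
    (galerkinField A hS u).coef = trunc S ((fun k => A.symbol k • u.coef k) + bil u.coef u.coef) :=
  rfl

theorem norm_galerkinField_sub_le (A : HyperOp) {S : Finset Freq} (hS : ∀ k, -k ∈ S ↔ k ∈ S)
    (u v : Dom A 0) : ‖galerkinField A hS u - galerkinField A hS v‖
      ≤ (∑ k ∈ S, (A.symbol k + 2 * √(waveSq k))) * (1 + ‖u‖ + ‖v‖) * ‖u - v‖ := by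
  have hfin : ∀ w : Dom A 0, en A 0 w.coef < ⊤ := fun w => by
    rw [← Dom.enorm_sq]
    finiteness
  have hsub : ∀ k, (galerkinField A hS u - galerkinField A hS v).coef k
      = (galerkinField A hS u).coef k - (galerkinField A hS v).coef k := fun k => rfl
  refine (Dom.norm_le_sum (S := S) fun k hk => ?_).trans ?_
  · rw [hsub, coef_galerkinField, coef_galerkinField, trunc_of_notMem hk, trunc_of_notMem hk, sub_zero]
  rw [mul_assoc, Finset.sum_mul]
  refine Finset.sum_le_sum fun k hk => ?_
  have e : (galerkinField A hS u - galerkinField A hS v).coef k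
      = A.symbol k • (u - v).coef k + (bil (u - v).coef u.coef k + bil v.coef (u - v).coef k) := by
    have h1 := congrFun (bil_sub_bil (hfin u) (hfin v)) k
    rw [hsub, coef_galerkinField, coef_galerkinField, trunc_of_mem hk, trunc_of_mem hk]
    simp only [Pi.add_apply, Pi.sub_apply, Dom.coef_sub] at h1 ⊢
    rw [← h1, smul_sub]
    abel
  have h1 := norm_bil_le (u - v) u k
  have h2 := norm_bil_le v (u - v) k
  have h3 : ‖A.symbol k • (u - v).coef k‖ ≤ A.symbol k * ‖u - v‖ := by
    rw [norm_smul, Real.norm_of_nonneg (A.symbol_nonneg k)]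
    have := Dom.norm_coef_le k (u - v)
    rw [neg_zero, Real.rpow_zero, one_mul] at this
    have := A.symbol_nonneg k
    gcongr
  rw [e]
  refine (norm_add_le _ _).trans ((add_le_add h3 ((norm_add_le _ _).trans (add_le_add h1 h2))).trans ?_)
  have ha := A.symbol_nonneg k
  have : 0 ≤ A.symbol k * (‖u‖ + ‖v‖) * ‖u - v‖ := by positivity
  have : 0 ≤ √(waveSq k) * ‖u - v‖ := by positivity
  nlinarith

theorem bil_zero : bil 0 0 = 0 := by
  have hconv : conv (0 : Freq → C3) 0 = 0 := by
    funext k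
    simp [conv]
  rw [bil, hconv]
  funext k
  ext i
  simp [helmholtz]

/-- The truncated system with a cutoff of the nonlinear term. -/
theorem exists_cutoff_galerkin {A : HyperOp} {T : ℝ} (hT : 0 < T) {F : ℝ → Freq → C3}
    {c : Freq → C3} (hF : MemEn A (-1 / 2) T F) (hFr : ∀ t, IsReal3 (F t)) (hc : IsReal3 c)
    {S : Finset Freq} (hS : ∀ k, -k ∈ S ↔ k ∈ S) {R : ℝ} (hR : 0 ≤ R) :
    ∃ u : ℝ → Dom A 0, ContinuousOn u (Icc 0 T) ∧
      (∀ t ∈ Icc 0 T, trunc S (u t).coef = (u t).coef) ∧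
      MemEn A (-1 / 2) T (fun t => trunc S (F t) - cutoff R ‖u t‖ • (galerkinField A hS (u t)).coef) ∧
      ∀ k, ∀ t ∈ Icc 0 T, (u t).coef k = trunc S c k +
        ∫ s in 0..t, (trunc S (F s) - cutoff R ‖u s‖ • (galerkinField A hS (u s)).coef) k := by
  obtain ⟨U, hU, hUF⟩ := (hF.trunc (s := 0) S).exists_memLp (ae_of_all _ fun t => (hFr t).trunc hS)
  have hUi : IntervalIntegrable U volume 0 T :=
    (integrableOn_timeMeasure_iff hT.le).1 (hU.integrable (by norm_num))
  obtain ⟨K, B, hK, hB⟩ := exists_lipschitzWith_cutoff (N := galerkinField A hS)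
    (Finset.sum_nonneg fun k _ => add_nonneg (A.symbol_nonneg k) (by positivity))
    (Dom.ext (funext fun k => by
      have h0 : (0 : Dom A 0).coef = 0 := rfl
      rw [coef_galerkinField, h0]
      by_cases hk : k ∈ S
      · rw [trunc_of_mem hk]
        simp [bil_zero]
      · rw [trunc_of_notMem hk]
        rfl))
    (norm_galerkinField_sub_le A hS) hR
  obtain ⟨u, huc, hu⟩ := exists_continuousOn_eq_add_integral hK hB hT.le
    (continuousOn_primitive hT.le hUi) (Dom.of (A := A) (hc.trunc hS) (en_trunc_lt_top A 0 S c))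
  set Ψ : Dom A 0 → Dom A 0 := fun x => -(cutoff R ‖x‖ • galerkinField A hS x)
  have hΨc : ContinuousOn (fun t => Ψ (u t)) (Icc 0 T) := hK.continuous.comp_continuousOn huc
  have hΨi : IntervalIntegrable (fun t => Ψ (u t)) volume 0 T :=
    ContinuousOn.intervalIntegrable (by rwa [uIcc_of_le hT.le])
  have htr : ∀ x, trunc S (Ψ x).coef = (Ψ x).coef := by
    intro x
    funext k
    by_cases hk : k ∈ S
    · rw [trunc_of_mem hk]
    · have h1 : (Ψ x).coef k = -(cutoff R ‖x‖ • (galerkinField A hS x).coef k) := rfl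
      rw [trunc_of_notMem hk, h1, coef_galerkinField, trunc_of_notMem hk, smul_zero, neg_zero]
  have hg : MemEn A (-1 / 2) T
      fun t => trunc S (F t) - cutoff R ‖u t‖ • (galerkinField A hS (u t)).coef := by
    have h1 := ((memEn_of_continuousOn hΨc).trunc (s := -1 / 2) S)
    simp only [htr] at h1
    refine ((hF.trunc S).add h1).congr (ae_of_all _ fun t => ?_)
    rw [sub_eq_add_neg]
    rfl
  have heq : ∀ k, ∀ t ∈ Icc 0 T, (u t).coef k = trunc S c k +
        ∫ s in 0..t, (trunc S (F s) - cutoff R ‖u s‖ • (galerkinField A hS (u s)).coef) k := by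
    intro k t ht
    have h1 := congrArg (Dom.coefCLM A 0 k) (hu t ht)
    have hUt := intervalIntegrable_of_mem hUi ht
    have hΨt := intervalIntegrable_of_mem hΨi ht
    have hc' : ∀ {V : ℝ → Dom A 0}, IntervalIntegrable V volume 0 t →
        IntervalIntegrable (fun s => Dom.coefCLM A 0 k (V s)) volume 0 t := fun hV =>
      ⟨(Dom.coefCLM A 0 k).integrable_comp hV.1, (Dom.coefCLM A 0 k).integrable_comp hV.2⟩
    rw [map_add, map_add, ← (Dom.coefCLM A 0 k).intervalIntegral_comp_comm hUt,
      ← (Dom.coefCLM A 0 k).intervalIntegral_comp_comm hΨt, add_assoc,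
      ← intervalIntegral.integral_add (hc' hUt) (hc' hΨt)] at h1
    refine h1.trans (congrArg₂ (· + ·) rfl (intervalIntegral_congr_timeMeasure ht ?_))
    filter_upwards [hUF] with s hs
    rw [Dom.coefCLM_apply, hs, Pi.sub_apply, sub_eq_add_neg]
    rfl
  refine ⟨u, huc, fun t ht => ?_, hg, heq⟩
  funext k
  by_cases hk : k ∈ S
  · rw [trunc_of_mem hk]
  · rw [trunc_of_notMem hk, heq k t ht, trunc_of_notMem hk, zero_add]
    refine ((intervalIntegral.integral_congr (g := fun _ => 0) fun s _ => ?_).trans (by simp)).symm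
    simp only [Pi.sub_apply, Pi.smul_apply]
    rw [coef_galerkinField, trunc_of_notMem hk, trunc_of_notMem hk, smul_zero, sub_zero]

theorem toReal_en_zero_coef {A : HyperOp} (c : Dom A 0) : (en A 0 c.coef).toReal = ‖c‖ ^ 2 := by
  rw [← Dom.enorm_sq]
  simp

theorem integral_toReal_en_le {A : HyperOp} {s T : ℝ} {c : ℝ → Freq → C3} (h : MemEn A s T c) {t : ℝ}
    (ht : t ∈ Icc 0 T) :
    ∫ r in 0..t, (en A s (c r)).toReal ≤ (∫⁻ r, en A s (c r) ∂timeMeasure T).toReal := by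
  rw [← integral_toReal (aemeasurable_en h.meas) h.ae_lt_top, intervalIntegral.integral_of_le ht.1,
    integral_Ioc_eq_integral_Ioo]
  exact integral_mono_measure (Measure.restrict_mono (Ioo_subset_Ioo_right ht.2) le_rfl)
    (ae_of_all _ fun _ => ENNReal.toReal_nonneg) (integrable_toReal_en h)

/-- The Galerkin approximations exist on the whole time interval, and satisfy energy bounds that do
not depend on the truncation. The cutoff is removed by an a priori bound that may depend on the
truncation, for which the dissipation is not needed. -/
theorem exists_galerkin {A : HyperOp} {T : ℝ} (hT : 0 < T) {F : ℝ → Freq → C3}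
    {c : Freq → C3} (hF : MemEn A (-1 / 2) T F) (hFr : ∀ t, IsReal3 (F t)) (hc : IsReal3 c)
    (hc0 : en A 0 c < ⊤) : ∃ K : ℝ≥0∞, K ≠ ⊤ ∧ ∀ S : Finset Freq, (∀ k, -k ∈ S ↔ k ∈ S) →
      ∃ y : ℝ → Freq → C3, (∀ t ∈ Icc 0 T, IsReal3 (y t)) ∧ (∀ t ∈ Icc 0 T, en A 0 (y t) ≤ K) ∧
        MemEn A (1 / 2) T y ∧ ∫⁻ t, en A (1 / 2) (y t) ∂timeMeasure T ≤ K ∧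
        ∀ k, ∀ t ∈ Icc 0 T, y t k = trunc S c k + ∫ s in 0..t, trunc S (rhs A (F s) (y s)) k := by
  set E₀ := (en A 0 c).toReal
  set Φ := (∫⁻ t, en A (-1 / 2) (F t) ∂timeMeasure T).toReal
  have hE₀ : 0 ≤ E₀ := ENNReal.toReal_nonneg
  have hΦ : 0 ≤ Φ := ENNReal.toReal_nonneg
  set M := (E₀ + Φ) * Real.exp T
  have hM : 0 ≤ M := by positivity
  refine ⟨ENNReal.ofReal (E₀ + Φ + (2 * T + 1) * M), ENNReal.ofReal_ne_top, fun S hS => ?_⟩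
  set ΦS := (∫⁻ t, en A 0 (trunc S (F t)) ∂timeMeasure T).toReal
  have hΦS : 0 ≤ ΦS := ENNReal.toReal_nonneg
  set R := √((E₀ + ΦS) * Real.exp T)
  obtain ⟨u, huc, hutr, hg, hueq⟩ := exists_cutoff_galerkin hT hF hFr hc hS (Real.sqrt_nonneg
    ((E₀ + ΦS) * Real.exp T))
  have h0T := left_mem_Icc.2 hT.le
  have hy0 : MemEn A 0 T fun t => (u t).coef := memEn_of_continuousOn huc
  have hy : MemEn A (1 / 2) T fun t => (u t).coef :=
    (hy0.trunc S).congr (ae_timeMeasure_of_forall hutr)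
  have hu0 : (u 0).coef = trunc S c := by
    funext k
    rw [hueq k 0 h0T, intervalIntegral.integral_same, add_zero]
  have hEu0 : ‖u 0‖ ^ 2 ≤ E₀ := by
    rw [← toReal_en_zero_coef, hu0]
    exact ENNReal.toReal_mono hc0.ne (en_trunc_le A 0 S c)
  have henergy := (energy_identity hg hy (by rw [hu0]; exact en_trunc_lt_top A 0 S c)
    fun k t ht => by rw [hu0]; exact hueq k t ht).1
  set g : ℝ → Freq → C3 :=
    fun t => trunc S (F t) - cutoff R ‖u t‖ • (galerkinField A hS (u t)).coef with hgdef
  have hE : ∀ t ∈ Icc 0 T, ‖u t‖ ^ 2 = ‖u 0‖ ^ 2 + 2 * ∫ s in 0..t, pair (g s) ((u s).coef) := by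
    intro t ht
    rw [← toReal_en_zero_coef (u 0), toReal_en_zero, ← (henergy t ht).tsum_eq, ← toReal_en_zero,
      toReal_en_zero_coef]
  have hi : IntervalIntegrable (fun s => pair (g s) ((u s).coef)) volume 0 T :=
    (integrableOn_timeMeasure_iff hT.le).1 (integrable_pair hg hy)
  have hEc : ContinuousOn (fun t => ‖u t‖ ^ 2) (Icc 0 T) := huc.norm.pow 2
  have hEi : IntervalIntegrable (fun t => ‖u t‖ ^ 2) volume 0 T :=
    ContinuousOn.intervalIntegrable (by rwa [uIcc_of_le hT.le])
  set D : ℝ → ℝ := fun t => pair (fun k => A.symbol k • (u t).coef k) ((u t).coef)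
  have hD0 : ∀ t, 0 ≤ D t := fun t => pair_symbol_smul_nonneg A _
  have hDi : IntervalIntegrable D volume 0 T :=
    (integrableOn_timeMeasure_iff hT.le).1 (integrable_pair hy.symbol_smul hy)
  have hfin : ∀ t ∈ Icc 0 T, en A (1 / 2) (u t).coef < ⊤ := fun t ht => by
    rw [← hutr t ht]
    exact en_trunc_lt_top A _ S _
  -- The nonlinear term does no work, the linear one is dissipative.
  have hpair : ∀ t ∈ Icc 0 T, en A (-1 / 2) (F t) < ⊤ →
      pair (g t) (u t).coef = pair (F t) (u t).coef - cutoff R ‖u t‖ * D t := by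
    intro t ht hFt
    have h1 := hfin t ht
    have h2 : en A (-1 / 2) (fun k => A.symbol k • (u t).coef k) < ⊤ :=
      (en_symbol_smul_le A _).trans_lt h1
    have h3 : pair (galerkinField A hS (u t)).coef (u t).coef = D t := by
      rw [coef_galerkinField, pair_trunc_left (hutr t ht), pair_add h2 (en_bil_lt_top h1 h1) h1,
        pair_bil_self (u t).isReal3 h1, add_zero]
    have h4 : pair (cutoff R ‖u t‖ • (galerkinField A hS (u t)).coef) (u t).coef
        = cutoff R ‖u t‖ * pair (galerkinField A hS (u t)).coef (u t).coef := by
      rw [pair, pair, ← tsum_mul_left]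
      congr 1
      funext k
      rw [Pi.smul_apply, RCLike.real_smul_eq_coe_smul (K := ℂ), inner_smul_left]
      simp
    have h5 : en A (-1 / 2) (cutoff R ‖u t‖ • (galerkinField A hS (u t)).coef) < ⊤ := by
      have : trunc S (cutoff R ‖u t‖ • (galerkinField A hS (u t)).coef)
          = cutoff R ‖u t‖ • (galerkinField A hS (u t)).coef := by
        funext k
        by_cases hk : k ∈ S
        · rw [trunc_of_mem hk]
        · rw [trunc_of_notMem hk, Pi.smul_apply, coef_galerkinField, trunc_of_notMem hk, smul_zero]
      rw [← this]
      exact en_trunc_lt_top A _ S _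
    rw [hgdef]
    simp only
    rw [pair_sub (en_trunc_lt_top A _ S _) h5 h1, pair_trunc_left (hutr t ht), h4, h3]
  have hgron : ∀ K₀, 0 ≤ K₀ → (∀ t ∈ Icc 0 T, ‖u t‖ ^ 2 ≤ K₀ + ∫ s in 0..t, ‖u s‖ ^ 2) →
      ∀ t ∈ Icc 0 T, ‖u t‖ ^ 2 ≤ K₀ * Real.exp T := by
    intro K₀ hK₀ h t ht
    refine (le_mul_exp_of_le_add_integral hT hEc (fun _ _ => sq_nonneg _) hK₀ h t ht).trans ?_
    gcongr
    exact ht.2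
  have hR : ∀ t ∈ Icc 0 T, ‖u t‖ ≤ R := by
    have hFS := hF.trunc (s := 0) S
    have hFSi := (integrableOn_timeMeasure_iff hT.le).1 (integrable_toReal_en hFS)
    intro t ht
    refine Real.le_sqrt_of_sq_le (hgron _ (by positivity) (fun t ht => ?_) t ht)
    have h1 : ∫ s in 0..t, 2 * pair (g s) (u s).coef
        ≤ ∫ s in 0..t, ((en A 0 (trunc S (F s))).toReal + ‖u s‖ ^ 2) := by
      refine intervalIntegral_mono_timeMeasure ht (hi.const_mul 2) (hFSi.add hEi) ?_
      filter_upwards [hF.ae_lt_top, ae_restrict_mem measurableSet_Ioo] with s h1 h2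
      have hs := Ioo_subset_Icc_self h2
      have h3 := two_mul_pair_le (s := 0) (s' := 0) neg_zero.symm (en_trunc_lt_top A 0 S (F s))
        ((en_zero_le_half A _).trans_lt (hfin s hs))
      rw [pair_trunc_left (hutr s hs), toReal_en_zero_coef] at h3
      rw [hpair s hs h1]
      nlinarith [mul_nonneg (cutoff_nonneg R ‖u s‖) (hD0 s)]
    rw [intervalIntegral.integral_const_mul, intervalIntegral.integral_add
      (intervalIntegrable_of_mem hFSi ht) (intervalIntegrable_of_mem hEi ht)] at h1
    have h2 : _ ≤ ΦS := integral_toReal_en_le hFS ht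
    rw [hE t ht]
    linarith
  have hFi := (integrableOn_timeMeasure_iff hT.le).1 (integrable_toReal_en hF)
  have hED : ∀ t ∈ Icc 0 T, ‖u t‖ ^ 2 + ∫ s in 0..t, D s ≤ E₀ + Φ + ∫ s in 0..t, ‖u s‖ ^ 2 := by
    intro t ht
    have h1 : ∫ s in 0..t, 2 * pair (g s) (u s).coef
        ≤ ∫ s in 0..t, ((en A (-1 / 2) (F s)).toReal + ‖u s‖ ^ 2 - D s) := by
      refine intervalIntegral_mono_timeMeasure ht (hi.const_mul 2) ((hFi.add hEi).sub hDi) ?_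
      filter_upwards [hF.ae_lt_top, ae_restrict_mem measurableSet_Ioo] with s h1 h2
      have hs := Ioo_subset_Icc_self h2
      have h3 := two_mul_pair_le (s := 1 / 2) (s' := -1 / 2) (by norm_num) h1 (hfin s hs)
      rw [toReal_en_half (hfin s hs), ← toReal_en_zero (A := A), toReal_en_zero_coef] at h3
      rw [hpair s hs h1, cutoff_of_le (hR s hs)]
      linarith [hD0 s]
    rw [intervalIntegral.integral_const_mul, intervalIntegral.integral_sub
      ((intervalIntegrable_of_mem hFi ht).add (intervalIntegrable_of_mem hEi ht))
      (intervalIntegrable_of_mem hDi ht), intervalIntegral.integral_add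
      (intervalIntegrable_of_mem hFi ht) (intervalIntegrable_of_mem hEi ht)] at h1
    have h2 : _ ≤ Φ := integral_toReal_en_le hF ht
    rw [hE t ht]
    linarith
  have hEM : ∀ t ∈ Icc 0 T, ‖u t‖ ^ 2 ≤ M := hgron _ (by positivity) fun t ht => by
    have h1 := hED t ht
    have h2 : 0 ≤ ∫ s in 0..t, D s := intervalIntegral.integral_nonneg ht.1 fun s _ => hD0 s
    linarith
  have hTI := right_mem_Icc.2 hT.le
  have hintE : ∫ s in 0..T, ‖u s‖ ^ 2 ≤ T * M := by
    have h1 := intervalIntegral_mono_timeMeasure hTI hEi (intervalIntegrable_const (c := M))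
      (ae_timeMeasure_of_forall hEM)
    simpa using h1
  refine ⟨fun t => (u t).coef, fun t _ => (u t).isReal3, fun t ht => ?_, hy, ?_, fun k t ht => ?_⟩
  · rw [← Dom.enorm_sq, ← ofReal_sq_norm]
    refine ENNReal.ofReal_le_ofReal ((hEM t ht).trans ?_)
    nlinarith
  · rw [← ENNReal.ofReal_toReal hy.lt_top.ne]
    refine ENNReal.ofReal_le_ofReal ?_
    rw [← integral_toReal (aemeasurable_en hy.meas) hy.ae_lt_top, ← integral_Ioc_eq_integral_Ioo,
      ← intervalIntegral.integral_of_le hT.le]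
    have h1 : ∫ s in 0..T, (en A (1 / 2) (u s).coef).toReal = ∫ s in 0..T, (‖u s‖ ^ 2 + D s) := by
      refine intervalIntegral_congr_timeMeasure hTI ?_
      filter_upwards [hy.ae_lt_top] with s hs
      rw [toReal_en_half hs, ← toReal_en_zero (A := A), toReal_en_zero_coef]
    rw [h1, intervalIntegral.integral_add hEi hDi]
    have h2 := hED T hTI
    nlinarith [sq_nonneg ‖u T‖]
  · refine (hueq k t ht).trans (congrArg₂ (· + ·) rfl ?_)
    refine intervalIntegral.integral_congr fun s hs => ?_
    rw [uIcc_of_le ht.1] at hs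
    simp only
    rw [cutoff_of_le (hR s ⟨hs.1, hs.2.trans ht.2⟩), one_smul, coef_galerkinField]
    by_cases hk : k ∈ S
    · simp only [Pi.sub_apply, trunc_of_mem hk, rhs, Pi.add_apply]
      abel
    · simp only [Pi.sub_apply, trunc_of_notMem hk, sub_zero]

/-! ### Passage to the limit -/

/-- Each coefficient of the right-hand side is locally Lipschitz in the norm of `L²(Ω)`. -/
theorem exists_enorm_rhs_sub_sq_le (A : HyperOp) {K : ℝ≥0∞} (hK : K ≠ ⊤) (k : Freq) :
    ∃ C : ℝ≥0∞, C ≠ ⊤ ∧ ∀ F u v : Freq → C3, en A 0 u ≤ K → en A 0 v ≤ K →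
      ‖rhs A F u k - rhs A F v k‖ₑ ^ 2 ≤ C * en A 0 (u - v) := by
  refine ⟨2 * (2 * (ENNReal.ofReal (A.symbol k) ^ 2 + 4 * ENNReal.ofReal (waveSq k) * K)
    + 4 * ENNReal.ofReal (waveSq k) * K), by finiteness, fun F u v hu hv => ?_⟩
  have h := congrFun (rhs_sub_rhs (A := A) (F := F) (hu.trans_lt hK.lt_top) (hv.trans_lt hK.lt_top)) k
  simp only [Pi.sub_apply, Pi.neg_apply] at h
  rw [h]
  set w := u - v
  have h1 : ‖-(A.symbol k • (u k - v k))‖ₑ ^ 2 ≤ ENNReal.ofReal (A.symbol k) ^ 2 * en A 0 w := by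
    rw [enorm_neg, enorm_smul, mul_pow, Real.enorm_of_nonneg (A.symbol_nonneg k)]
    gcongr
    rw [en_zero]
    exact ENNReal.le_tsum (f := fun k => ‖w k‖ₑ ^ 2) k
  have h2 : ‖bil w u k‖ₑ ^ 2 ≤ 4 * ENNReal.ofReal (waveSq k) * K * en A 0 w := by
    calc _ ≤ _ := enorm_bil_sq_le A w u k
      _ ≤ 4 * ENNReal.ofReal (waveSq k) * (en A 0 w * K) := by gcongr
      _ = _ := by ring
  have h3 : ‖bil v w k‖ₑ ^ 2 ≤ 4 * ENNReal.ofReal (waveSq k) * K * en A 0 w := by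
    calc _ ≤ _ := enorm_bil_sq_le A v w k
      _ ≤ 4 * ENNReal.ofReal (waveSq k) * (K * en A 0 w) := by gcongr
      _ = _ := by ring
  calc _ ≤ (‖-(A.symbol k • (u k - v k)) - bil w u k‖ₑ + ‖bil v w k‖ₑ) ^ 2 := by
        gcongr
        exact enorm_sub_le
    _ ≤ 2 * (‖-(A.symbol k • (u k - v k)) - bil w u k‖ₑ ^ 2 + ‖bil v w k‖ₑ ^ 2) :=
        add_sq_le_two_mul _ _
    _ ≤ 2 * ((‖-(A.symbol k • (u k - v k))‖ₑ + ‖bil w u k‖ₑ) ^ 2 + ‖bil v w k‖ₑ ^ 2) := by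
        gcongr
        exact enorm_sub_le
    _ ≤ 2 * (2 * (‖-(A.symbol k • (u k - v k))‖ₑ ^ 2 + ‖bil w u k‖ₑ ^ 2) + ‖bil v w k‖ₑ ^ 2) := by
        gcongr
        exact add_sq_le_two_mul _ _
    _ ≤ 2 * (2 * (ENNReal.ofReal (A.symbol k) ^ 2 * en A 0 w
          + 4 * ENNReal.ofReal (waveSq k) * K * en A 0 w)
          + 4 * ENNReal.ofReal (waveSq k) * K * en A 0 w) := by gcongr
    _ = _ := by ring

/-- The norms of the scale are lower semicontinuous under convergence of the coefficients. -/
theorem en_le_liminf {A : HyperOp} {s : ℝ} {c : ℕ → Freq → C3} {d : Freq → C3}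
    (h : ∀ k, Filter.Tendsto (fun n => c n k) Filter.atTop (nhds (d k))) :
    en A s d ≤ Filter.liminf (fun n => en A s (c n)) Filter.atTop := by
  have e : ∀ x : Freq → C3, en A s x
      = ∫⁻ k, ENNReal.ofReal ((1 + A.symbol k) ^ (2 * s)) * ‖x k‖ₑ ^ 2 ∂Measure.count := fun x =>
    (lintegral_count _).symm
  simp only [e]
  refine le_trans (lintegral_mono fun k => le_of_eq ?_)
    (lintegral_liminf_le' fun n => (measurable_of_countable _).aemeasurable)
  refine (Filter.Tendsto.liminf_eq ?_).symm
  exact ENNReal.Tendsto.const_mul (ENNReal.Tendsto.pow ((continuous_enorm.tendsto _).comp (h k)))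
    (Or.inr ENNReal.ofReal_ne_top)

theorem en_le_of_tendsto {A : HyperOp} {s : ℝ} {c : ℕ → Freq → C3} {d : Freq → C3}
    (h : ∀ k, Filter.Tendsto (fun n => c n k) Filter.atTop (nhds (d k))) {K : ℝ≥0∞}
    (hK : ∀ n, en A s (c n) ≤ K) : en A s d ≤ K :=
  (en_le_liminf h).trans (Filter.liminf_le_of_frequently_le' (Filter.Frequently.of_forall hK))

theorem IsReal3.of_tendsto {c : ℕ → Freq → C3} {d : Freq → C3} (hc : ∀ n, IsReal3 (c n))
    (h : ∀ k, Filter.Tendsto (fun n => c n k) Filter.atTop (nhds (d k))) : IsReal3 d := by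
  have hj : ∀ k j, Filter.Tendsto (fun n => c n k j) Filter.atTop (nhds (d k j)) := fun k j =>
    ((PiLp.continuous_apply 2 (fun _ : Fin 3 => ℂ) j).tendsto _).comp (h k)
  constructor
  · intro k j
    refine tendsto_nhds_unique (hj (-k) j) ?_
    simp only [fun n => (hc n).conj k j]
    exact (Complex.continuous_conj.tendsto _).comp (hj k j)
  · intro k
    have h1 := tendsto_finsetSum (Finset.univ : Finset (Fin 3)) fun j _ =>
      (hj k j).const_mul (wave k j : ℂ)
    simp only [fun n => (hc n).div k] at h1
    exact (tendsto_nhds_unique h1 tendsto_const_nhds)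

/-- High frequencies are controlled by the norm of `D(A^{1/2})`. -/
theorem HyperOp.exists_en_zero_le (A : HyperOp) : ∃ C : ℝ≥0∞, C ≠ ⊤ ∧ ∀ (N : ℕ) (c : Freq → C3),
    en A 0 c ≤ ∑ k ∈ freqBox N, ‖c k‖ₑ ^ 2 + ((N + 1 : ℕ) : ℝ≥0∞)⁻¹ * C * en A (1 / 2) c := by
  obtain ⟨C, hC, h⟩ := waveSq_le_symbol A
  refine ⟨ENNReal.ofReal C, ENNReal.ofReal_ne_top, fun N c => ?_⟩
  have htail : ∀ k ∉ freqBox N,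
      (1 : ℝ≥0∞) ≤ ((N + 1 : ℕ) : ℝ≥0∞)⁻¹ * ENNReal.ofReal C * ENNReal.ofReal (1 + A.symbol k) := by
    intro k hk
    rw [mem_freqBox] at hk
    push Not at hk
    obtain ⟨j, hj⟩ := hk
    have h1 : ((N + 1 : ℕ) : ℝ) ≤ |(k j : ℝ)| := by exact_mod_cast hj
    have h2 : ((N + 1 : ℕ) : ℝ) ≤ wave k j ^ 2 := by
      have h3 := h1.trans (abs_le_abs_wave k j)
      have h4 : (1 : ℝ) ≤ ((N + 1 : ℕ) : ℝ) := by exact_mod_cast Nat.succ_pos N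
      rw [← sq_abs]
      nlinarith
    have h5 : ((N + 1 : ℕ) : ℝ≥0∞) ≤ ENNReal.ofReal C * ENNReal.ofReal (1 + A.symbol k) := by
      rw [← ENNReal.ofReal_mul hC, ← ENNReal.ofReal_natCast]
      exact ENNReal.ofReal_le_ofReal (h2.trans ((sq_le_waveSq k j).trans (h k)))
    calc (1 : ℝ≥0∞) = ((N + 1 : ℕ) : ℝ≥0∞)⁻¹ * ((N + 1 : ℕ) : ℝ≥0∞) :=
          (ENNReal.inv_mul_cancel (by simp) (by simp)).symm
      _ ≤ ((N + 1 : ℕ) : ℝ≥0∞)⁻¹ * (ENNReal.ofReal C * ENNReal.ofReal (1 + A.symbol k)) := by gcongr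
      _ = _ := by ring
  have e : ∑ k ∈ freqBox N, ‖c k‖ₑ ^ 2 = ∑' k, if k ∈ freqBox N then ‖c k‖ₑ ^ 2 else 0 := by
    rw [tsum_eq_sum (s := freqBox N) fun k hk => if_neg hk]
    exact Finset.sum_congr rfl fun k hk => (if_pos hk).symm
  rw [e, en_zero, en_half, ← ENNReal.tsum_mul_left, ← ENNReal.tsum_add]
  refine ENNReal.tsum_le_tsum fun k => ?_
  by_cases hk : k ∈ freqBox N
  · rw [if_pos hk]
    exact le_self_add
  · rw [if_neg hk, zero_add, ← mul_assoc]
    exact le_mul_of_one_le_left' (htail k hk)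

/-- Families that are bounded in `L²(0,T; D(A^{1/2}))` and converge to zero in every mode converge
to zero in `L²(0,T; L²(Ω))`. -/
theorem tendsto_lintegral_en_zero {A : HyperOp} {T : ℝ} {w : ℕ → ℝ → Freq → C3} {K : ℝ≥0∞}
    (hK : K ≠ ⊤) (hm : ∀ n, MemEn A (1 / 2) T (w n))
    (hb : ∀ n, ∀ t ∈ Icc 0 T, en A 0 (w n t) ≤ K)
    (hi : ∀ n, ∫⁻ t, en A (1 / 2) (w n t) ∂timeMeasure T ≤ K)
    (h : ∀ k, ∀ t ∈ Icc 0 T, Filter.Tendsto (fun n => w n t k) Filter.atTop (nhds 0)) :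
    Filter.Tendsto (fun n => ∫⁻ t, en A 0 (w n t) ∂timeMeasure T) Filter.atTop (nhds 0) := by
  obtain ⟨C, hC, htail⟩ := A.exists_en_zero_le
  have hsplit : ∀ N n, ∫⁻ t, en A 0 (w n t) ∂timeMeasure T
      ≤ ∑ k ∈ freqBox N, ∫⁻ t, ‖w n t k‖ₑ ^ 2 ∂timeMeasure T
        + ((N + 1 : ℕ) : ℝ≥0∞)⁻¹ * (C * K) := by
    intro N n
    have hne : ((N + 1 : ℕ) : ℝ≥0∞)⁻¹ * C ≠ ⊤ := ENNReal.mul_ne_top (by simp) hC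
    refine (lintegral_mono fun t => htail N (w n t)).trans ?_
    rw [lintegral_add_right' _ ((aemeasurable_en (hm n).meas).const_mul _),
      lintegral_finsetSum' _ fun k _ => ((hm n).meas k).enorm.pow_const 2,
      lintegral_const_mul' _ _ hne, ← mul_assoc]
    gcongr
    exact hi n
  have hmode : ∀ k, Filter.Tendsto (fun n => ∫⁻ t, ‖w n t k‖ₑ ^ 2 ∂timeMeasure T) Filter.atTop
      (nhds 0) := by
    intro k
    have h0 : (0 : ℝ≥0∞) = ∫⁻ _, 0 ∂timeMeasure T := by simp
    rw [h0]
    refine tendsto_lintegral_of_dominated_convergence' (fun _ => K)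
      (fun n => ((hm n).meas k).enorm.pow_const 2) (fun n => ae_timeMeasure_of_forall fun t ht => ?_)
      (by simp [ENNReal.mul_eq_top, hK]) (ae_timeMeasure_of_forall fun t ht => ?_)
    · refine le_trans ?_ (hb n t ht)
      rw [en_zero]
      exact ENNReal.le_tsum (f := fun k => ‖w n t k‖ₑ ^ 2) k
    · have := ENNReal.Tendsto.pow (n := 2) ((continuous_enorm.tendsto _).comp (h k t ht))
      simpa using this
  rw [ENNReal.tendsto_nhds_zero]
  intro ε hε
  have h1 : Filter.Tendsto (fun N : ℕ => ((N + 1 : ℕ) : ℝ≥0∞)⁻¹ * (C * K)) Filter.atTop (nhds 0) := by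
    have := ENNReal.Tendsto.mul_const (b := C * K)
      (ENNReal.tendsto_inv_nat_nhds_zero.comp (Filter.tendsto_add_atTop_nat 1))
      (Or.inr (ENNReal.mul_ne_top hC hK))
    simpa using this
  obtain ⟨N, hN⟩ := (ENNReal.tendsto_nhds_zero.1 h1 (ε / 2) (ENNReal.half_pos hε.ne')).exists
  have h2 := tendsto_finsetSum (freqBox N) fun k _ => hmode k
  simp only [Finset.sum_const_zero] at h2
  filter_upwards [ENNReal.tendsto_nhds_zero.1 h2 (ε / 2) (ENNReal.half_pos hε.ne')] with n hn
  exact (hsplit N n).trans ((add_le_add hn hN).trans_eq (ENNReal.add_halves ε))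

theorem lintegral_le_sqrt_mul {μ : Measure ℝ} {f : ℝ → ℝ≥0∞} (hf : AEMeasurable f μ) :
    ∫⁻ t, f t ∂μ ≤ (∫⁻ t, f t ^ 2 ∂μ) ^ (1 / 2 : ℝ) * μ univ ^ (1 / 2 : ℝ) := by
  have h := ENNReal.lintegral_mul_le_Lp_mul_Lq μ Real.HolderConjugate.two_two hf
    (aemeasurable_const (b := (1 : ℝ≥0∞)))
  simpa using h

/-- The right-hand sides converge in every mode. -/
theorem tendsto_integral_rhs {A : HyperOp} {T : ℝ} {F : ℝ → Freq → C3} {K : ℝ≥0∞} (hK : K ≠ ⊤)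
    (hF : MemEn A (-1 / 2) T F) {Y : ℕ → ℝ → Freq → C3} {y : ℝ → Freq → C3}
    (hY : ∀ n, MemEn A (1 / 2) T (Y n)) (hy : MemEn A (1 / 2) T y)
    (hYK : ∀ n, ∀ t ∈ Icc 0 T, en A 0 (Y n t) ≤ K) (hyK : ∀ t ∈ Icc 0 T, en A 0 (y t) ≤ K)
    (h : Filter.Tendsto (fun n => ∫⁻ t, en A 0 (Y n t - y t) ∂timeMeasure T) Filter.atTop (nhds 0))
    (k : Freq) {t : ℝ} (ht : t ∈ Icc 0 T) :
    Filter.Tendsto (fun n => ∫ s in 0..t, rhs A (F s) (Y n s) k) Filter.atTop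
      (nhds (∫ s in 0..t, rhs A (F s) (y s) k)) := by
  obtain ⟨C, hC, hle⟩ := exists_enorm_rhs_sub_sq_le A hK k
  have hmono : timeMeasure t ≤ timeMeasure T :=
    Measure.restrict_mono (Ioo_subset_Ioo_right ht.2) le_rfl
  have hYm : ∀ n, Integrable (fun s => rhs A (F s) (Y n s) k) (timeMeasure T) := fun n =>
    ((memEn_rhs hF hK (hYK n) (hY n)).memLp k).integrable (by norm_num)
  have hym : Integrable (fun s => rhs A (F s) (y s) k) (timeMeasure T) :=
    ((memEn_rhs hF hK hyK hy).memLp k).integrable (by norm_num)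
  simp only [intervalIntegral.integral_of_le ht.1, integral_Ioc_eq_integral_Ioo]
  refine tendsto_integral_of_L1 _ (hym.1.mono_measure hmono)
    (Filter.Eventually.of_forall fun n => (hYm n).mono_measure hmono) ?_
  have hbound : ∀ n, ∫⁻ s, ‖rhs A (F s) (Y n s) k - rhs A (F s) (y s) k‖ₑ ∂timeMeasure t
      ≤ (C * ∫⁻ s, en A 0 (Y n s - y s) ∂timeMeasure T) ^ (1 / 2 : ℝ)
        * timeMeasure T univ ^ (1 / 2 : ℝ) := by
    intro n
    refine (lintegral_mono' hmono le_rfl).trans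
      ((lintegral_le_sqrt_mul ((hYm n).1.sub hym.1).enorm).trans ?_)
    gcongr
    rw [← lintegral_const_mul' _ _ hC]
    exact lintegral_mono_ae (ae_timeMeasure_of_forall fun s hs => hle _ _ _ (hYK n s hs) (hyK s hs))
  refine tendsto_of_tendsto_of_tendsto_of_le_of_le tendsto_const_nhds ?_ (fun _ => zero_le) hbound
  have h1 := ENNReal.Tendsto.const_mul (a := C) h (Or.inr hC)
  rw [mul_zero] at h1
  have h2 := ((ENNReal.continuous_rpow_const (y := 1 / 2)).tendsto 0).comp h1
  rw [ENNReal.zero_rpow_of_pos (by norm_num)] at h2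
  have h3 := ENNReal.Tendsto.mul_const (b := timeMeasure T univ ^ (1 / 2 : ℝ)) h2
    (Or.inr (by simp))
  rwa [zero_mul] at h3

/-! ### Existence of solutions -/

theorem rhs_zero (A : HyperOp) (F : Freq → C3) : rhs A F 0 = F := by
  funext k
  simp [rhs, bil_zero]

theorem exists_norm_rhs_sub_le (A : HyperOp) {K : ℝ≥0∞} (hK : K ≠ ⊤) (k : Freq) :
    ∃ V : ℝ, ∀ F u : Freq → C3, en A 0 u ≤ K → ‖rhs A F u k - F k‖ ≤ V := by
  obtain ⟨C, hC, h⟩ := exists_enorm_rhs_sub_sq_le A hK k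
  refine ⟨√(C * K).toReal, fun F u hu => Real.le_sqrt_of_sq_le ?_⟩
  have h1 := h F u 0 hu (by simp [en])
  rw [rhs_zero, sub_zero] at h1
  have h2 := ENNReal.toReal_mono (ENNReal.mul_ne_top hC hK) (h1.trans (mul_le_mul' le_rfl hu))
  simpa using h2

/-- A subsequence of the Galerkin approximations converges in every mode at all times. -/
theorem exists_subseq_galerkin_tendsto {A : HyperOp} {T : ℝ} (hT : 0 < T) {F : ℝ → Freq → C3}
    {c : Freq → C3} (hF : MemEn A (-1 / 2) T F) {K : ℝ≥0∞} (hK : K ≠ ⊤) {Y : ℕ → ℝ → Freq → C3}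
    (hYK : ∀ n, ∀ t ∈ Icc 0 T, en A 0 (Y n t) ≤ K) (hY : ∀ n, MemEn A (1 / 2) T (Y n))
    (heq : ∀ n k, ∀ t ∈ Icc 0 T, Y n t k
      = trunc (freqBox n) c k + ∫ s in 0..t, trunc (freqBox n) (rhs A (F s) (Y n s)) k) :
    ∃ φ : ℕ → ℕ, StrictMono φ ∧ ∃ y : ℝ → Freq → C3, ∀ k, ∀ t ∈ Icc 0 T,
      Filter.Tendsto (fun n => Y (φ n) t k) Filter.atTop (nhds (y t k)) := by
  choose V hV using exists_norm_rhs_sub_le A hK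
  have hFi : ∀ n k, IntervalIntegrable (fun s => trunc (freqBox n) (F s) k) volume 0 T := fun n k =>
    (hF.trunc (s := 0) (freqBox n)).intervalIntegrable hT.le k
  have hri : ∀ n k, IntervalIntegrable (fun s => trunc (freqBox n) (rhs A (F s) (Y n s)) k)
      volume 0 T := fun n k =>
    ((memEn_rhs hF hK (hYK n) (hY n)).trunc (s := 0) (freqBox n)).intervalIntegrable hT.le k
  have hV0 : ∀ k, 0 ≤ V k := fun k => (norm_nonneg _).trans (hV k 0 0 (by simp [en]))
  set p : ℕ → Freq → ℝ → C3 := fun n k s =>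
    trunc (freqBox n) (rhs A (F s) (Y n s)) k - trunc (freqBox n) (F s) k
  have hpi : ∀ n k, IntervalIntegrable (p n k) volume 0 T := fun n k => (hri n k).sub (hFi n k)
  have hp : ∀ n k, ∀ s ∈ Icc 0 T, ‖p n k s‖ ≤ V k := by
    intro n k s hs
    by_cases hk : k ∈ freqBox n
    · simp only [p, trunc_of_mem hk]
      exact hV k _ _ (hYK n s hs)
    · simp only [p, trunc_of_notMem hk, sub_zero, norm_zero]
      exact hV0 k
  -- The part of the coefficients that is not the primitive of the force is Lipschitz continuous.
  set z : ℕ → Freq → ℝ → C3 := fun n k t => Y n t k - ∫ s in 0..t, trunc (freqBox n) (F s) k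
  have hz : ∀ n k, ∀ t ∈ Icc 0 T, z n k t = trunc (freqBox n) c k + ∫ s in 0..t, p n k s := by
    intro n k t ht
    simp only [z, p]
    rw [heq n k t ht, intervalIntegral.integral_sub (intervalIntegrable_of_mem (hri n k) ht)
      (intervalIntegrable_of_mem (hFi n k) ht)]
    abel
  have hL : ∀ n k, ∀ s ∈ Icc 0 T, ∀ t ∈ Icc 0 T, ‖z n k s - z n k t‖ ≤ V k * |s - t| := by
    intro n k s hs t ht
    rw [hz n k s hs, hz n k t ht, add_sub_add_left_eq_sub, intervalIntegral.integral_interval_sub_left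
      (intervalIntegrable_of_mem (hpi n k) hs) (intervalIntegrable_of_mem (hpi n k) ht)]
    refine intervalIntegral.norm_integral_le_of_norm_le_const fun r hr => hp n k r ?_
    have h1 := uIoc_subset_uIcc hr
    exact ⟨(le_min ht.1 hs.1).trans h1.1, h1.2.trans (max_le ht.2 hs.2)⟩
  have hB : ∀ n k, ∀ t ∈ Icc 0 T, ‖z n k t‖ ≤ ‖c k‖ + V k * T := by
    intro n k t ht
    have h1 := hL n k t ht 0 (left_mem_Icc.2 hT.le)
    rw [hz n k 0 (left_mem_Icc.2 hT.le), intervalIntegral.integral_same, add_zero, sub_zero,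
      abs_of_nonneg ht.1] at h1
    have h2 : ‖trunc (freqBox n) c k‖ ≤ ‖c k‖ := by
      by_cases hk : k ∈ freqBox n
      · rw [trunc_of_mem hk]
      · rw [trunc_of_notMem hk, norm_zero]
        exact norm_nonneg _
    have h3 := norm_le_norm_add_norm_sub' (z n k t) (trunc (freqBox n) c k)
    have h4 : V k * t ≤ V k * T := mul_le_mul_of_nonneg_left ht.2 (hV0 k)
    linarith
  obtain ⟨φ, hφ, Z, hZ⟩ := exists_subseq_tendsto hT.le hB hL
  refine ⟨φ, hφ, fun t k => Z k t + ∫ s in 0..t, F s k, fun k t ht => ?_⟩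
  have hev : ∀ᶠ n in Filter.atTop, k ∈ freqBox (φ n) :=
    ((tendsto_freqBox.comp hφ.tendsto_atTop).eventually
      (Filter.eventually_ge_atTop ({k} : Finset Freq))).mono fun n hn =>
        Finset.singleton_subset_iff.1 hn
  refine ((hZ k t ht).add_const _).congr' ?_
  filter_upwards [hev] with n hn
  simp only [z, trunc_of_mem hn]
  abel

/-- The equation for the Fourier coefficients has a solution. -/
theorem exists_isModalSolution {A : HyperOp} {T : ℝ} (hT : 0 < T) {F : ℝ → Freq → C3} {c : Freq → C3}
    (hF : MemEn A (-1 / 2) T F) (hFr : ∀ t, IsReal3 (F t)) (hc : IsReal3 c) (hc0 : en A 0 c < ⊤) :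
    ∃ y, IsModalSolution A T F c y := by
  obtain ⟨K, hK, hex⟩ := exists_galerkin hT hF hFr hc hc0
  choose Y hYr hYK hY hYi heq using fun n => hex (freqBox n) fun k => neg_mem_freqBox
  obtain ⟨φ, hφ, y, hlim⟩ := exists_subseq_galerkin_tendsto hT hF hK hYK hY heq
  have hyK : ∀ t ∈ Icc 0 T, en A 0 (y t) ≤ K := fun t ht =>
    en_le_of_tendsto (fun k => hlim k t ht) fun n => hYK (φ n) t ht
  have hyi : ∫⁻ t, en A (1 / 2) (y t) ∂timeMeasure T ≤ K :=
    calc _ ≤ ∫⁻ t, Filter.liminf (fun n => en A (1 / 2) (Y (φ n) t)) Filter.atTop ∂timeMeasure T :=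
          lintegral_mono_ae (ae_timeMeasure_of_forall fun t ht => en_le_liminf fun k => hlim k t ht)
      _ ≤ Filter.liminf (fun n => ∫⁻ t, en A (1 / 2) (Y (φ n) t) ∂timeMeasure T) Filter.atTop :=
          lintegral_liminf_le' fun n => aemeasurable_en (hY (φ n)).meas
      _ ≤ K := Filter.liminf_le_of_frequently_le' (Filter.Frequently.of_forall fun n => hYi (φ n))
  have hy : MemEn A (1 / 2) T y :=
    ⟨fun k => aestronglyMeasurable_of_tendsto_ae Filter.atTop (fun n => (hY (φ n)).meas k)
      (ae_timeMeasure_of_forall fun t ht => hlim k t ht), hyi.trans_lt hK.lt_top⟩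
  have hstrong := tendsto_lintegral_en_zero (w := fun n t => Y (φ n) t - y t) (K := 2 * (K + K))
    (by finiteness) (fun n => (hY (φ n)).sub hy)
    (fun n t ht => (en_sub_le A 0 _ _).trans (by
      gcongr
      · exact hYK (φ n) t ht
      · exact hyK t ht))
    (fun n => (lintegral_mono fun t => en_sub_le A (1 / 2) _ _).trans (by
      rw [lintegral_const_mul' _ _ (by simp), lintegral_add_right' _ (aemeasurable_en hy.meas)]
      gcongr
      exact hYi (φ n)))
    (fun k t ht => by simpa using (hlim k t ht).sub_const (y t k))
  refine ⟨y, fun t ht => .of_tendsto (fun n => hYr (φ n) t ht) fun k => hlim k t ht,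
    ⟨K, hK, hyK⟩, hy, fun k t ht => ?_⟩
  have h1 := (tendsto_integral_rhs hK hF (fun n => hY (φ n)) hy (fun n => hYK (φ n)) hyK hstrong k
    ht).const_add (c k)
  refine tendsto_nhds_unique (hlim k t ht) (h1.congr' ?_)
  have hev : ∀ᶠ n in Filter.atTop, k ∈ freqBox (φ n) :=
    ((tendsto_freqBox.comp hφ.tendsto_atTop).eventually
      (Filter.eventually_ge_atTop ({k} : Finset Freq))).mono fun n hn =>
        Finset.singleton_subset_iff.1 hn
  filter_upwards [hev] with n hn
  rw [heq (φ n) k t ht]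
  simp only [trunc_of_mem hn]

theorem dissipation_eq (A : HyperOp) (u : L2) :
    dissipation A u = 2 * pair (fun k => A.symbol k • fourier u k) (fourier u) := by
  simp only [dissipation, pair, re_inner_smul_self]

end HNS

end

theorem proposition4p6 (A : HNS.HyperOp) (T : ℝ) (hT : 0 < T) (u₀ : HNS.L2sigma)
    (f : ℝ → HNS.Dom A (-1 / 2)) (hf : MemLp f 2 (HNS.timeMeasure T)) :
    ∃ u : ℝ → HNS.L2sigma,
      HNS.IsStrongSolution A T u₀ f u ∧
      (∀ v : ℝ → HNS.L2sigma, HNS.IsStrongSolution A T u₀ f v → v =ᵐ[HNS.timeMeasure T] u) ∧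
      ContinuousOn u (Icc 0 T) ∧ u 0 = u₀ ∧
      ∀ t ∈ Ioc 0 T,
        ‖u t‖ ^ 2 + 2 * ∫ s in 0..t, HNS.dissipation A (u s) =
          ‖u 0‖ ^ 2 + 2 * ∫ s in 0..t, HNS.pairing (f s) (u s) := by
  have hF := HNS.memEn_of_memLp hf
  have hu₀ : HNS.en A 0 (HNS.fourier (u₀ : HNS.L2)) < ⊤ := by
    have h := HNS.en_zero_fourier A (u₀ : HNS.L2)
    have h1 : 2 * HNS.en A 0 (HNS.fourier (u₀ : HNS.L2)) < ⊤ := by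
      rw [h]
      finiteness
    exact (le_mul_of_one_le_left' (by norm_num)).trans_lt h1
  obtain ⟨y, hy⟩ := HNS.exists_isModalSolution hT hF (fun t => (f t).isReal3)
    (HNS.isReal3_fourier u₀.2) hu₀
  obtain ⟨u, hu, hcont, hu0, huy⟩ := hy.exists_isStrongSolution hT hf
  refine ⟨u, hu, fun v hv => ?_, hcont, hu0, fun t ht => ?_⟩
  · obtain ⟨w, hvw, hw⟩ := hv.exists_isModalSolution hT
    have huniq := hw.unique hT hF hy
    filter_upwards [hvw, HNS.ae_timeMeasure_of_forall huniq,
      HNS.ae_timeMeasure_of_forall huy] with s h1 h2 h3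
    rw [h1]
    exact Subtype.ext (HNS.fourier_injective (h2.trans h3.symm))
  · have ht' : t ∈ Icc 0 T := Ioc_subset_Icc_self ht
    have hsq : ∀ s ∈ Icc 0 T, ‖u s‖ ^ 2 = 2 * ∑' k, ‖y s k‖ ^ 2 := by
      intro s hs
      have h1 := HNS.hasSum_fourier_sq (u s : HNS.L2)
      rw [huy s hs] at h1
      rw [← tsum_mul_left]
      exact h1.tsum_eq.symm
    have e1 : ∫ s in 0..t, HNS.dissipation A (u s)
        = 2 * ∫ s in 0..t, HNS.pair (fun k => A.symbol k • y s k) (y s) := by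
      rw [← intervalIntegral.integral_const_mul]
      refine intervalIntegral.integral_congr fun s hs => ?_
      rw [uIcc_of_le ht'.1] at hs
      rw [HNS.dissipation_eq, huy s ⟨hs.1, hs.2.trans ht'.2⟩]
    have e2 : ∫ s in 0..t, HNS.pairing (f s) (u s) = 2 * ∫ s in 0..t, HNS.pair (f s).coef (y s) := by
      rw [← intervalIntegral.integral_const_mul]
      refine intervalIntegral.integral_congr fun s hs => ?_
      rw [uIcc_of_le ht'.1] at hs
      rw [HNS.pairing, HNS.pair, huy s ⟨hs.1, hs.2.trans ht'.2⟩]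
    have h := hy.energy hT hF ht'
    rw [hsq t ht', hsq 0 ⟨le_rfl, hT.le⟩, e1, e2]
    linear_combination 2 * h
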